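/- \textbf{Setting.} Let $T>0$, $n_x,n_u,n_d\ge 0$, and let $A,Q:[0,T]\to\mathbb R^{n_x\times n_x}$, $B:[0,T]\to\mathbb R^{n_x\times n_u}$, $C:[0,T]\to\mathbb R^{n_x\times n_d}$, $H:[0,T]\to\mathbb R^{n_u\times n_x}$, $R:[0,T]\to\mathbb R^{n_u\times n_u}$, $G:[0,T]\to\mathbb R^{n_d\times n_x}$, $W:[0,T]\to\mathbb R^{n_d\times n_u}$ be continuous, $Q_T\in\mathbb R^{n_x\times n_x}$, $G_T\in\mathbb R^{n_d\times n_x}$. For a bounded measurable $d:[0,T]\to\mathbb R^{n_d}$ and $d_0\in\mathbb R^{n_x}$, $d_T\in\mathbb R^{n_d}$ consider the problem of minimizing $$\frac12\int_0^T\begin{bmatrix}x\\u\\d\end{bmatrix}^{\top}\begin{bmatrix}Q&H^\top&G^\top\\H&R&W^\top\\G&W&0\end{bmatrix}\begin{bmatrix}x\\u\\d\end{bmatrix}dt+\frac12\begin{bmatrix}x(T)\\d_T\end{bmatrix}^{\top}\begin{bmatrix}Q_T&G_T^\top\\G_T&0\end{bmatrix}\begin{bmatrix}x(T)\\d_T\end{bmatrix}$$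 over all bounded measurable controls $u:[0,T]\to\mathbb R^{n_u}$ and the corresponding continuous states $x$ with $\dot x=Ax+Bu+Cd$, $x(0)=d_0$ (in integrated form). For an optimal pair $(x,u)$, its adjoint is the continuous solution (in integrated form) of $\dot\lambda=-(Qx+H^\top u+G^\top d+A^\top\lambda)$, $\lambda(T)=Q_Tx(T)+G_T^\top d_T$; we then call $(x,u,\lambda)$ an optimal triple for $(d,d_0,d_T)$. Let $\Phi_A(t,s)$ be the evolution operator of $\dot x=A(t)x$ and $W_{A,B}(t_0,t_1)=\int_{t_0}^{t_1}\Phi_A(t_0,s)B(s)B(s)^\top\Phi_A(t_0,s)^\top ds$ the controllability Gramian. Norms are Euclidean norms and the induced operator norms, and $\preceq$ is the Loewner order on symmetric matrices. \textbf{Assumptions}, with constants $\sigma,\alpha_0,\alpha_1,\beta_0,\beta_1,\lambda_A,\lambda_B,\lambda_C,\lambda_H,\lambda_R,\lambda_G,\lambda_W,\gamma_R>0$ and $\lambda_Q\ge\gamma_Q>0$: (i) $\|M(t)\|\le\lambda_M$ for all $t\in[0,T]$ and $M\in\{A,B,C,Q,H,R,G,W\}$, and $\|G_T\|\le\lambda_G$;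 (ii) $\sigma<T$, and for every $t_0\in[0,T-\sigma]$ there is $t_1\in[t_0,t_0+\sigma]$ with $\alpha_0I\preceq W_{A,B}(t_0,t_1)\preceq\alpha_1I$ and $\beta_0I\preceq\Phi_A(t_1,t_0)W_{A,B}(t_0,t_1)\Phi_A(t_1,t_0)^\top\preceq\beta_1I$; (iii) $R(t)\succeq\gamma_RI$ and $Q(t)-H(t)^\top R(t)^{-1}H(t)\succeq\gamma_QI$ for all $t\in[0,T]$, and $\gamma_QI\preceq Q_T\preceq\lambda_QI$. \textbf{Constants} (none of them depends on $T$). Put $\kappa=\lambda_A+\lambda_B\lambda_H/\gamma_R$, $$\alpha_0'=\Big(\tfrac{2}{\alpha_0}+\tfrac{\lambda_H^2}{\gamma_R^2\lambda_A}\big(1+\tfrac{\alpha_1}{\alpha_0}\big)^2(e^{2\lambda_A\sigma}-1)\Big)^{-1},\qquad \alpha_1'=\frac{\lambda_B^2(e^{2\kappa\sigma}-1)}{2\kappa},$$ $$\tilde\alpha_0=\frac{1-e^{-2\kappa\sigma}}{2\kappa},\qquad\tilde\alpha_1=\frac{e^{2\kappa\sigma}-1}{2\kappa},$$ $$c_0=\min\Big\{2\kappa\Big(\tfrac{\lambda_B^2}{\gamma_R}\big(1+\tfrac{\tilde\alpha_1}{\tilde\alpha_0}\big)^2+\tfrac1{\gamma_Q\tilde\alpha_0^2}\Big)^{-1},\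 \Big(\tfrac{\lambda_B^2}{2\gamma_R\kappa}+\tfrac1{\gamma_Q}\Big)^{-1}\Big\}e^{-2\kappa\sigma},$$ $$c_1=\max\Big\{\Big(\big(\lambda_Q+\tfrac{\lambda_H^2}{\gamma_R}\big)\big(1+\tfrac{\alpha_1'}{\alpha_0'}\big)^2+\tfrac{\lambda_R\lambda_B^2}{(\alpha_0')^2}\Big)\tfrac1{2\kappa},\ \big(\lambda_Q+\tfrac{\lambda_H^2}{\gamma_R}\big)\big(1+\tfrac1{2\kappa}\big)\Big\}e^{2\kappa\sigma},$$ $$c_Z=\sqrt{c_1/c_0},\qquad\rho_Z=\frac{\gamma_Q}{2c_1},\qquad\Lambda_b=\Big(1+\tfrac{\lambda_H}{\gamma_R}+\big(1+\tfrac{\lambda_B}{\gamma_R}\big)(c_1+\lambda_G)\Big)\max\Big\{c_Z,\ \frac{c_Z^2\lambda_B^2\lambda_G}{2\rho_Z\gamma_R}\Big\}.$$ \textbf{Theorem} \label{theorem:eds-for-boundary}. One has $\Lambda_b>0$ and $\rho_Z>0$, and under the assumptions above the following holds for every bounded measurable $d$. For all $d_0,d_T$ an optimal triple exists, and its control can be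 chosen continuous if $d$ is continuous. Moreover, for all $d_0,l_0\in\mathbb R^{n_x}$ and $d_T,l_T\in\mathbb R^{n_d}$, if $(x^*,u^*,\lambda^*)$ is an optimal triple for $(d,d_0,d_T)$ and $(x_p^*,u_p^*,\lambda_p^*)$ is one for $(d,d_0+l_0,d_T+l_T)$, then $$\|x_p^*(t)-x^*(t)\|+\|u_p^*(t)-u^*(t)\|+\|\lambda_p^*(t)-\lambda^*(t)\|\le\Lambda_b\left(\|l_0\|e^{-\rho_Zt}+\|l_T\|e^{-\rho_Z(T-t)}\right)$$ for almost every $t\in[0,T]$, and for every $t\in[0,T]$ if $u^*$ and $u_p^*$ are continuous on $[0,T]$. (In particular, taking $l_0=0$ and $l_T=0$, optimal triples are unique, the control up to null sets.) -/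

import Mathlib

open Set MeasureTheory
open scoped InnerProductSpace InnerProduct

noncomputable section

/-- The column vectors `ℝⁿ` with the Euclidean norm. -/
abbrev Vec (n : ℕ) : Type := EuclideanSpace ℝ (Fin n)

/-- Real `m × n` matrices, as linear maps `ℝⁿ → ℝᵐ`.  The norm is the operator norm for the Euclidean
norms, the adjoint `M†` is the transpose, and `M ≤ N` between square matrices is the Loewner order
(`N - M` is symmetric and positive semidefinite). -/
abbrev Mat (m n : ℕ) : Type := Vec n →L[ℝ] Vec m

/-! ### The evolution operator of `ẋ = A(t) x` and the controllability Gramian -/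

/-- The terms of the Peano–Baker series of `ẋ = A(t) x` started at time `s`:
`P₀(t) = I`, `Pₖ₊₁(t) = ∫ₛᵗ A(τ) Pₖ(τ) dτ`. -/
def peanoBakerTerm {n : ℕ} (A : ℝ → Mat n n) (s : ℝ) : ℕ → ℝ → Mat n n
  | 0, _ => 1
  | k + 1, t => ∫ τ in s..t, A τ * peanoBakerTerm A s k τ

/-- The linear evolution operator `Φ_A(t, s)` of `ẋ = A(t) x` (for `s ≤ t` and for `t ≤ s`). -/
def evolution {n : ℕ} (A : ℝ → Mat n n) (t s : ℝ) : Mat n n :=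
  ∑' k, peanoBakerTerm A s k t

theorem peanoBakerTerm_hasDerivAt {n : ℕ} {A : ℝ → Mat n n} (hA : Continuous A) (s : ℝ) (k : ℕ) :
    Continuous (peanoBakerTerm A s k) ∧
      ∀ t, HasDerivAt (peanoBakerTerm A s (k + 1)) (A t * peanoBakerTerm A s k t) t := by
  induction k with
  | zero =>
    have h0 : Continuous (peanoBakerTerm A s 0) := continuous_const
    exact ⟨h0, fun t => intervalIntegral.integral_hasDerivAt_right
      ((hA.mul h0).intervalIntegrable _ _) (hA.mul h0).aestronglyMeasurable.stronglyMeasurableAtFilter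
      (hA.mul h0).continuousAt⟩
  | succ k ih =>
    have h0 : Continuous (peanoBakerTerm A s (k + 1)) :=
      continuous_iff_continuousAt.2 fun t => (ih.2 t).continuousAt
    exact ⟨h0, fun t => intervalIntegral.integral_hasDerivAt_right
      ((hA.mul h0).intervalIntegrable _ _) (hA.mul h0).aestronglyMeasurable.stronglyMeasurableAtFilter
      (hA.mul h0).continuousAt⟩

theorem norm_peanoBakerTerm_le {n : ℕ} {A : ℝ → Mat n n} {M : ℝ} (hM : ∀ t, ‖A t‖ ≤ M)
    (s : ℝ) (k : ℕ) (t : ℝ) :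
    ‖peanoBakerTerm A s k t‖ ≤ (M * |t - s|) ^ k / (k.factorial : ℝ) := by
  have hM0 : 0 ≤ M := (norm_nonneg _).trans (hM 0)
  induction k generalizing t with
  | zero =>
    have h1 : ‖(1 : Mat n n)‖ ≤ 1 := ContinuousLinearMap.norm_id_le
    simpa [peanoBakerTerm] using h1
  | succ k ih =>
    have hb : ∀ τ, ‖A τ * peanoBakerTerm A s k τ‖ ≤
        M ^ (k + 1) / (k.factorial : ℝ) * |τ - s| ^ k := by
      intro τ
      refine (norm_mul_le _ _).trans ((mul_le_mul (hM τ) (ih τ) (norm_nonneg _) hM0).trans_eq ?_)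
      rw [mul_pow]; ring
    have hint : IntervalIntegrable (fun τ => M ^ (k + 1) / (k.factorial : ℝ) * |τ - s| ^ k)
        volume s t := by
      apply Continuous.intervalIntegrable
      fun_prop
    calc ‖peanoBakerTerm A s (k + 1) t‖
        ≤ ∫ τ in uIoc s t, ‖A τ * peanoBakerTerm A s k τ‖ :=
          intervalIntegral.norm_integral_le_integral_norm_uIoc
      _ ≤ ∫ τ in uIoc s t, M ^ (k + 1) / (k.factorial : ℝ) * |τ - s| ^ k :=
          integral_mono_of_nonneg (Filter.Eventually.of_forall fun _ => norm_nonneg _)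
            hint.def' (Filter.Eventually.of_forall hb)
      _ = (M * |t - s|) ^ (k + 1) / ((k + 1).factorial : ℝ) := by
          rw [integral_const_mul, integral_pow_abs_sub_uIoc, mul_pow, Nat.factorial_succ]
          push_cast
          field_simp

theorem evolution_self {n : ℕ} (A : ℝ → Mat n n) (s : ℝ) : evolution A s s = 1 := by
  rw [evolution, tsum_eq_single 0]
  · rfl
  · rintro (_ | k) hk
    · exact absurd rfl hk
    · simp [peanoBakerTerm]

theorem evolution_hasDerivAt_of_bounded {n : ℕ} {A : ℝ → Mat n n} (hA : Continuous A) {M : ℝ}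
    (hM : ∀ t, ‖A t‖ ≤ M) (s t : ℝ) :
    HasDerivAt (fun r => evolution A r s) (A t * evolution A t s) t := by
  have hM0 : 0 ≤ M := (norm_nonneg _).trans (hM 0)
  have hsum : ∀ r, Summable fun k => peanoBakerTerm A s k r := fun r =>
    Summable.of_norm_bounded (Real.summable_pow_div_factorial (M * |r - s|))
      fun k => norm_peanoBakerTerm_le hM s k r
  set ρ : ℝ := |t - s| + 1 with hρ
  have hsum0 : Summable fun k => peanoBakerTerm A s (k + 1) s :=
    (summable_nat_add_iff (f := fun k => peanoBakerTerm A s k s) 1).2 (hsum s)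
  have hu : Summable fun k : ℕ => M * ((M * ρ) ^ k / (k.factorial : ℝ)) :=
    (Real.summable_pow_div_factorial (M * ρ)).mul_left M
  have hmem : s ∈ Metric.ball s ρ := Metric.mem_ball_self (by positivity)
  have key : HasDerivAt (fun r => ∑' k, peanoBakerTerm A s (k + 1) r)
      (∑' k, A t * peanoBakerTerm A s k t) t := by
    refine hasDerivAt_tsum_of_isPreconnected
      (g := fun k r => peanoBakerTerm A s (k + 1) r)
      (g' := fun k r => A r * peanoBakerTerm A s k r) hu Metric.isOpen_ball
      (convex_ball s ρ).isPreconnected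
      (fun k r _ => (peanoBakerTerm_hasDerivAt hA s k).2 r) (fun k r hr => ?_)
      hmem hsum0 ?_
    · refine (norm_mul_le _ _).trans (mul_le_mul (hM r) ?_ (norm_nonneg _) hM0)
      refine (norm_peanoBakerTerm_le hM s k r).trans ?_
      have : |r - s| ≤ ρ := by
        have := Metric.mem_ball.1 hr
        rw [Real.dist_eq] at this
        exact this.le
      gcongr
    · rw [Metric.mem_ball, Real.dist_eq]
      linarith
  rw [(hsum t).tsum_mul_left] at key
  have heq : (fun r => evolution A r s) = fun r => 1 + ∑' k, peanoBakerTerm A s (k + 1) r := by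
    funext r
    rw [evolution, (hsum r).tsum_eq_zero_add]
    rfl
  rw [heq]
  exact key.const_add 1

theorem evolution_congr {n : ℕ} {A A' : ℝ → Mat n n} {T : ℝ} (h : EqOn A A' (Icc 0 T))
    {s t : ℝ} (hs : s ∈ Icc 0 T) (ht : t ∈ Icc 0 T) : evolution A t s = evolution A' t s := by
  have hk : ∀ k, ∀ r ∈ Icc 0 T, peanoBakerTerm A s k r = peanoBakerTerm A' s k r := by
    intro k
    induction k with
    | zero => intro r _; rfl
    | succ k ih =>
      intro r hr
      refine intervalIntegral.integral_congr fun τ hτ => ?_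
      have hτ' : τ ∈ Icc 0 T := (uIcc_subset_Icc hs hr) hτ
      simp only [h hτ', ih τ hτ']
  exact tsum_congr fun k => hk k t ht

/-- `Φ_A(·, s)` solves `ẋ = A(t) x` on `[0, T]`, with value `I` at `s` (`evolution_self`). -/
theorem evolution_hasDerivWithinAt {n : ℕ} {A : ℝ → Mat n n} {T : ℝ}
    (hA : ContinuousOn A (Icc 0 T)) {s t : ℝ} (hs : s ∈ Icc 0 T) (ht : t ∈ Icc 0 T) :
    HasDerivWithinAt (fun r => evolution A r s) (A t * evolution A t s) (Icc 0 T) t := by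
  have hT : (0 : ℝ) ≤ T := ht.1.trans ht.2
  set A' : ℝ → Mat n n := IccExtend hT ((Icc 0 T).domRestrict A) with hA'
  have hcont : Continuous A' := (continuousOn_iff_continuous_domRestrict.1 hA).Icc_extend'
  have heq : EqOn A A' (Icc 0 T) := fun r hr => by
    rw [hA', IccExtend_of_mem hT _ hr, domRestrict_apply]
  obtain ⟨M, hM⟩ := isCompact_Icc.exists_bound_of_continuousOn hA
  have hM' : ∀ r, ‖A' r‖ ≤ M := fun r => hM _ (projIcc 0 T hT r).2
  have hd := (evolution_hasDerivAt_of_bounded hcont hM' s t).hasDerivWithinAt (s := Icc 0 T)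
  rw [heq ht, evolution_congr heq hs ht]
  exact hd.congr (fun r hr => evolution_congr heq hs hr) (evolution_congr heq hs ht)

/-- The controllability Gramian
`W_{A,B}(t₀, t₁) = ∫_{t₀}^{t₁} Φ_A(t₀, s) B(s) B(s)ᵀ Φ_A(t₀, s)ᵀ ds`. -/
def gramian {n m : ℕ} (A : ℝ → Mat n n) (B : ℝ → Mat n m) (t₀ t₁ : ℝ) : Mat n n :=
  ∫ s in t₀..t₁, evolution A t₀ s ∘L B s ∘L (B s)† ∘L (evolution A t₀ s)†

/-! ### The parameterized linear-quadratic problem -/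

/-- The horizon and the coefficients of the parameterized linear-quadratic problem.  Only the values
of the time-dependent matrices on `[0, T]` matter. -/
structure LQProblem (nx nu nd : ℕ) where
  T : ℝ
  A : ℝ → Mat nx nx
  B : ℝ → Mat nx nu
  C : ℝ → Mat nx nd
  Q : ℝ → Mat nx nx
  H : ℝ → Mat nu nx
  R : ℝ → Mat nu nu
  G : ℝ → Mat nd nx
  W : ℝ → Mat nd nu
  QT : Mat nx nx
  GT : Mat nd nx

namespace LQProblem

variable {nx nu nd : ℕ}

/-- `f` is a bounded measurable function on `[0, T]`. -/
def IsBoundedInput (P : LQProblem nx nu nd) {m : ℕ} (f : ℝ → Vec m) : Prop :=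
  AEStronglyMeasurable f (volume.restrict (Icc 0 P.T)) ∧ ∃ M, ∀ t ∈ Icc 0 P.T, ‖f t‖ ≤ M

/-- The objective
`½ ∫₀ᵀ [x; u; d]ᵀ [Q Hᵀ Gᵀ; H R Wᵀ; G W 0] [x; u; d] dt`
`  + ½ [x(T); d_T]ᵀ [Q_T G_Tᵀ; G_T 0] [x(T); d_T]`. -/
def cost (P : LQProblem nx nu nd) (d : ℝ → Vec nd) (dT : Vec nd)
    (x : ℝ → Vec nx) (u : ℝ → Vec nu) : ℝ :=
  (1 / 2) * (∫ t in (0 : ℝ)..P.T,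
      (⟪x t, P.Q t (x t) + ((P.H t)†) (u t) + ((P.G t)†) (d t)⟫_ℝ
        + ⟪u t, P.H t (x t) + P.R t (u t) + ((P.W t)†) (d t)⟫_ℝ
        + ⟪d t, P.G t (x t) + P.W t (u t)⟫_ℝ))
    + (1 / 2) * (⟪x P.T, P.QT (x P.T) + (P.GT†) dT⟫_ℝ + ⟪dT, P.GT (x P.T)⟫_ℝ)

/-- `(x, u)` is admissible: `u` is bounded and measurable, and `x` is the continuous solution of
`ẋ = A x + B u + C d`, `x(0) = d₀`, on `[0, T]` (in integrated form). -/
structure IsAdmissible (P : LQProblem nx nu nd) (d : ℝ → Vec nd) (d0 : Vec nx)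
    (x : ℝ → Vec nx) (u : ℝ → Vec nu) : Prop where
  control : P.IsBoundedInput u
  continuousOn : ContinuousOn x (Icc 0 P.T)
  dynamics : ∀ t ∈ Icc 0 P.T,
    x t = d0 + ∫ s in (0 : ℝ)..t, (P.A s (x s) + P.B s (u s) + P.C s (d s))

/-- `(x, u, p)` is an optimal state, control and adjoint for the parameters `(d, d₀, d_T)`: the pair
`(x, u)` minimizes the objective among all admissible pairs, and `p` is the continuous solution of
the adjoint equation `ṗ = -(Q x + Hᵀ u + Gᵀ d + Aᵀ p)`, `p(T) = Q_T x(T) + G_Tᵀ d_T`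
(in integrated form). -/
structure IsOptimal (P : LQProblem nx nu nd) (d : ℝ → Vec nd) (d0 : Vec nx) (dT : Vec nd)
    (x : ℝ → Vec nx) (u : ℝ → Vec nu) (p : ℝ → Vec nx) : Prop where
  admissible : P.IsAdmissible d d0 x u
  optimal : ∀ (y : ℝ → Vec nx) (w : ℝ → Vec nu), P.IsAdmissible d d0 y w →
    P.cost d dT x u ≤ P.cost d dT y w
  adjoint_continuousOn : ContinuousOn p (Icc 0 P.T)
  adjoint_equation : ∀ t ∈ Icc 0 P.T,
    p t = P.QT (x P.T) + (P.GT†) dT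
      + ∫ s in t..P.T, (P.Q s (x s) + ((P.H s)†) (u s) + ((P.G s)†) (d s) + ((P.A s)†) (p s))

end LQProblem

/-! ### The constants -/

/-- The constants in the assumptions; the horizon `T` is not among them. -/
structure LQConstants where
  (σ α₀ α₁ β₀ β₁ lamA lamB lamC lamQ lamH lamR lamG lamW γQ γR : ℝ)
  σ_pos : 0 < σ
  α₀_pos : 0 < α₀
  α₁_pos : 0 < α₁
  β₀_pos : 0 < β₀
  β₁_pos : 0 < β₁
  lamA_pos : 0 < lamA
  lamB_pos : 0 < lamB
  lamC_pos : 0 < lamC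
  lamH_pos : 0 < lamH
  lamR_pos : 0 < lamR
  lamG_pos : 0 < lamG
  lamW_pos : 0 < lamW
  γQ_pos : 0 < γQ
  γR_pos : 0 < γR
  γQ_le_lamQ : γQ ≤ lamQ

namespace LQConstants

/-- `κ = λ_A + λ_B λ_H / γ_R`, a bound for `‖A - B R⁻¹ H‖`. -/
def kappa (c : LQConstants) : ℝ := c.lamA + c.lamB * c.lamH / c.γR

/-- The lower Gramian bound `α₀'(σ)` for the pair `(A - B R⁻¹ H, B)`. -/
def α₀' (c : LQConstants) : ℝ :=
  (2 / c.α₀ + (c.lamH / c.γR) ^ 2 / c.lamA * (1 + c.α₁ / c.α₀) ^ 2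
    * (Real.exp (2 * c.lamA * c.σ) - 1))⁻¹

/-- The upper Gramian bound `α₁'(σ)` for the pair `(A - B R⁻¹ H, B)`. -/
def α₁' (c : LQConstants) : ℝ :=
  c.lamB ^ 2 * (Real.exp (2 * c.σ * c.kappa) - 1) / (2 * c.kappa)

/-- The lower Gramian bound `α̃₀(σ)` for the dual pair. -/
def αt₀ (c : LQConstants) : ℝ := 1 / (2 * c.kappa) * (1 - Real.exp (-2 * c.kappa * c.σ))

/-- The upper Gramian bound `α̃₁(σ)` for the dual pair. -/
def αt₁ (c : LQConstants) : ℝ := 1 / (2 * c.kappa) * (Real.exp (2 * c.kappa * c.σ) - 1)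

/-- The lower bound `c₀(σ)` for the Riccati matrix. -/
def c₀ (c : LQConstants) : ℝ :=
  min (2 * c.kappa * (c.lamB ^ 2 / c.γR * (1 + c.αt₁ / c.αt₀) ^ 2 + 1 / (c.γQ * c.αt₀ ^ 2))⁻¹)
      (c.lamB ^ 2 / (2 * c.γR * c.kappa) + 1 / c.γQ)⁻¹
    * Real.exp (-2 * c.kappa * c.σ)

/-- The upper bound `c₁(σ)` for the Riccati matrix. -/
def c₁ (c : LQConstants) : ℝ :=
  max (((c.lamQ + c.lamH ^ 2 / c.γR) * (1 + c.α₁' / c.α₀') ^ 2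
        + c.lamR * c.lamB ^ 2 / c.α₀' ^ 2) * (1 / (2 * c.kappa)))
      ((c.lamQ + c.lamH ^ 2 / c.γR) * (1 + 1 / (2 * c.kappa)))
    * Real.exp (2 * c.kappa * c.σ)

/-- `c_Z(σ) = √(c₁(σ) / c₀(σ))`. -/
def cZ (c : LQConstants) : ℝ := Real.sqrt (c.c₁ / c.c₀)

/-- The decay rate `ρ_Z(σ) = γ_Q / (2 c₁(σ))`. -/
def ρZ (c : LQConstants) : ℝ := c.γQ / (2 * c.c₁)

/-- The sensitivity constant `Λ_b(σ)`. -/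
def Lamb (c : LQConstants) : ℝ :=
  (1 + c.lamH / c.γR + (1 + c.lamB / c.γR) * (c.c₁ + c.lamG))
    * max c.cZ (c.cZ ^ 2 * c.lamB ^ 2 * c.lamG / (2 * c.ρZ * c.γR))

end LQConstants

/-! ### The standing assumptions -/

/-- Boundedness, uniform complete controllability and coercivity, with the constants `c`. -/
structure LQProblem.Assumptions {nx nu nd : ℕ} (P : LQProblem nx nu nd) (c : LQConstants) :
    Prop where
  σ_lt_T : c.σ < P.T
  -- continuity and boundedness of the coefficients
  contA : ContinuousOn P.A (Icc 0 P.T)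
  contB : ContinuousOn P.B (Icc 0 P.T)
  contC : ContinuousOn P.C (Icc 0 P.T)
  contQ : ContinuousOn P.Q (Icc 0 P.T)
  contH : ContinuousOn P.H (Icc 0 P.T)
  contR : ContinuousOn P.R (Icc 0 P.T)
  contG : ContinuousOn P.G (Icc 0 P.T)
  contW : ContinuousOn P.W (Icc 0 P.T)
  boundA : ∀ t ∈ Icc 0 P.T, ‖P.A t‖ ≤ c.lamA
  boundB : ∀ t ∈ Icc 0 P.T, ‖P.B t‖ ≤ c.lamB
  boundC : ∀ t ∈ Icc 0 P.T, ‖P.C t‖ ≤ c.lamC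
  boundQ : ∀ t ∈ Icc 0 P.T, ‖P.Q t‖ ≤ c.lamQ
  boundH : ∀ t ∈ Icc 0 P.T, ‖P.H t‖ ≤ c.lamH
  boundR : ∀ t ∈ Icc 0 P.T, ‖P.R t‖ ≤ c.lamR
  boundG : ∀ t ∈ Icc 0 P.T, ‖P.G t‖ ≤ c.lamG
  boundW : ∀ t ∈ Icc 0 P.T, ‖P.W t‖ ≤ c.lamW
  boundGT : ‖P.GT‖ ≤ c.lamG
  -- uniform complete controllability
  controllable : ∀ t₀ ∈ Icc 0 (P.T - c.σ), ∃ t₁ ∈ Icc t₀ (t₀ + c.σ),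
    c.α₀ • (1 : Mat nx nx) ≤ gramian P.A P.B t₀ t₁ ∧
    gramian P.A P.B t₀ t₁ ≤ c.α₁ • (1 : Mat nx nx) ∧
    c.β₀ • (1 : Mat nx nx) ≤
      evolution P.A t₁ t₀ ∘L gramian P.A P.B t₀ t₁ ∘L (evolution P.A t₁ t₀)† ∧
    evolution P.A t₁ t₀ ∘L gramian P.A P.B t₀ t₁ ∘L (evolution P.A t₁ t₀)† ≤
      c.β₁ • (1 : Mat nx nx)
  -- coercivity
  coerciveR : ∀ t ∈ Icc 0 P.T, c.γR • (1 : Mat nu nu) ≤ P.R t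
  coerciveQ : ∀ t ∈ Icc 0 P.T,
    c.γQ • (1 : Mat nx nx) ≤ P.Q t - (P.H t)† ∘L (P.R t).inverse ∘L P.H t
  coerciveQT : c.γQ • (1 : Mat nx nx) ≤ P.QT
  boundQT : P.QT ≤ c.lamQ • (1 : Mat nx nx)

end

/-! Stationarity gives u = -R⁻¹(Hx + Bᵀp + Wᵀd). Eliminating u leaves a linear Hamiltonian boundary
value problem for (x, p) with the reduced coefficients At = A - BR⁻¹H, Qt = Q - HᵀR⁻¹H and S =
BR⁻¹Bᵀ; its solutions are called extremals. The cost is quadratic, so its expansion about an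
extremal is exact: the linear part vanishes after integration by parts and a positive second
variation remains (`cost_eq_add`). Hence extremals are optimal, and every optimal triple agrees with
the extremal (`eq_of_isOptimal`). Only extremals need to be estimated.

The difference (ξ, q) of two extremals with the same d solves the homogeneous system with ξ(0) = l₀
and q(T) = Q_T ξ(T) + g, where g = G_Tᵀ l_T. Let (X, Y) be the fundamental pair with X(T) = I, Y(T)
= Q_T. Along its solutions (x, y) = (Xb, Yb) the value ⟨y, x⟩ decreases at rate at least γ_Q‖x‖² and
is positive at T for b ≠ 0. So X is invertible on the horizon, and YX⁻¹ is the Riccati matrix. It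
lies between c₀ and c₁ uniformly in T. The upper bound (`value_le`) comes from competitors steered
to the origin within time σ, since controllability passes from (A, B) to (At, B)
(`gramian_At_bounds`). The lower bound (`le_value`) is dual: the state is paired with a solution of
the adjoint equation. The value is then a strict Lyapunov function, and X(t)X(s)⁻¹ decays with
constants c_Z and ρ_Z (`norm_le_decay`).

Finally put r = q - YX⁻¹ξ. Conservation of the symplectic pairing shows that r(t) is g transported
by the transpose of the decaying closed loop, so it is of size e^{-ρ_Z(T-t)}
(`norm_costate_sub_feedback_le`). Since (X⁻¹ξ)' = -X⁻¹Sr, variation of constants bounds ξ by a term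
from l₀ and a term from g (`norm_state_le`); q = r + YX⁻¹ξ and the control formula give the rest. -/

noncomputable section

/-! ### Volterra equations, growth bounds and integration by parts. -/

section Generalities

variable {E F : Type*} [NormedAddCommGroup E] [NormedAddCommGroup F]

/-- A symmetric positive semidefinite operator with quadratic form at most `c‖x‖²` has norm at
most `c`. -/
theorem norm_apply_le_of_inner_le [InnerProductSpace ℝ E] {S : E → E}
    (hadd : ∀ (x y : E) (r : ℝ), S (x - r • y) = S x - r • S y) {c : ℝ} (hc : 0 < c)
    (hs : ∀ x y, ⟪S x, y⟫_ℝ = ⟪x, S y⟫_ℝ) (h0 : ∀ x, 0 ≤ ⟪S x, x⟫_ℝ)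
    (h1 : ∀ x, ⟪S x, x⟫_ℝ ≤ c * ‖x‖ ^ 2) (x : E) : ‖S x‖ ≤ c * ‖x‖ := by
  -- Positivity at x - c⁻¹Sx, with the bound applied at Sx, yields ‖Sx‖² ≤ c⟨Sx, x⟩ without any
  -- spectral theory.
  have h2 := h0 (x - c⁻¹ • S x)
  rw [hadd] at h2
  simp only [inner_sub_left, inner_sub_right, inner_smul_left, inner_smul_right,
    RCLike.conj_to_real] at h2
  rw [hs (S x) x, real_inner_self_eq_norm_sq] at h2
  have h3 := h1 (S x)
  have h4 := h1 x
  have hc' : 0 < c⁻¹ := inv_pos.2 hc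
  have h5 : c⁻¹ * (c⁻¹ * ⟪S (S x), S x⟫_ℝ) ≤ c⁻¹ * ‖S x‖ ^ 2 := by
    refine mul_le_mul_of_nonneg_left ?_ hc'.le
    rw [inv_mul_le_iff₀ hc]
    exact h3
  have h6 : c⁻¹ * ‖S x‖ ^ 2 ≤ c * ‖x‖ ^ 2 := by linarith
  rw [inv_mul_le_iff₀ hc] at h6
  exact abs_le_of_sq_le_sq' (by nlinarith) (by positivity) |>.2

/-- The terms of the Neumann series of the Volterra equation `z = h + ∫ₛ M z`. -/
def volterraTerm [NormedSpace ℝ E] (M : ℝ → E →L[ℝ] E) (h : ℝ → E) (s : ℝ) : ℕ → ℝ → E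
  | 0, t => h t
  | k + 1, t => ∫ τ in s..t, M τ (volterraTerm M h s k τ)

theorem volterraTerm_hasDerivAt [NormedSpace ℝ E] [CompleteSpace E] {M : ℝ → E →L[ℝ] E}
    (hM : Continuous M) {h : ℝ → E} (hh : Continuous h) (s : ℝ) (k : ℕ) :
    Continuous (volterraTerm M h s k) ∧
      ∀ t, HasDerivAt (volterraTerm M h s (k + 1)) (M t (volterraTerm M h s k t)) t := by
  have step : ∀ f : ℝ → E, Continuous f →
      ∀ t, HasDerivAt (fun t => ∫ τ in s..t, M τ (f τ)) (M t (f t)) t := fun f hf t =>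
    intervalIntegral.integral_hasDerivAt_right ((hM.clm_apply hf).intervalIntegrable _ _)
      (hM.clm_apply hf).aestronglyMeasurable.stronglyMeasurableAtFilter
      (hM.clm_apply hf).continuousAt
  induction k with
  | zero => exact ⟨hh, step _ hh⟩
  | succ k ih =>
    have h0 : Continuous (volterraTerm M h s (k + 1)) :=
      continuous_iff_continuousAt.2 fun t => (ih.2 t).continuousAt
    exact ⟨h0, step _ h0⟩

/-- The k! gained from k nested integrations makes the Neumann series converge on every interval,
with no smallness of K. -/
theorem norm_volterraTerm_le [NormedSpace ℝ E] {M : ℝ → E →L[ℝ] E} {K : ℝ}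
    (hK : ∀ t, ‖M t‖ ≤ K) {h : ℝ → E} {D : ℝ} (hD : ∀ t, ‖h t‖ ≤ D) (s : ℝ) (k : ℕ) (t : ℝ) :
    ‖volterraTerm M h s k t‖ ≤ D * ((K * |t - s|) ^ k / (k.factorial : ℝ)) := by
  have hK0 : 0 ≤ K := (norm_nonneg _).trans (hK 0)
  induction k generalizing t with
  | zero => simpa [volterraTerm] using hD t
  | succ k ih =>
    have hb : ∀ τ, ‖M τ (volterraTerm M h s k τ)‖ ≤
        D * K ^ (k + 1) / (k.factorial : ℝ) * |τ - s| ^ k := by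
      intro τ
      refine ((M τ).le_opNorm _).trans
        ((mul_le_mul (hK τ) (ih τ) (norm_nonneg _) hK0).trans_eq ?_)
      rw [mul_pow]; ring
    have hint : IntervalIntegrable (fun τ => D * K ^ (k + 1) / (k.factorial : ℝ) * |τ - s| ^ k)
        volume s t := by
      apply Continuous.intervalIntegrable
      fun_prop
    calc ‖volterraTerm M h s (k + 1) t‖
        ≤ ∫ τ in uIoc s t, ‖M τ (volterraTerm M h s k τ)‖ :=
          intervalIntegral.norm_integral_le_integral_norm_uIoc
      _ ≤ ∫ τ in uIoc s t, D * K ^ (k + 1) / (k.factorial : ℝ) * |τ - s| ^ k :=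
          integral_mono_of_nonneg (Filter.Eventually.of_forall fun _ => norm_nonneg _)
            hint.def' (Filter.Eventually.of_forall hb)
      _ = D * ((K * |t - s|) ^ (k + 1) / ((k + 1).factorial : ℝ)) := by
          rw [integral_const_mul, integral_pow_abs_sub_uIoc, mul_pow, Nat.factorial_succ]
          push_cast
          field_simp

/-- Solvability of linear Volterra equations with a bounded continuous right-hand side. -/
theorem exists_volterra_solution [NormedSpace ℝ E] [CompleteSpace E] {M : ℝ → E →L[ℝ] E}
    (hM : Continuous M) {K : ℝ} (hK : ∀ t, ‖M t‖ ≤ K) {h : ℝ → E} (hh : Continuous h) {D : ℝ}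
    (hD : ∀ t, ‖h t‖ ≤ D) (s : ℝ) :
    ∃ z : ℝ → E, Continuous z ∧ ∀ t, z t = h t + ∫ τ in s..t, M τ (z τ) := by
  have hK0 : 0 ≤ K := (norm_nonneg _).trans (hK 0)
  have hD0 : 0 ≤ D := (norm_nonneg _).trans (hD 0)
  have hsum : ∀ r, Summable fun k => volterraTerm M h s k r := fun r =>
    Summable.of_norm_bounded ((Real.summable_pow_div_factorial (K * |r - s|)).mul_left D)
      fun k => norm_volterraTerm_le hK hD s k r
  have hsum0 : Summable fun k => volterraTerm M h s (k + 1) s :=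
    (summable_nat_add_iff (f := fun k => volterraTerm M h s k s) 1).2 (hsum s)
  have key : ∀ t, HasDerivAt (fun r => ∑' k, volterraTerm M h s (k + 1) r)
      (∑' k, M t (volterraTerm M h s k t)) t := by
    intro t
    set ρ : ℝ := |t - s| + 1 with hρ
    have hu : Summable fun k : ℕ => K * (D * ((K * ρ) ^ k / (k.factorial : ℝ))) :=
      ((Real.summable_pow_div_factorial (K * ρ)).mul_left D).mul_left K
    have hmem : s ∈ Metric.ball s ρ := Metric.mem_ball_self (by positivity)
    refine hasDerivAt_tsum_of_isPreconnected
      (g := fun k r => volterraTerm M h s (k + 1) r)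
      (g' := fun k r => M r (volterraTerm M h s k r)) hu Metric.isOpen_ball
      (convex_ball s ρ).isPreconnected
      (fun k r _ => (volterraTerm_hasDerivAt hM hh s k).2 r) (fun k r hr => ?_)
      hmem hsum0 ?_
    · refine ((M r).le_opNorm _).trans (mul_le_mul (hK r) ?_ (norm_nonneg _) hK0)
      refine (norm_volterraTerm_le hK hD s k r).trans ?_
      have : |r - s| ≤ ρ := by
        have := Metric.mem_ball.1 hr
        rw [Real.dist_eq] at this
        exact this.le
      gcongr
    · rw [Metric.mem_ball, Real.dist_eq]
      linarith
  have hz : ∀ t, ∑' k, volterraTerm M h s k t = h t + ∑' k, volterraTerm M h s (k + 1) t :=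
    fun t => (hsum t).tsum_eq_zero_add
  have hMz : ∀ t, ∑' k, M t (volterraTerm M h s k t) = M t (∑' k, volterraTerm M h s k t) :=
    fun t => ((M t).map_tsum (hsum t)).symm
  have hcont : Continuous fun t => ∑' k, volterraTerm M h s k t := by
    simp_rw [hz]
    exact hh.add (continuous_iff_continuousAt.2 fun t => (key t).continuousAt)
  refine ⟨fun t => ∑' k, volterraTerm M h s k t, hcont, fun t => ?_⟩
  have hftc := intervalIntegral.integral_eq_sub_of_hasDerivAt (a := s) (b := t)
    (fun r _ => (hMz r) ▸ key r) ((hM.clm_apply hcont).intervalIntegrable _ _)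
  have h0 : ∑' k, volterraTerm M h s (k + 1) s = 0 := by simp [volterraTerm]
  rw [hftc, h0, sub_zero]
  exact hz t

/-- Exponential growth bound for `x' = f` with `‖f‖ ≤ K ‖x‖`. -/
theorem norm_le_exp_mul_of_hasDerivAt [NormedSpace ℝ E] {x f : ℝ → E} {K t₀ t₁ : ℝ}
    (hx : ∀ t ∈ Icc t₀ t₁, HasDerivAt x (f t) t) (hf : ∀ t ∈ Icc t₀ t₁, ‖f t‖ ≤ K * ‖x t‖)
    {t : ℝ} (ht : t ∈ Icc t₀ t₁) : ‖x t‖ ≤ Real.exp (K * (t - t₀)) * ‖x t₀‖ := by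
  have := norm_le_gronwallBound_of_norm_deriv_right_le (f := x) (f' := f) (δ := ‖x t₀‖) (K := K)
    (ε := 0) (a := t₀) (b := t₁) (fun r hr => (hx r hr).continuousAt.continuousWithinAt)
    (fun r hr => (hx r (Ico_subset_Icc_self hr)).hasDerivWithinAt) le_rfl
    (fun r hr => by simpa using hf r (Ico_subset_Icc_self hr)) t ht
  rwa [gronwallBound_ε0, mul_comm] at this

theorem norm_primitive_sub_le [NormedSpace ℝ E] {f x : ℝ → E} {T K : ℝ}
    (hf : IntervalIntegrable f volume 0 T)
    (hfK : ∀ t ∈ Icc 0 T, ‖f t‖ ≤ K) (hx : ∀ t ∈ Icc 0 T, x t = x 0 + ∫ s in (0 : ℝ)..t, f s)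
    {s t : ℝ} (hs : s ∈ Icc 0 T) (ht : t ∈ Icc 0 T) : ‖x s - x t‖ ≤ K * |s - t| := by
  have hT : 0 ≤ T := hs.1.trans hs.2
  have hI : ∀ r ∈ Icc 0 T, IntervalIntegrable f volume 0 r := fun r hr =>
    hf.mono_set (by rw [uIcc_of_le hr.1, uIcc_of_le hT]; exact Icc_subset_Icc_right hr.2)
  rw [hx s hs, hx t ht, add_sub_add_left_eq_sub,
    intervalIntegral.integral_interval_sub_left (hI s hs) (hI t ht)]
  refine intervalIntegral.norm_integral_le_of_norm_le_const fun r hr => hfK r ?_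
  exact uIcc_subset_Icc ht hs (uIoc_subset_uIcc hr)

/-- Integration by parts for primitives of bounded functions. -/
theorem integral_inner_add_inner_primitive [InnerProductSpace ℝ E] [FiniteDimensional ℝ E]
    {f g x y : ℝ → E} {T K : ℝ} (hT : 0 ≤ T)
    (hf : IntervalIntegrable f volume 0 T) (hg : IntervalIntegrable g volume 0 T)
    (hfK : ∀ t ∈ Icc 0 T, ‖f t‖ ≤ K) (hgK : ∀ t ∈ Icc 0 T, ‖g t‖ ≤ K)
    (hx : ∀ t ∈ Icc 0 T, x t = x 0 + ∫ s in (0 : ℝ)..t, f s)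
    (hy : ∀ t ∈ Icc 0 T, y t = y 0 + ∫ s in (0 : ℝ)..t, g s) :
    ∫ t in (0 : ℝ)..T, (⟪x t, g t⟫_ℝ + ⟪f t, y t⟫_ℝ) = ⟪x T, y T⟫_ℝ - ⟪x 0, y 0⟫_ℝ := by
  have hK0 : 0 ≤ K := (norm_nonneg _).trans (hfK 0 ⟨le_rfl, hT⟩)
  have hbd : ∀ {f x : ℝ → E}, IntervalIntegrable f volume 0 T → (∀ t ∈ Icc 0 T, ‖f t‖ ≤ K) →
      (∀ t ∈ Icc 0 T, x t = x 0 + ∫ s in (0 : ℝ)..t, f s) →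
      ∀ t ∈ Icc 0 T, ‖x t‖ ≤ ‖x 0‖ + K * T := by
    intro f x hf hfK hx t ht
    have h1 := norm_primitive_sub_le hf hfK hx ht (⟨le_rfl, hT⟩ : (0 : ℝ) ∈ Icc 0 T)
    rw [sub_zero, abs_of_nonneg ht.1] at h1
    have h2 := norm_sub_norm_le (x t) (x 0)
    nlinarith [ht.2]
  have hxb := hbd hf hfK hx
  have hyb := hbd hg hgK hy
  set L : ℝ := K * (‖y 0‖ + K * T) + (‖x 0‖ + K * T) * K with hL
  have hL0 : 0 ≤ L := by positivity
  -- The integrands are only bounded and measurable, so x and y are differentiable only almost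
  -- everywhere. The product is Lipschitz, hence absolutely continuous, and the fundamental theorem
  -- still applies.
  have hlip : LipschitzOnWith L.toNNReal (fun t => ⟪x t, y t⟫_ℝ) (uIcc 0 T) := by
    rw [uIcc_of_le hT]
    refine LipschitzOnWith.of_dist_le_mul fun s hs t ht => ?_
    rw [Real.coe_toNNReal _ hL0, Real.dist_eq, Real.dist_eq]
    have e : ⟪x s, y s⟫_ℝ - ⟪x t, y t⟫_ℝ = ⟪x s - x t, y s⟫_ℝ + ⟪x t, y s - y t⟫_ℝ := by
      rw [inner_sub_left, inner_sub_right]; ring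
    rw [e]
    calc |⟪x s - x t, y s⟫_ℝ + ⟪x t, y s - y t⟫_ℝ|
        ≤ ‖x s - x t‖ * ‖y s‖ + ‖x t‖ * ‖y s - y t‖ :=
          (abs_add_le _ _).trans (add_le_add (abs_real_inner_le_norm _ _)
            (abs_real_inner_le_norm _ _))
      _ ≤ (K * |s - t|) * (‖y 0‖ + K * T) + (‖x 0‖ + K * T) * (K * |s - t|) := by
          gcongr
          · exact norm_primitive_sub_le hf hfK hx hs ht
          · exact hyb s hs
          · exact hxb t ht
          · exact norm_primitive_sub_le hg hgK hy hs ht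
      _ = L * |s - t| := by rw [hL]; ring
  rw [← hlip.absolutelyContinuousOnInterval.integral_deriv_eq_sub]
  refine intervalIntegral.integral_congr_ae ?_
  -- The integral representations hold on [0, T] only, so a two-sided derivative is available only
  -- at interior points.
  have hne : ∀ᵐ t : ℝ, t ≠ T := by simp [ae_iff]
  filter_upwards [hf.ae_hasDerivAt_integral, hg.ae_hasDerivAt_integral, hne] with t h1 h2 h3 ht
  rw [uIoc_of_le hT] at ht
  have htI : t ∈ uIcc 0 T := by rw [uIcc_of_le hT]; exact Ioc_subset_Icc_self ht
  have hnhds : Icc 0 T ∈ nhds t := Icc_mem_nhds ht.1 (lt_of_le_of_ne ht.2 h3)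
  have hd : ∀ {f x : ℝ → E}, HasDerivAt (fun t => ∫ s in (0 : ℝ)..t, f s) (f t) t →
      (∀ t ∈ Icc 0 T, x t = x 0 + ∫ s in (0 : ℝ)..t, f s) → HasDerivAt x (f t) t := by
    intro f x h hx
    refine (h.const_add (x 0)).congr_of_eventuallyEq ?_
    filter_upwards [hnhds] with r hr using hx r hr
  exact ((hd (h1 htI 0 left_mem_uIcc) hx).inner ℝ (hd (h2 htI 0 left_mem_uIcc) hy)).deriv.symm

end Generalities

/-! ### Evolution operators, Gramians and steering. -/

section Evolution

variable {n m : ℕ} {A : ℝ → Mat n n} {B : ℝ → Mat n m} {K : ℝ}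

theorem continuous_adjoint {m n : ℕ} {M : ℝ → Mat m n} (hM : Continuous M) :
    Continuous fun t => (M t)† :=
  ContinuousLinearMap.adjoint.continuous.comp hM

theorem norm_adjoint_le {m n : ℕ} {M : Mat m n} {c : ℝ} (h : ‖M‖ ≤ c) : ‖M†‖ ≤ c := by
  rwa [LinearIsometryEquiv.norm_map]

/-- The derivative of the duality pairing between the solutions of `x' = f` and of the adjoint
equation. -/
theorem hasDerivAt_inner_adjoint {A : Mat n n} {x y : ℝ → Vec n} {f g : Vec n} {t : ℝ}
    (hy : HasDerivAt y (g - (A†) (y t)) t) (hx : HasDerivAt x (A (x t) + f) t) :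
    HasDerivAt (fun t => ⟪y t, x t⟫_ℝ) (⟪y t, f⟫_ℝ + ⟪g, x t⟫_ℝ) t := by
  refine (hy.inner ℝ hx).congr_deriv ?_
  rw [inner_add_right, inner_sub_left, ContinuousLinearMap.adjoint_inner_left]
  ring

theorem evolution_apply_hasDerivAt (hA : Continuous A) (hK : ∀ t, ‖A t‖ ≤ K) (s : ℝ) (z : Vec n)
    (t : ℝ) : HasDerivAt (fun r => evolution A r s z) (A t (evolution A t s z)) t := by
  have := (evolution_hasDerivAt_of_bounded hA hK s t).clm_apply (hasDerivAt_const t z)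
  simpa using this

/-- The solution operator of the adjoint equation `y' = -Aᵀ y`. -/
def adjointEvolution (A : ℝ → Mat n n) (t s : ℝ) : Mat n n := evolution (fun r => -(A r)†) t s

theorem adjointEvolution_apply_hasDerivAt (hA : Continuous A) (hK : ∀ t, ‖A t‖ ≤ K) (s : ℝ)
    (z : Vec n) (t : ℝ) : HasDerivAt (fun r => adjointEvolution A r s z)
      (0 - ((A t)†) (adjointEvolution A t s z)) t := by
  have := evolution_apply_hasDerivAt (A := fun r => -(A r)†) (continuous_adjoint hA).neg
    (fun t => by rw [norm_neg]; exact norm_adjoint_le (hK t)) s z t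
  simpa [adjointEvolution] using this

theorem adjointEvolution_self (A : ℝ → Mat n n) (s : ℝ) : adjointEvolution A s s = 1 :=
  evolution_self _ s

/-- The left side does not depend on r, because the two equations are dual and the contributions of
A cancel. This one identity yields both the transpose and the inverse of the evolution operator. -/
theorem inner_adjointEvolution_evolution (hA : Continuous A) (hK : ∀ t, ‖A t‖ ≤ K) (r s t : ℝ)
    (a b : Vec n) :
    ⟪adjointEvolution A r s a, evolution A r t b⟫_ℝ = ⟪a, evolution A s t b⟫_ℝ := by
  have hd : ∀ r, HasDerivAt (fun r => ⟪adjointEvolution A r s a, evolution A r t b⟫_ℝ) 0 r :=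
    fun r => by
      have h := hasDerivAt_inner_adjoint (f := 0) (g := 0) (A := A r)
        (adjointEvolution_apply_hasDerivAt hA hK s a r)
        (by simpa using evolution_apply_hasDerivAt hA hK t b r)
      simpa using h
  have := is_const_of_deriv_eq_zero (fun r => (hd r).differentiableAt) (fun r => (hd r).deriv) r s
  simpa [adjointEvolution_self] using this

theorem evolution_adjoint (hA : Continuous A) (hK : ∀ t, ‖A t‖ ≤ K) (s t : ℝ) :
    (evolution A s t)† = adjointEvolution A t s := by
  refine ContinuousLinearMap.ext fun a => ext_inner_right ℝ fun b => ?_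
  rw [ContinuousLinearMap.adjoint_inner_left, ← inner_adjointEvolution_evolution hA hK t s t,
    evolution_self]
  rfl

theorem evolution_mul_evolution_swap (hA : Continuous A) (hK : ∀ t, ‖A t‖ ≤ K) (s t : ℝ)
    (b : Vec n) : evolution A s t (evolution A t s b) = b := by
  refine ext_inner_left ℝ fun a => ?_
  rw [← ContinuousLinearMap.adjoint_inner_left, evolution_adjoint hA hK,
    inner_adjointEvolution_evolution hA hK, evolution_self]
  rfl

theorem continuous_adjointEvolution (hA : Continuous A) (hK : ∀ t, ‖A t‖ ≤ K) (s : ℝ) :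
    Continuous fun t => adjointEvolution A t s :=
  continuous_iff_continuousAt.2 fun t =>
    (evolution_hasDerivAt_of_bounded (A := fun r => -(A r)†) (continuous_adjoint hA).neg
      (fun t => by rw [norm_neg]; exact norm_adjoint_le (hK t)) s t).continuousAt

/-- The Peano–Baker series is differentiated in its first argument only; transposition moves the
second argument there. -/
theorem continuous_evolution_right (hA : Continuous A) (hK : ∀ t, ‖A t‖ ≤ K) (t : ℝ) :
    Continuous fun s => evolution A t s := by
  have h : (fun s => evolution A t s) = fun s => (adjointEvolution A s t)† := by
    funext s
    rw [← evolution_adjoint hA hK, ContinuousLinearMap.adjoint_adjoint]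
  rw [h]
  exact continuous_adjoint (continuous_adjointEvolution hA hK t)

theorem norm_evolution_apply_le (hA : Continuous A) (hK : ∀ t, ‖A t‖ ≤ K) {s t : ℝ} (hst : s ≤ t)
    (z : Vec n) : ‖evolution A t s z‖ ≤ Real.exp (K * (t - s)) * ‖z‖ := by
  have := norm_le_exp_mul_of_hasDerivAt (x := fun r => evolution A r s z) (K := K) (t₀ := s)
    (t₁ := t) (fun r _ => evolution_apply_hasDerivAt hA hK s z r)
    (fun r _ => (A r).le_of_opNorm_le (hK r) _) ⟨hst, le_rfl⟩
  simpa [evolution_self] using this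

theorem norm_adjointEvolution_apply_le (hA : Continuous A) (hK : ∀ t, ‖A t‖ ≤ K) {s t : ℝ}
    (hst : s ≤ t) (z : Vec n) : ‖adjointEvolution A t s z‖ ≤ Real.exp (K * (t - s)) * ‖z‖ :=
  norm_evolution_apply_le (A := fun r => -(A r)†) (continuous_adjoint hA).neg
    (fun t => by rw [norm_neg]; exact norm_adjoint_le (hK t)) hst z

theorem continuous_gramian_integrand (hA : Continuous A) (hK : ∀ t, ‖A t‖ ≤ K)
    (hB : Continuous B) (t₀ : ℝ) :
    Continuous fun s => evolution A t₀ s ∘L B s ∘L (B s)† ∘L (evolution A t₀ s)† :=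
  (continuous_evolution_right hA hK t₀).clm_comp (hB.clm_comp ((continuous_adjoint hB).clm_comp
    (continuous_adjoint (continuous_evolution_right hA hK t₀))))

theorem gramian_hasDerivAt (hA : Continuous A) (hK : ∀ t, ‖A t‖ ≤ K) (hB : Continuous B)
    (t₀ t : ℝ) : HasDerivAt (fun t => gramian A B t₀ t)
      (evolution A t₀ t ∘L B t ∘L (B t)† ∘L (evolution A t₀ t)†) t := by
  have hc := continuous_gramian_integrand hA hK hB t₀
  exact intervalIntegral.integral_hasDerivAt_right (hc.intervalIntegrable _ _)
    hc.aestronglyMeasurable.stronglyMeasurableAtFilter hc.continuousAt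

theorem inner_gramian_apply (hA : Continuous A) (hK : ∀ t, ‖A t‖ ≤ K) (hB : Continuous B)
    (t₀ t₁ : ℝ) (a b : Vec n) : ⟪a, gramian A B t₀ t₁ b⟫_ℝ =
      ∫ s in t₀..t₁, ⟪((B s)†) (adjointEvolution A s t₀ a),
        ((B s)†) (adjointEvolution A s t₀ b)⟫_ℝ := by
  have hc := continuous_gramian_integrand hA hK hB t₀
  have hc' : Continuous fun s =>
      (evolution A t₀ s ∘L B s ∘L (B s)† ∘L (evolution A t₀ s)†) b := hc.clm_apply continuous_const
  rw [gramian, ContinuousLinearMap.intervalIntegral_apply (hc.intervalIntegrable _ _)]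
  have := (innerSL ℝ a).intervalIntegral_comp_comm (hc'.intervalIntegrable (μ := volume) t₀ t₁)
  simp only [innerSL_apply_apply] at this
  rw [← this]
  refine intervalIntegral.integral_congr fun s _ => ?_
  simp only [ContinuousLinearMap.comp_apply]
  rw [← evolution_adjoint hA hK, ContinuousLinearMap.adjoint_inner_left,
    ContinuousLinearMap.adjoint_inner_left]

theorem continuous_adjoint_apply_adjointEvolution (hA : Continuous A) (hK : ∀ t, ‖A t‖ ≤ K)
    (hB : Continuous B) (s : ℝ) (a : Vec n) :
    Continuous fun t => ((B t)†) (adjointEvolution A t s a) :=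
  (continuous_adjoint hB).clm_apply
    ((continuous_adjointEvolution hA hK s).clm_apply continuous_const)

theorem inner_gramian_self (hA : Continuous A) (hK : ∀ t, ‖A t‖ ≤ K) (hB : Continuous B)
    (t₀ t₁ : ℝ) (a : Vec n) : ⟪a, gramian A B t₀ t₁ a⟫_ℝ =
      ∫ s in t₀..t₁, ‖((B s)†) (adjointEvolution A s t₀ a)‖ ^ 2 := by
  rw [inner_gramian_apply hA hK hB]
  simp only [real_inner_self_eq_norm_sq]

/-- The Gramian form is the integral of a nonnegative function, so it grows with the upper limit and
the bound at t₁ controls all intermediate Gramians. The steered trajectory involves these. -/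
theorem norm_gramian_apply_le (hA : Continuous A) (hK : ∀ t, ‖A t‖ ≤ K) (hB : Continuous B)
    {t₀ t₁ a₁ : ℝ} (ha₁ : 0 < a₁) (h : ∀ z, ⟪z, gramian A B t₀ t₁ z⟫_ℝ ≤ a₁ * ‖z‖ ^ 2)
    {s : ℝ} (hs : s ∈ Icc t₀ t₁) (w : Vec n) : ‖gramian A B t₀ s w‖ ≤ a₁ * ‖w‖ := by
  refine norm_apply_le_of_inner_le (S := fun w => gramian A B t₀ s w) (fun x y r => by simp) ha₁
    (fun x y => ?_) (fun x => ?_) (fun x => ?_) w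
  · rw [real_inner_comm, inner_gramian_apply hA hK hB, inner_gramian_apply hA hK hB]
    simp only [real_inner_comm]
  · rw [real_inner_comm, inner_gramian_self hA hK hB]
    exact intervalIntegral.integral_nonneg hs.1 fun _ _ => by positivity
  · rw [real_inner_comm]
    refine le_trans ?_ (h x)
    rw [inner_gramian_self hA hK hB, inner_gramian_self hA hK hB]
    have hc := (continuous_adjoint_apply_adjointEvolution hA hK hB t₀ x).norm.pow 2
    exact intervalIntegral.integral_mono_interval le_rfl hs.1 hs.2
      (Filter.Eventually.of_forall fun _ => by positivity) (hc.intervalIntegrable _ _)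

/-- Increments are bounded by the integral of a bound of the derivative. -/
theorem sub_le_integral_of_hasDerivAt {g g' φ : ℝ → ℝ} {a b : ℝ} (hab : a ≤ b)
    (hg : ∀ t, HasDerivAt g (g' t) t) (hφ : Continuous φ) (h : ∀ t ∈ Icc a b, g' t ≤ φ t) :
    g b - g a ≤ ∫ t in a..b, φ t :=
  intervalIntegral.sub_le_integral_of_hasDeriv_right_of_le hab
    (fun t _ => (hg t).continuousAt.continuousWithinAt) (fun t _ => (hg t).hasDerivWithinAt)
    (hφ.integrableOn_Icc) fun t ht => h t (Ioo_subset_Icc_self ht)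

theorem integral_exp_mul_sub {c : ℝ} (hc : c ≠ 0) (a b : ℝ) :
    ∫ s in a..b, Real.exp (c * (s - a)) = (Real.exp (c * (b - a)) - 1) / c := by
  have hd : ∀ s, HasDerivAt (fun s => Real.exp (c * (s - a)) / c) (Real.exp (c * (s - a))) s := by
    intro s
    have h1 : HasDerivAt (fun s => c * (s - a)) c s := by
      simpa using ((hasDerivAt_id s).sub_const a).const_mul c
    refine (h1.exp.div_const c).congr_deriv ?_
    field_simp
  rw [intervalIntegral.integral_eq_sub_of_hasDerivAt (fun s _ => hd s)
    ((by fun_prop : Continuous fun s => Real.exp (c * (s - a))).intervalIntegrable _ _)]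
  simp [sub_div]

/-- A pair with a coercive and bounded Gramian can be steered to the origin, with quantitative bounds
on the state and on the costate `y` generating the control `-Bᵀ y`. -/
theorem exists_steering (hA : Continuous A) (hK : ∀ t, ‖A t‖ ≤ K) (hB : Continuous B)
    {t₀ t₁ a₀ a₁ : ℝ} (ha₀ : 0 < a₀) (ha₁ : 0 < a₁)
    (hlo : ∀ z, a₀ * ‖z‖ ^ 2 ≤ ⟪z, gramian A B t₀ t₁ z⟫_ℝ)
    (hhi : ∀ z, ⟪z, gramian A B t₀ t₁ z⟫_ℝ ≤ a₁ * ‖z‖ ^ 2) (z : Vec n) :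
    ∃ x y : ℝ → Vec n, x t₀ = z ∧ x t₁ = 0 ∧
      (∀ t, HasDerivAt x (A t (x t) + B t (-((B t)†) (y t))) t) ∧ Continuous y ∧
      (∀ t ∈ Icc t₀ t₁, ‖x t‖ ≤ Real.exp (K * (t - t₀)) * ((1 + a₁ / a₀) * ‖z‖)) ∧
      (∀ t ∈ Icc t₀ t₁, ‖y t‖ ≤ Real.exp (K * (t - t₀)) * (‖z‖ / a₀)) ∧
      ∫ t in t₀..t₁, ‖((B t)†) (y t)‖ ^ 2 ≤ ‖z‖ ^ 2 / a₀ := by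
  have hbelow : ∀ w, ‖w‖ ≤ ‖gramian A B t₀ t₁ w‖ / a₀ := fun w => by
    rw [le_div_iff₀ ha₀]
    rcases (norm_nonneg w).eq_or_lt with h | h
    · rw [← h, zero_mul]; positivity
    · have h1 := (hlo w).trans (real_inner_le_norm _ _)
      nlinarith
  have hinj : Function.Injective (gramian A B t₀ t₁ : Vec n →ₗ[ℝ] Vec n) := by
    refine (injective_iff_map_eq_zero _).2 fun w hw => ?_
    have := hbelow w
    have hw' : gramian A B t₀ t₁ w = 0 := hw
    rw [hw', norm_zero, zero_div] at this
    exact norm_le_zero_iff.1 this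
  obtain ⟨w, hw⟩ := LinearMap.injective_iff_surjective.1 hinj z
  have hw' : gramian A B t₀ t₁ w = z := hw
  have hwz : ‖w‖ ≤ ‖z‖ / a₀ := hw' ▸ hbelow w
  have hev : Continuous fun s => adjointEvolution A s t₀ w :=
    (continuous_adjointEvolution hA hK t₀).clm_apply continuous_const
  -- The minimum-energy control: with w solving W(t₀,t₁)w = z, the costate is w transported by the
  -- adjoint equation, and variation of constants gives x(s) = Φ(s,t₀)(z - W(t₀,s)w), which vanishes
  -- at t₁. Its energy is ⟨w, z⟩.
  refine ⟨fun s => evolution A s t₀ (z - gramian A B t₀ s w), fun s => adjointEvolution A s t₀ w,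
    ?_, ?_, fun s => ?_, hev, fun s hs => ?_, fun s hs => ?_, ?_⟩
  · simp [evolution_self, gramian]
  · simp [hw']
  · have h1 := (evolution_hasDerivAt_of_bounded hA hK t₀ s).clm_apply
      (((gramian_hasDerivAt hA hK hB t₀ s).clm_apply (hasDerivAt_const s w)).const_sub z)
    refine h1.congr_deriv ?_
    simp only [ContinuousLinearMap.comp_apply, map_zero, add_zero, map_neg,
      evolution_mul_evolution_swap hA hK, evolution_adjoint hA hK]
    rfl
  · refine (norm_evolution_apply_le hA hK hs.1 _).trans ?_
    gcongr
    calc ‖z - gramian A B t₀ s w‖ ≤ ‖z‖ + ‖gramian A B t₀ s w‖ := norm_sub_le _ _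
      _ ≤ ‖z‖ + a₁ * (‖z‖ / a₀) := by
        gcongr
        exact (norm_gramian_apply_le hA hK hB ha₁ hhi hs w).trans (by gcongr)
      _ = (1 + a₁ / a₀) * ‖z‖ := by ring
  · refine (norm_adjointEvolution_apply_le hA hK hs.1 _).trans ?_
    gcongr
  · rw [← inner_gramian_self hA hK hB, hw']
    refine (real_inner_le_norm _ _).trans ?_
    calc ‖w‖ * ‖z‖ ≤ ‖z‖ / a₀ * ‖z‖ := by gcongr
      _ = ‖z‖ ^ 2 / a₀ := by ring

/-- If every initial state can be steered to the origin with energy at most `‖z‖² / a`, then the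
Gramian is at least `a`. -/
theorem le_inner_gramian_of_steering (hA : Continuous A) (hK : ∀ t, ‖A t‖ ≤ K) (hB : Continuous B)
    {t₀ t₁ a : ℝ} (ht : t₀ ≤ t₁) (ha : 0 < a) {z : Vec n} {x : ℝ → Vec n} {v : ℝ → Vec m}
    (hx₀ : x t₀ = z) (hx₁ : x t₁ = 0) (hx : ∀ t, HasDerivAt x (A t (x t) + B t (v t)) t)
    (hv : Continuous v) (hE : ∫ t in t₀..t₁, ‖v t‖ ^ 2 ≤ ‖z‖ ^ 2 / a) :
    a * ‖z‖ ^ 2 ≤ ⟪z, gramian A B t₀ t₁ z⟫_ℝ := by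
  set p : ℝ → Vec m := fun t => ((B t)†) (adjointEvolution A t t₀ z) with hp
  have hpc : Continuous p := continuous_adjoint_apply_adjointEvolution hA hK hB t₀ z
  -- Since x runs from z to 0, integrating this gives ‖z‖² = -∫⟨p, v⟩. Young's inequality with
  -- weight a then lets the energy of v use up half of ‖z‖², leaving the other half to the Gramian.
  have hd : ∀ t, HasDerivAt (fun t => -⟪adjointEvolution A t t₀ z, x t⟫_ℝ) (-⟪p t, v t⟫_ℝ) t := by
    intro t
    have h := (hasDerivAt_inner_adjoint (adjointEvolution_apply_hasDerivAt hA hK t₀ z t)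
      (hx t)).neg
    refine h.congr_deriv ?_
    rw [inner_zero_left, add_zero, hp, ContinuousLinearMap.adjoint_inner_left]
  have hc1 : Continuous fun t => 1 / (2 * a) * ‖p t‖ ^ 2 := by fun_prop
  have hc2 : Continuous fun t => a / 2 * ‖v t‖ ^ 2 := by fun_prop
  have hle := sub_le_integral_of_hasDerivAt (φ := fun t => 1 / (2 * a) * ‖p t‖ ^ 2 + a / 2 * ‖v t‖ ^ 2)
    ht hd (hc1.add hc2) fun t _ => by
    have h1 : 0 ≤ ‖p t + a • v t‖ ^ 2 := by positivity
    rw [norm_add_sq_real, inner_smul_right, norm_smul, Real.norm_of_nonneg ha.le] at h1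
    have h2 : 1 / (2 * a) * ‖p t‖ ^ 2 + a / 2 * ‖v t‖ ^ 2 + ⟪p t, v t⟫_ℝ =
        1 / (2 * a) * (‖p t‖ ^ 2 + 2 * (a * ⟪p t, v t⟫_ℝ) + (a * ‖v t‖) ^ 2) := by
      field_simp
      ring
    have h3 : 0 ≤ 1 / (2 * a) * (‖p t‖ ^ 2 + 2 * (a * ⟪p t, v t⟫_ℝ) + (a * ‖v t‖) ^ 2) := by
      positivity
    linarith
  rw [intervalIntegral.integral_add (hc1.intervalIntegrable _ _) (hc2.intervalIntegrable _ _),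
    intervalIntegral.integral_const_mul, intervalIntegral.integral_const_mul,
    ← inner_gramian_self hA hK hB, hx₀, hx₁, adjointEvolution_self] at hle
  simp only [inner_zero_right, one_apply_eq_self, real_inner_self_eq_norm_sq] at hle
  have h4 : a / 2 * ∫ t in t₀..t₁, ‖v t‖ ^ 2 ≤ ‖z‖ ^ 2 / 2 := by
    calc a / 2 * ∫ t in t₀..t₁, ‖v t‖ ^ 2 ≤ a / 2 * (‖z‖ ^ 2 / a) := by gcongr
      _ = ‖z‖ ^ 2 / 2 := by field_simp
  have h5 : ‖z‖ ^ 2 / 2 ≤ 1 / (2 * a) * ⟪z, gramian A B t₀ t₁ z⟫_ℝ := by linarith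
  have h6 := mul_le_mul_of_nonneg_left h5 (by positivity : 0 ≤ 2 * a)
  have h7 : 2 * a * (1 / (2 * a) * ⟪z, gramian A B t₀ t₁ z⟫_ℝ) = ⟪z, gramian A B t₀ t₁ z⟫_ℝ := by
    field_simp
  linarith

theorem integral_exp_sq_mul_le {K D : ℝ} (hK : 0 < K) {t₀ t₁ σ : ℝ} (ht₁ : t₁ ≤ t₀ + σ)
    (hD : 0 ≤ D) : ∫ s in t₀..t₁, Real.exp (2 * K * (s - t₀)) * D ≤
      (Real.exp (2 * K * σ) - 1) / (2 * K) * D := by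
  rw [intervalIntegral.integral_mul_const, integral_exp_mul_sub (by positivity)]
  gcongr
  linarith

theorem inner_gramian_le (hA : Continuous A) (hK : ∀ t, ‖A t‖ ≤ K) (hB : Continuous B)
    (hK0 : 0 < K) {b : ℝ} (hb : ∀ t, ‖B t‖ ≤ b) {t₀ t₁ σ : ℝ} (ht : t₀ ≤ t₁) (ht₁ : t₁ ≤ t₀ + σ)
    (z : Vec n) : ⟪z, gramian A B t₀ t₁ z⟫_ℝ ≤
      b ^ 2 * (Real.exp (2 * K * σ) - 1) / (2 * K) * ‖z‖ ^ 2 := by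
  rw [inner_gramian_self hA hK hB]
  have hc := (continuous_adjoint_apply_adjointEvolution hA hK hB t₀ z).norm.pow 2
  have hc' : Continuous fun s => Real.exp (2 * K * (s - t₀)) * (b ^ 2 * ‖z‖ ^ 2) := by fun_prop
  refine (intervalIntegral.integral_mono_on ht (hc.intervalIntegrable _ _)
    (hc'.intervalIntegrable _ _) fun s hs => ?_).trans
    ((integral_exp_sq_mul_le hK0 ht₁ (by positivity)).trans_eq (by ring))
  have h1 : ‖((B s)†) (adjointEvolution A s t₀ z)‖ ≤ b * (Real.exp (K * (s - t₀)) * ‖z‖) :=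
    ((B s)†).le_of_opNorm_le_of_le (norm_adjoint_le (hb s))
      (norm_adjointEvolution_apply_le hA hK hs.1 z)
  calc ‖((B s)†) (adjointEvolution A s t₀ z)‖ ^ 2
      ≤ (b * (Real.exp (K * (s - t₀)) * ‖z‖)) ^ 2 := by gcongr
    _ = Real.exp (2 * K * (s - t₀)) * (b ^ 2 * ‖z‖ ^ 2) := by
        rw [show 2 * K * (s - t₀) = K * (s - t₀) + K * (s - t₀) by ring, Real.exp_add]; ring

end Evolution

/-! ### Positivity of the constants and the inequalities hidden in c₀ and c₁. -/

namespace LQConstants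

variable (c : LQConstants)

theorem lamQ_pos : 0 < c.lamQ := c.γQ_pos.trans_le c.γQ_le_lamQ

theorem kappa_pos : 0 < c.kappa := by
  have := c.lamA_pos; have := c.lamB_pos; have := c.lamH_pos; have := c.γR_pos
  unfold kappa; positivity

theorem one_lt_exp_kappa : 1 < Real.exp (2 * c.kappa * c.σ) := by
  have := c.kappa_pos; have := c.σ_pos
  exact Real.one_lt_exp_iff.2 (by positivity)

theorem α₀'_pos : 0 < c.α₀' := by
  have := c.lamA_pos; have := c.lamH_pos; have := c.γR_pos; have := c.α₀_pos; have := c.α₁_pos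
  have : 0 < Real.exp (2 * c.lamA * c.σ) - 1 := by
    have := c.σ_pos
    exact sub_pos.2 (Real.one_lt_exp_iff.2 (by positivity))
  unfold α₀'; positivity

theorem α₁'_eq : c.α₁' = c.lamB ^ 2 * (Real.exp (2 * c.kappa * c.σ) - 1) / (2 * c.kappa) := by
  unfold α₁'; ring_nf

theorem α₁'_pos : 0 < c.α₁' := by
  have := c.kappa_pos; have := c.lamB_pos; have := sub_pos.2 c.one_lt_exp_kappa
  rw [α₁'_eq]; positivity

theorem αt₀_pos : 0 < c.αt₀ := by
  have := c.kappa_pos; have := c.σ_pos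
  have : 0 < 1 - Real.exp (-2 * c.kappa * c.σ) :=
    sub_pos.2 (Real.exp_lt_one_iff.2 (by have : 0 < c.kappa * c.σ := by positivity
                                         linarith))
  unfold αt₀; positivity

theorem αt₀_le_σ : c.αt₀ ≤ c.σ := by
  have hk := c.kappa_pos
  have h := Real.add_one_le_exp (-2 * c.kappa * c.σ)
  rw [αt₀, one_div, inv_mul_le_iff₀ (by positivity)]
  linarith

theorem αt₁_pos : 0 < c.αt₁ := by
  have := c.kappa_pos; have := sub_pos.2 c.one_lt_exp_kappa
  unfold αt₁; positivity

theorem c₀_pos : 0 < c.c₀ := by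
  have := c.kappa_pos; have := c.lamB_pos; have := c.γR_pos; have := c.γQ_pos
  have := c.αt₀_pos; have := c.αt₁_pos
  unfold c₀
  exact mul_pos (lt_min (by positivity) (by positivity)) (Real.exp_pos _)

theorem c₁_pos : 0 < c.c₁ := by
  have := c.kappa_pos; have := c.lamQ_pos; have := c.lamH_pos; have := c.γR_pos
  unfold c₁
  exact mul_pos (lt_max_of_lt_right (by positivity)) (Real.exp_pos _)

theorem ρZ_pos : 0 < c.ρZ := by
  have := c.c₁_pos; have := c.γQ_pos
  unfold ρZ; positivity

theorem cZ_pos : 0 < c.cZ := Real.sqrt_pos.2 (div_pos c.c₁_pos c.c₀_pos)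

theorem Lamb_pos : 0 < c.Lamb := by
  have := c.cZ_pos; have := c.c₁_pos; have := c.lamB_pos; have := c.lamH_pos
  have := c.γR_pos; have := c.lamG_pos
  unfold Lamb
  exact mul_pos (by positivity) (lt_max_of_lt_left c.cZ_pos)

/-- The reciprocal of the lower bound obtained on a full controllability interval. -/
theorem c₀_mul_le_one {N : ℝ} (hN : N ≤ (c.lamB ^ 2 / c.γR + 1 / (c.γQ * c.σ ^ 2)) *
      ((Real.exp (2 * c.kappa * c.σ) - 1) / (2 * c.kappa))) : c.c₀ * N ≤ 1 := by
  have hk := c.kappa_pos; have := c.lamB_pos; have := c.γR_pos; have := c.γQ_pos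
  have h0 := c.αt₀_pos; have := c.αt₁_pos; have := c.σ_pos
  set N' : ℝ := c.lamB ^ 2 / c.γR * (1 + c.αt₁ / c.αt₀) ^ 2 + 1 / (c.γQ * c.αt₀ ^ 2) with hN'
  have hN'0 : 0 < N' := by positivity
  have h1 : c.c₀ ≤ 2 * c.kappa * N'⁻¹ * Real.exp (-2 * c.kappa * c.σ) := by
    unfold c₀
    exact mul_le_mul_of_nonneg_right (min_le_left _ _) (Real.exp_pos _).le
  -- The duality argument needs less than c₀ provides: the factor (1 + α̃₁/α̃₀)² is at least 1, and
  -- α̃₀ ≤ σ.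
  have h2 : c.lamB ^ 2 / c.γR + 1 / (c.γQ * c.σ ^ 2) ≤ N' := by
    have h3 : 1 ≤ (1 + c.αt₁ / c.αt₀) ^ 2 := one_le_pow₀ (le_add_of_nonneg_right (by positivity))
    have h4 : c.lamB ^ 2 / c.γR ≤ c.lamB ^ 2 / c.γR * (1 + c.αt₁ / c.αt₀) ^ 2 :=
      le_mul_of_one_le_right (by positivity) h3
    have h5 : 1 / (c.γQ * c.σ ^ 2) ≤ 1 / (c.γQ * c.αt₀ ^ 2) := by
      have := c.αt₀_le_σ
      gcongr
    linarith
  have h6 : N ≤ N' * (Real.exp (2 * c.kappa * c.σ) / (2 * c.kappa)) := by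
    refine hN.trans (mul_le_mul h2 ?_ ?_ hN'0.le)
    · gcongr; linarith
    · have := sub_pos.2 c.one_lt_exp_kappa
      positivity
  calc c.c₀ * N ≤ c.c₀ * (N' * (Real.exp (2 * c.kappa * c.σ) / (2 * c.kappa))) :=
        mul_le_mul_of_nonneg_left h6 c.c₀_pos.le
    _ ≤ (2 * c.kappa * N'⁻¹ * Real.exp (-2 * c.kappa * c.σ)) *
        (N' * (Real.exp (2 * c.kappa * c.σ) / (2 * c.kappa))) :=
        mul_le_mul_of_nonneg_right h1 (by positivity)
    _ = Real.exp (-2 * c.kappa * c.σ) * Real.exp (2 * c.kappa * c.σ) := by field_simp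
    _ = 1 := by rw [← Real.exp_add]; ring_nf; exact Real.exp_zero

/-- The reciprocal of the lower bound obtained near the end of the horizon. -/
theorem c₀_mul_terminal_le_one : c.c₀ * (Real.exp (2 * c.kappa * c.σ) *
    (c.lamB ^ 2 / (2 * c.γR * c.kappa) + 1 / c.γQ)) ≤ 1 := by
  have hk := c.kappa_pos; have := c.lamB_pos; have := c.γR_pos; have := c.γQ_pos
  set N' : ℝ := c.lamB ^ 2 / (2 * c.γR * c.kappa) + 1 / c.γQ with hN'
  have hN'0 : 0 < N' := by positivity
  have h1 : c.c₀ ≤ N'⁻¹ * Real.exp (-2 * c.kappa * c.σ) := by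
    unfold c₀
    exact mul_le_mul_of_nonneg_right (min_le_right _ _) (Real.exp_pos _).le
  calc c.c₀ * (Real.exp (2 * c.kappa * c.σ) * N')
      ≤ (N'⁻¹ * Real.exp (-2 * c.kappa * c.σ)) * (Real.exp (2 * c.kappa * c.σ) * N') :=
        mul_le_mul_of_nonneg_right h1 (by positivity)
    _ = Real.exp (-2 * c.kappa * c.σ) * Real.exp (2 * c.kappa * c.σ) := by field_simp
    _ = 1 := by rw [← Real.exp_add]; ring_nf; exact Real.exp_zero

/-- The left side is the cost factor of steering to the origin. The term λ_H²/γ_R in c₁ is slack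
here, because the form of Qt is already bounded by λ_Q (`inner_Qt_le`). -/
theorem steering_cost_le_c₁ : (Real.exp (2 * c.kappa * c.σ) - 1) / (2 * c.kappa) *
    (c.lamQ * (1 + c.α₁' / c.α₀') ^ 2 + c.lamR * c.lamB ^ 2 / c.α₀' ^ 2) ≤ c.c₁ := by
  have hk := c.kappa_pos; have := c.lamQ_pos; have := c.lamH_pos; have := c.γR_pos
  have := c.α₀'_pos; have := c.α₁'_pos; have := c.lamR_pos; have := c.lamB_pos
  have := sub_pos.2 c.one_lt_exp_kappa
  unfold c₁
  refine le_trans ?_ (mul_le_mul_of_nonneg_right (le_max_left _ _) (Real.exp_pos _).le)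
  calc _ ≤ (Real.exp (2 * c.kappa * c.σ)) / (2 * c.kappa) *
        ((c.lamQ + c.lamH ^ 2 / c.γR) * (1 + c.α₁' / c.α₀') ^ 2
          + c.lamR * c.lamB ^ 2 / c.α₀' ^ 2) := by
        gcongr
        · linarith
        · exact le_add_of_nonneg_right (by positivity)
    _ = _ := by ring

/-- The left side is the cost factor of the uncontrolled trajectory over a remaining time of at most
σ: terminal cost plus running cost. -/
theorem terminal_cost_le_c₁ : c.lamQ * Real.exp (2 * c.kappa * c.σ) +
    (Real.exp (2 * c.kappa * c.σ) - 1) / (2 * c.kappa) * c.lamQ ≤ c.c₁ := by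
  have hk := c.kappa_pos; have := c.lamQ_pos; have := c.lamH_pos; have := c.γR_pos
  unfold c₁
  refine le_trans ?_ (mul_le_mul_of_nonneg_right (le_max_right _ _) (Real.exp_pos _).le)
  calc _ ≤ (c.lamQ + c.lamH ^ 2 / c.γR) * Real.exp (2 * c.kappa * c.σ) +
        Real.exp (2 * c.kappa * c.σ) / (2 * c.kappa) * (c.lamQ + c.lamH ^ 2 / c.γR) := by
        have : c.lamQ ≤ c.lamQ + c.lamH ^ 2 / c.γR := le_add_of_nonneg_right (by positivity)
        gcongr
        linarith
    _ = _ := by ring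

end LQConstants

/-! ### Loewner inequalities as statements about quadratic forms. -/

theorem symm_of_smul_one_le {n : ℕ} {M : Mat n n} {a : ℝ} (h : a • (1 : Mat n n) ≤ M)
    (x y : Vec n) : ⟪M x, y⟫_ℝ = ⟪x, M y⟫_ℝ := by
  have := ((ContinuousLinearMap.le_def _ _).1 h).inner_left_eq_inner_right x y
  simp only [sub_apply, smul_apply, one_apply_eq_self,
    inner_sub_left, inner_sub_right, inner_smul_left, inner_smul_right, RCLike.conj_to_real] at this
  linarith

theorem le_inner_of_smul_one_le {n : ℕ} {M : Mat n n} {a : ℝ} (h : a • (1 : Mat n n) ≤ M)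
    (x : Vec n) : a * ‖x‖ ^ 2 ≤ ⟪M x, x⟫_ℝ := by
  have := ((ContinuousLinearMap.le_def _ _).1 h).inner_nonneg_left x
  simp only [sub_apply, smul_apply, one_apply_eq_self,
    inner_sub_left, inner_smul_left, RCLike.conj_to_real, real_inner_self_eq_norm_sq] at this
  linarith

theorem inner_le_of_le_smul_one {n : ℕ} {M : Mat n n} {a : ℝ} (h : M ≤ a • (1 : Mat n n))
    (x : Vec n) : ⟪M x, x⟫_ℝ ≤ a * ‖x‖ ^ 2 := by
  have := ((ContinuousLinearMap.le_def _ _).1 h).inner_nonneg_left x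
  simp only [sub_apply, smul_apply, one_apply_eq_self,
    inner_sub_left, inner_smul_left, RCLike.conj_to_real, real_inner_self_eq_norm_sq] at this
  linarith

theorem isUnit_of_smul_one_le {n : ℕ} {M : Mat n n} {a : ℝ} (ha : 0 < a)
    (h : a • (1 : Mat n n) ≤ M) : IsUnit M := by
  refine ContinuousLinearMap.isUnit_of_forall_le_norm_inner_map M (c := ⟨a, ha.le⟩) ha fun x => ?_
  have := le_inner_of_smul_one_le h x
  refine le_trans ?_ (Real.le_norm_self _)
  rw [mul_comm]
  exact this

/-! ### The reduced coefficients At, Qt, S and the controllability of (At, B). -/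

namespace LQProblem

variable {nx nu nd : ℕ} {P : LQProblem nx nu nd} {c : LQConstants}

/-- The standing assumptions for coefficients that are continuous, bounded and coercive on the whole
line. -/
structure Regular (P : LQProblem nx nu nd) (c : LQConstants) : Prop where
  σ_lt_T : c.σ < P.T
  contA : Continuous P.A
  contB : Continuous P.B
  contC : Continuous P.C
  contQ : Continuous P.Q
  contH : Continuous P.H
  contR : Continuous P.R
  contG : Continuous P.G
  contW : Continuous P.W
  boundA : ∀ t, ‖P.A t‖ ≤ c.lamA
  boundB : ∀ t, ‖P.B t‖ ≤ c.lamB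
  boundC : ∀ t, ‖P.C t‖ ≤ c.lamC
  boundQ : ∀ t, ‖P.Q t‖ ≤ c.lamQ
  boundH : ∀ t, ‖P.H t‖ ≤ c.lamH
  boundR : ∀ t, ‖P.R t‖ ≤ c.lamR
  boundG : ∀ t, ‖P.G t‖ ≤ c.lamG
  boundW : ∀ t, ‖P.W t‖ ≤ c.lamW
  boundGT : ‖P.GT‖ ≤ c.lamG
  controllable : ∀ t₀ ∈ Icc 0 (P.T - c.σ), ∃ t₁ ∈ Icc t₀ (t₀ + c.σ),
    c.α₀ • (1 : Mat nx nx) ≤ gramian P.A P.B t₀ t₁ ∧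
    gramian P.A P.B t₀ t₁ ≤ c.α₁ • (1 : Mat nx nx)
  coerciveR : ∀ t, c.γR • (1 : Mat nu nu) ≤ P.R t
  coerciveQ : ∀ t, c.γQ • (1 : Mat nx nx) ≤ P.Q t - (P.H t)† ∘L (P.R t).inverse ∘L P.H t
  coerciveQT : c.γQ • (1 : Mat nx nx) ≤ P.QT
  boundQT : P.QT ≤ c.lamQ • (1 : Mat nx nx)

/-- `R⁻¹`. -/
def Rinv (P : LQProblem nx nu nd) (t : ℝ) : Mat nu nu := (P.R t).inverse

/-- `A - B R⁻¹ H`. -/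
def At (P : LQProblem nx nu nd) (t : ℝ) : Mat nx nx := P.A t - P.B t ∘L P.Rinv t ∘L P.H t

/-- `Q - Hᵀ R⁻¹ H`. -/
def Qt (P : LQProblem nx nu nd) (t : ℝ) : Mat nx nx := P.Q t - (P.H t)† ∘L P.Rinv t ∘L P.H t

/-- `B R⁻¹ Bᵀ`. -/
def S (P : LQProblem nx nu nd) (t : ℝ) : Mat nx nx := P.B t ∘L P.Rinv t ∘L (P.B t)†

namespace Regular

theorem T_pos (h : P.Regular c) : 0 < P.T := c.σ_pos.trans h.σ_lt_T

theorem R_symm (h : P.Regular c) (t : ℝ) (x y : Vec nu) : ⟪P.R t x, y⟫_ℝ = ⟪x, P.R t y⟫_ℝ :=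
  symm_of_smul_one_le (h.coerciveR t) x y

theorem le_inner_R (h : P.Regular c) (t : ℝ) (x : Vec nu) : c.γR * ‖x‖ ^ 2 ≤ ⟪P.R t x, x⟫_ℝ :=
  le_inner_of_smul_one_le (h.coerciveR t) x

theorem isUnit_R (h : P.Regular c) (t : ℝ) : IsUnit (P.R t) :=
  isUnit_of_smul_one_le c.γR_pos (h.coerciveR t)

theorem R_Rinv (h : P.Regular c) (t : ℝ) (x : Vec nu) : P.R t (P.Rinv t x) = x := by
  have := Ring.mul_inverse_cancel _ (h.isUnit_R t)
  rw [ContinuousLinearMap.ringInverse_eq_inverse] at this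
  exact DFunLike.congr_fun this x

theorem continuous_Rinv (h : P.Regular c) : Continuous P.Rinv := by
  have : P.Rinv = fun t => Ring.inverse (P.R t) := by
    funext t; rw [ContinuousLinearMap.ringInverse_eq_inverse]; rfl
  rw [this]
  refine continuous_iff_continuousAt.2 fun t => ?_
  obtain ⟨u, hu⟩ := h.isUnit_R t
  have h1 := NormedRing.inverse_continuousAt u
  rw [hu] at h1
  exact ContinuousAt.comp (f := P.R) h1 h.contR.continuousAt

theorem Rinv_symm (h : P.Regular c) (t : ℝ) (x y : Vec nu) :
    ⟪P.Rinv t x, y⟫_ℝ = ⟪x, P.Rinv t y⟫_ℝ := by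
  conv_lhs => rw [← h.R_Rinv t y]
  rw [← h.R_symm, h.R_Rinv]

theorem Rinv_nonneg (h : P.Regular c) (t : ℝ) (x : Vec nu) : 0 ≤ ⟪P.Rinv t x, x⟫_ℝ := by
  have h1 := h.le_inner_R t (P.Rinv t x)
  rw [h.R_Rinv, real_inner_comm] at h1
  have := c.γR_pos
  exact le_trans (by positivity) h1

theorem norm_Rinv_apply_le (h : P.Regular c) (t : ℝ) (x : Vec nu) :
    ‖P.Rinv t x‖ ≤ 1 / c.γR * ‖x‖ := by
  have h1 := (h.le_inner_R t (P.Rinv t x)).trans (real_inner_le_norm _ _)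
  rw [h.R_Rinv] at h1
  have hγ := c.γR_pos
  rw [one_div, inv_mul_eq_div, le_div_iff₀ hγ]
  rcases (norm_nonneg (P.Rinv t x)).eq_or_lt with h2 | h2
  · rw [← h2, zero_mul]; positivity
  · nlinarith

theorem norm_Rinv_le (h : P.Regular c) (t : ℝ) : ‖P.Rinv t‖ ≤ 1 / c.γR :=
  ContinuousLinearMap.opNorm_le_bound _ (by have := c.γR_pos; positivity) (h.norm_Rinv_apply_le t)

theorem continuous_At (h : P.Regular c) : Continuous P.At :=
  h.contA.sub (h.contB.clm_comp (h.continuous_Rinv.clm_comp h.contH))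

theorem continuous_Qt (h : P.Regular c) : Continuous P.Qt :=
  h.contQ.sub ((continuous_adjoint h.contH).clm_comp (h.continuous_Rinv.clm_comp h.contH))

theorem continuous_S (h : P.Regular c) : Continuous P.S :=
  h.contB.clm_comp (h.continuous_Rinv.clm_comp (continuous_adjoint h.contB))

theorem norm_At_le (h : P.Regular c) (t : ℝ) : ‖P.At t‖ ≤ c.kappa := by
  have := c.lamB_pos; have := c.lamH_pos; have := c.γR_pos
  calc ‖P.At t‖ ≤ ‖P.A t‖ + ‖P.B t‖ * (‖P.Rinv t‖ * ‖P.H t‖) :=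
        (norm_sub_le _ _).trans (add_le_add_right ((ContinuousLinearMap.opNorm_comp_le _ _).trans
          (mul_le_mul_of_nonneg_left (ContinuousLinearMap.opNorm_comp_le _ _) (norm_nonneg _))) _)
    _ ≤ c.lamA + c.lamB * (1 / c.γR * c.lamH) := by
        gcongr
        exacts [h.boundA t, h.boundB t, h.norm_Rinv_le t, h.boundH t]
    _ = c.kappa := by unfold LQConstants.kappa; ring

theorem norm_S_le (h : P.Regular c) (t : ℝ) : ‖P.S t‖ ≤ c.lamB ^ 2 / c.γR := by
  have := c.lamB_pos; have := c.γR_pos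
  calc ‖P.S t‖ ≤ ‖P.B t‖ * (‖P.Rinv t‖ * ‖(P.B t)†‖) :=
        (ContinuousLinearMap.opNorm_comp_le _ _).trans
          (mul_le_mul_of_nonneg_left (ContinuousLinearMap.opNorm_comp_le _ _) (norm_nonneg _))
    _ ≤ c.lamB * (1 / c.γR * c.lamB) := by
        gcongr
        exacts [h.boundB t, h.norm_Rinv_le t, norm_adjoint_le (h.boundB t)]
    _ = c.lamB ^ 2 / c.γR := by ring

theorem norm_Qt_le (h : P.Regular c) (t : ℝ) : ‖P.Qt t‖ ≤ c.lamQ + c.lamH ^ 2 / c.γR := by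
  have := c.lamH_pos; have := c.γR_pos
  calc ‖P.Qt t‖ ≤ ‖P.Q t‖ + ‖(P.H t)†‖ * (‖P.Rinv t‖ * ‖P.H t‖) :=
        (norm_sub_le _ _).trans (add_le_add_right ((ContinuousLinearMap.opNorm_comp_le _ _).trans
          (mul_le_mul_of_nonneg_left (ContinuousLinearMap.opNorm_comp_le _ _) (norm_nonneg _))) _)
    _ ≤ c.lamQ + c.lamH * (1 / c.γR * c.lamH) := by
        gcongr
        exacts [h.boundQ t, norm_adjoint_le (h.boundH t), h.norm_Rinv_le t, h.boundH t]
    _ = _ := by ring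

theorem Qt_symm (h : P.Regular c) (t : ℝ) (x y : Vec nx) : ⟪P.Qt t x, y⟫_ℝ = ⟪x, P.Qt t y⟫_ℝ :=
  symm_of_smul_one_le (h.coerciveQ t) x y

theorem le_inner_Qt (h : P.Regular c) (t : ℝ) (x : Vec nx) : c.γQ * ‖x‖ ^ 2 ≤ ⟪P.Qt t x, x⟫_ℝ :=
  le_inner_of_smul_one_le (h.coerciveQ t) x

/-- Passing from Q to Qt subtracts the nonnegative form of HᵀR⁻¹H, so the bound for Q survives. -/
theorem inner_Qt_le (h : P.Regular c) (t : ℝ) (x : Vec nx) :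
    ⟪P.Qt t x, x⟫_ℝ ≤ c.lamQ * ‖x‖ ^ 2 := by
  have h1 : ⟪P.Qt t x, x⟫_ℝ = ⟪P.Q t x, x⟫_ℝ - ⟪P.Rinv t (P.H t x), P.H t x⟫_ℝ := by
    simp only [Qt, sub_apply, ContinuousLinearMap.comp_apply, inner_sub_left,
      ContinuousLinearMap.adjoint_inner_left]
  have h2 := h.Rinv_nonneg t (P.H t x)
  have h3 : ⟪P.Q t x, x⟫_ℝ ≤ c.lamQ * ‖x‖ * ‖x‖ := (real_inner_le_norm _ _).trans
    (mul_le_mul_of_nonneg_right ((P.Q t).le_of_opNorm_le (h.boundQ t) x) (norm_nonneg _))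
  nlinarith

theorem inner_R_le (h : P.Regular c) (t : ℝ) (x : Vec nu) :
    ⟪P.R t x, x⟫_ℝ ≤ c.lamR * ‖x‖ ^ 2 := by
  have h3 : ⟪P.R t x, x⟫_ℝ ≤ c.lamR * ‖x‖ * ‖x‖ := (real_inner_le_norm _ _).trans
    (mul_le_mul_of_nonneg_right ((P.R t).le_of_opNorm_le (h.boundR t) x) (norm_nonneg _))
  nlinarith

theorem QT_symm (h : P.Regular c) (x y : Vec nx) : ⟪P.QT x, y⟫_ℝ = ⟪x, P.QT y⟫_ℝ :=
  symm_of_smul_one_le h.coerciveQT x y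

theorem inner_S (t : ℝ) (x y : Vec nx) :
    ⟪P.S t x, y⟫_ℝ = ⟪P.Rinv t (((P.B t)†) x), ((P.B t)†) y⟫_ℝ := by
  rw [ContinuousLinearMap.adjoint_inner_right]; rfl

theorem S_symm (h : P.Regular c) (t : ℝ) (x y : Vec nx) : ⟪P.S t x, y⟫_ℝ = ⟪x, P.S t y⟫_ℝ := by
  rw [inner_S, h.Rinv_symm, real_inner_comm, ← inner_S, real_inner_comm]

/-- The Gramian of `(A - B R⁻¹ H, B)` on a controllability interval. -/
theorem gramian_At_bounds (h : P.Regular c) {t₀ : ℝ} (ht₀ : t₀ ∈ Icc 0 (P.T - c.σ)) :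
    ∃ t₁ ∈ Icc t₀ (t₀ + c.σ), (∀ z, c.α₀' * ‖z‖ ^ 2 ≤ ⟪z, gramian P.At P.B t₀ t₁ z⟫_ℝ) ∧
      ∀ z, ⟪z, gramian P.At P.B t₀ t₁ z⟫_ℝ ≤ c.α₁' * ‖z‖ ^ 2 := by
  obtain ⟨t₁, ht₁, hlo, hhi⟩ := h.controllable t₀ ht₀
  refine ⟨t₁, ht₁, fun z => ?_, fun z => ?_⟩
  · have hA0 := c.lamA_pos; have := c.lamH_pos; have := c.γR_pos
    have := c.α₀_pos; have := c.α₁_pos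
    obtain ⟨x, y, hx0, hx1, hx, hy, hxb, -, hE⟩ := exists_steering h.contA h.boundA h.contB
      c.α₀_pos c.α₁_pos
      (fun z => by rw [real_inner_comm]; exact le_inner_of_smul_one_le hlo z)
      (fun z => by rw [real_inner_comm]; exact inner_le_of_le_smul_one hhi z) z
    have hxc : Continuous x := continuous_iff_continuousAt.2 fun t => (hx t).continuousAt
    have hBy : Continuous fun t => ((P.B t)†) (y t) := (continuous_adjoint h.contB).clm_apply hy
    -- Adding the feedback R⁻¹Hx to the steering control of (A, B) produces the same trajectory for
    -- (At, B). Controllability is thus transferred at the price of the energy of R⁻¹Hx.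
    set v : ℝ → Vec nu := fun t => -((P.B t)†) (y t) + P.Rinv t (P.H t (x t)) with hv
    have hvc : Continuous v :=
      hBy.neg.add (h.continuous_Rinv.clm_apply (h.contH.clm_apply hxc))
    refine le_inner_gramian_of_steering h.continuous_At h.norm_At_le h.contB ht₁.1 c.α₀'_pos
      hx0 hx1 (fun t => (hx t).congr_deriv ?_) hvc ?_
    · simp only [At, hv, sub_apply, ContinuousLinearMap.comp_apply, map_add]
      abel
    · have hc1 : Continuous fun t => 2 * ‖((P.B t)†) (y t)‖ ^ 2 := by fun_prop
      set D : ℝ := 2 * (c.lamH / c.γR) ^ 2 * ((1 + c.α₁ / c.α₀) * ‖z‖) ^ 2 with hD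
      have hc2 : Continuous fun t => Real.exp (2 * c.lamA * (t - t₀)) * D := by fun_prop
      calc ∫ t in t₀..t₁, ‖v t‖ ^ 2
          ≤ ∫ t in t₀..t₁, (2 * ‖((P.B t)†) (y t)‖ ^ 2 + Real.exp (2 * c.lamA * (t - t₀)) * D) := by
            refine intervalIntegral.integral_mono_on ht₁.1
              ((hvc.norm.pow 2).intervalIntegrable _ _)
              ((hc1.add hc2).intervalIntegrable _ _) fun t ht => ?_
            have h1 : ‖P.Rinv t (P.H t (x t))‖ ≤ c.lamH / c.γR *
                (Real.exp (c.lamA * (t - t₀)) * ((1 + c.α₁ / c.α₀) * ‖z‖)) := by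
              calc _ ≤ 1 / c.γR * (c.lamH * ‖x t‖) :=
                    (h.norm_Rinv_apply_le t _).trans (by
                      gcongr
                      exact (P.H t).le_of_opNorm_le (h.boundH t) _)
                _ = c.lamH / c.γR * ‖x t‖ := by ring
                _ ≤ _ := by
                    gcongr
                    exact hxb t ht
            -- The factor 2 from (a + b)² ≤ 2a² + 2b² is the 2 in the 2/α₀ of α₀'.
            have h2 : ‖v t‖ ^ 2 ≤ 2 * ‖((P.B t)†) (y t)‖ ^ 2 +
                2 * ‖P.Rinv t (P.H t (x t))‖ ^ 2 := by
              have h3 := norm_add_le (-((P.B t)†) (y t)) (P.Rinv t (P.H t (x t)))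
              rw [norm_neg] at h3
              have h4 := pow_le_pow_left₀ (norm_nonneg _) h3 2
              nlinarith [sq_nonneg (‖((P.B t)†) (y t)‖ - ‖P.Rinv t (P.H t (x t))‖)]
            refine h2.trans (add_le_add_right ?_ _)
            calc 2 * ‖P.Rinv t (P.H t (x t))‖ ^ 2 ≤ 2 * (c.lamH / c.γR *
                (Real.exp (c.lamA * (t - t₀)) * ((1 + c.α₁ / c.α₀) * ‖z‖))) ^ 2 := by gcongr
              _ = Real.exp (2 * c.lamA * (t - t₀)) * D := by
                rw [show 2 * c.lamA * (t - t₀) = c.lamA * (t - t₀) + c.lamA * (t - t₀) by ring,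
                  Real.exp_add, hD]
                ring
        _ = 2 * (∫ t in t₀..t₁, ‖((P.B t)†) (y t)‖ ^ 2) +
              ∫ t in t₀..t₁, Real.exp (2 * c.lamA * (t - t₀)) * D := by
            rw [intervalIntegral.integral_add (hc1.intervalIntegrable _ _)
              (hc2.intervalIntegrable _ _), intervalIntegral.integral_const_mul]
        _ ≤ 2 * (‖z‖ ^ 2 / c.α₀) + (Real.exp (2 * c.lamA * c.σ) - 1) / (2 * c.lamA) * D := by
            gcongr
            exact integral_exp_sq_mul_le hA0 ht₁.2 (by positivity)
        _ = ‖z‖ ^ 2 / c.α₀' := by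
            rw [LQConstants.α₀', div_inv_eq_mul, hD]
            field_simp
  · rw [c.α₁'_eq]
    exact inner_gramian_le h.continuous_At h.norm_At_le h.contB c.kappa_pos h.boundB ht₁.1 ht₁.2 z

end Regular

end LQProblem

/-! ### The homogeneous Hamiltonian system: two-sided Riccati bounds and decay. -/

namespace LQProblem

variable {nx nu nd : ℕ} {P : LQProblem nx nu nd} {c : LQConstants} {x y : ℝ → Vec nx}

/-- `(x, y)` solves the Hamiltonian system with the homogeneous terminal condition
`y(T) = Q_T x(T)`. -/
structure IsHamiltonian (P : LQProblem nx nu nd) (x y : ℝ → Vec nx) : Prop where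
  state : ∀ t, HasDerivAt x (P.At t (x t) - P.S t (y t)) t
  costate : ∀ t, HasDerivAt y (-(P.Qt t (x t)) - ((P.At t)†) (y t)) t
  terminal : y P.T = P.QT (x P.T)

namespace IsHamiltonian

/-- The terms with At cancel by duality, and both remaining terms are dissipative. This makes ⟨y, x⟩
the Lyapunov function for everything below. -/
theorem value_hasDerivAt (hxy : P.IsHamiltonian x y) (t : ℝ) :
    HasDerivAt (fun t => ⟪y t, x t⟫_ℝ) (-(⟪P.Qt t (x t), x t⟫_ℝ + ⟪P.S t (y t), y t⟫_ℝ)) t := by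
  refine (hasDerivAt_inner_adjoint (hxy.costate t)
    ((hxy.state t).congr_deriv (sub_eq_add_neg _ _))).congr_deriv ?_
  rw [inner_neg_left, inner_neg_right, real_inner_comm]
  ring

theorem S_nonneg (h : P.Regular c) (t : ℝ) (y : Vec nx) : 0 ≤ ⟪P.S t y, y⟫_ℝ := by
  rw [Regular.inner_S]; exact h.Rinv_nonneg t _

theorem value_antitone (h : P.Regular c) (hxy : P.IsHamiltonian x y) :
    Antitone fun t => ⟪y t, x t⟫_ℝ := by
  refine antitone_of_deriv_nonpos (fun t => (hxy.value_hasDerivAt t).differentiableAt) fun t => ?_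
  rw [(hxy.value_hasDerivAt t).deriv]
  have h1 := h.le_inner_Qt t (x t)
  have h2 := S_nonneg h t (y t)
  have h3 : 0 ≤ c.γQ * ‖x t‖ ^ 2 := by have := c.γQ_pos; positivity
  linarith

theorem le_value_terminal (h : P.Regular c) (hxy : P.IsHamiltonian x y) :
    c.γQ * ‖x P.T‖ ^ 2 ≤ ⟪y P.T, x P.T⟫_ℝ := by
  rw [hxy.terminal]; exact le_inner_of_smul_one_le h.coerciveQT _

theorem value_nonneg (h : P.Regular c) (hxy : P.IsHamiltonian x y) {t : ℝ} (ht : t ≤ P.T) :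
    0 ≤ ⟪y t, x t⟫_ℝ := by
  have := c.γQ_pos
  exact (by positivity : 0 ≤ c.γQ * ‖x P.T‖ ^ 2).trans
    ((hxy.le_value_terminal h).trans (hxy.value_antitone h ht))

/-- Dual lower estimate of the value along an interval, with the weight `1 - m (s - t)`. -/
theorem norm_sq_sub_value_le (h : P.Regular c) (hxy : P.IsHamiltonian x y) {t t₁ m N : ℝ}
    (ht : t ≤ t₁) (hm : 0 ≤ m) (hm1 : m * (t₁ - t) ≤ 1) (hN : 0 < N) :
    ‖x t‖ ^ 2 - N / 2 * ⟪y t, x t⟫_ℝ ≤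
      (1 - m * (t₁ - t)) * ⟪adjointEvolution P.At t₁ t (x t), x t₁⟫_ℝ - N / 2 * ⟪y t₁, x t₁⟫_ℝ +
      (Real.exp (2 * c.kappa * (t₁ - t)) - 1) / (2 * c.kappa) *
        (‖x t‖ ^ 2 / (2 * N) * (m ^ 2 / c.γQ + c.lamB ^ 2 / c.γR)) := by
  have hγQ := c.γQ_pos; have hγR := c.γR_pos; have hκ := c.kappa_pos; have hB := c.lamB_pos
  -- The dual test function: ⟨ψ, x⟩ equals ‖x(t)‖² at time t and changes only through S y.
  -- Multiplied by the weight, its variation is to be absorbed by N/2 times the dissipation of the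
  -- value.
  set ψ : ℝ → Vec nx := fun s => adjointEvolution P.At s t (x t) with hψ
  have hd : ∀ s, HasDerivAt (fun s => N / 2 * ⟪y s, x s⟫_ℝ - (1 - m * (s - t)) * ⟪ψ s, x s⟫_ℝ)
      (N / 2 * -(⟪P.Qt s (x s), x s⟫_ℝ + ⟪P.S s (y s), y s⟫_ℝ) -
        (-m * ⟪ψ s, x s⟫_ℝ + (1 - m * (s - t)) * -⟪ψ s, P.S s (y s)⟫_ℝ)) s := fun s => by
    have h1 : HasDerivAt (fun s => 1 - m * (s - t)) (-m) s := by
      simpa using (((hasDerivAt_id s).sub_const t).const_mul m).const_sub 1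
    have h2 := hasDerivAt_inner_adjoint
      (adjointEvolution_apply_hasDerivAt h.continuous_At h.norm_At_le t (x t) s)
      ((hxy.state s).congr_deriv (sub_eq_add_neg _ _))
    refine (((hxy.value_hasDerivAt s).const_mul (N / 2)).sub (h1.mul h2)).congr_deriv ?_
    rw [inner_zero_left, add_zero, inner_neg_right]
  set D : ℝ := ‖x t‖ ^ 2 / (2 * N) * (m ^ 2 / c.γQ + c.lamB ^ 2 / c.γR) with hD
  have hle := sub_le_integral_of_hasDerivAt (φ := fun s => Real.exp (2 * c.kappa * (s - t)) * D)
    ht hd (by fun_prop) fun s hs => by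
      have hψs : ‖ψ s‖ ≤ Real.exp (c.kappa * (s - t)) * ‖x t‖ :=
        norm_adjointEvolution_apply_le h.continuous_At h.norm_At_le hs.1 _
      have hψ2 : ‖ψ s‖ ^ 2 ≤ Real.exp (2 * c.kappa * (s - t)) * ‖x t‖ ^ 2 := by
        refine (pow_le_pow_left₀ (norm_nonneg _) hψs 2).trans_eq ?_
        rw [show 2 * c.kappa * (s - t) = c.kappa * (s - t) + c.kappa * (s - t) by ring,
          Real.exp_add]
        ring
      set v : Vec nu := P.Rinv s (((P.B s)†) (y s)) with hv
      have e1 : ⟪P.S s (y s), y s⟫_ℝ = ⟪P.R s v, v⟫_ℝ := by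
        rw [Regular.inner_S, h.R_Rinv, real_inner_comm]
      have e2 : ⟪ψ s, P.S s (y s)⟫_ℝ = ⟪ψ s, P.B s v⟫_ℝ := rfl
      have hφ0 : 0 ≤ 1 - m * (s - t) := by nlinarith [hs.2]
      have hφ1 : 1 - m * (s - t) ≤ 1 := by nlinarith [hs.1]
      have i1 := h.le_inner_Qt s (x s)
      have i2 := h.le_inner_R s v
      have i3 : m * ⟪ψ s, x s⟫_ℝ ≤ m * (‖ψ s‖ * ‖x s‖) :=
        mul_le_mul_of_nonneg_left (real_inner_le_norm _ _) hm
      have i4 : (1 - m * (s - t)) * ⟪ψ s, P.B s v⟫_ℝ ≤ ‖ψ s‖ * (c.lamB * ‖v‖) := by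
        have j1 : ⟪ψ s, P.B s v⟫_ℝ ≤ ‖ψ s‖ * (c.lamB * ‖v‖) := (real_inner_le_norm _ _).trans
          (mul_le_mul_of_nonneg_left ((P.B s).le_of_opNorm_le (h.boundB s) v) (norm_nonneg _))
        calc _ ≤ (1 - m * (s - t)) * (‖ψ s‖ * (c.lamB * ‖v‖)) :=
              mul_le_mul_of_nonneg_left j1 hφ0
          _ ≤ _ := mul_le_of_le_one_left (by positivity) hφ1
      -- Used twice: the term created by the slope m of the weight goes into γ_Q‖x‖², and the term
      -- with the control v goes into γ_R‖v‖².
      have young : ∀ a b γ : ℝ, 0 < γ → a * b ≤ N / 2 * (γ * b ^ 2) + a ^ 2 / (2 * N * γ) := by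
        intro a b γ hγ
        have : N / 2 * (γ * b ^ 2) + a ^ 2 / (2 * N * γ) - a * b =
            (N * γ * b - a) ^ 2 / (2 * N * γ) := by field_simp; ring
        have h3 : 0 ≤ (N * γ * b - a) ^ 2 / (2 * N * γ) := by positivity
        linarith
      have i5 := young (m * ‖ψ s‖) ‖x s‖ c.γQ hγQ
      have i6 := young (c.lamB * ‖ψ s‖) ‖v‖ c.γR hγR
      have i7 : (m * ‖ψ s‖) ^ 2 / (2 * N * c.γQ) + (c.lamB * ‖ψ s‖) ^ 2 / (2 * N * c.γR) ≤
          Real.exp (2 * c.kappa * (s - t)) * D := by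
        calc _ = ‖ψ s‖ ^ 2 * (1 / (2 * N) * (m ^ 2 / c.γQ + c.lamB ^ 2 / c.γR)) := by
              field_simp
          _ ≤ (Real.exp (2 * c.kappa * (s - t)) * ‖x t‖ ^ 2) *
              (1 / (2 * N) * (m ^ 2 / c.γQ + c.lamB ^ 2 / c.γR)) :=
              mul_le_mul_of_nonneg_right hψ2 (by positivity)
          _ = _ := by rw [hD]; ring
      have i8 := mul_le_mul_of_nonneg_left i1 (by positivity : 0 ≤ N / 2)
      have i9 := mul_le_mul_of_nonneg_left i2 (by positivity : 0 ≤ N / 2)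
      rw [e1, e2]
      linarith
  rw [intervalIntegral.integral_mul_const, integral_exp_mul_sub (by positivity)] at hle
  have h0 : ψ t = x t := by rw [hψ]; simp [adjointEvolution_self]
  simp only [h0, sub_self, mul_zero, sub_zero, one_mul, real_inner_self_eq_norm_sq] at hle
  linarith

/-- The lower bound for the Riccati form. -/
theorem le_value (h : P.Regular c) (hxy : P.IsHamiltonian x y) {t : ℝ} (ht : t ∈ Icc 0 P.T) :
    c.c₀ * ‖x t‖ ^ 2 ≤ ⟪y t, x t⟫_ℝ := by
  have hγQ := c.γQ_pos; have hγR := c.γR_pos; have hκ := c.kappa_pos; have hB := c.lamB_pos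
  have hσ := c.σ_pos
  have hE := c.one_lt_exp_kappa
  have hE' := sub_pos.2 hE
  -- It is enough to find N with ‖x(t)‖² ≤ N⟨y, x⟩ and c₀N ≤ 1; in both cases N is chosen so that
  -- the error terms add up to at most ‖x(t)‖²/2.
  have concl : ∀ N, 0 < N → c.c₀ * N ≤ 1 →
      ‖x t‖ ^ 2 - N / 2 * ⟪y t, x t⟫_ℝ ≤ ‖x t‖ ^ 2 / 2 → c.c₀ * ‖x t‖ ^ 2 ≤ ⟪y t, x t⟫_ℝ := by
    intro N hN hN1 hle
    have h1 : ‖x t‖ ^ 2 ≤ N * ⟪y t, x t⟫_ℝ := by linarith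
    calc c.c₀ * ‖x t‖ ^ 2 ≤ c.c₀ * (N * ⟪y t, x t⟫_ℝ) :=
          mul_le_mul_of_nonneg_left h1 c.c₀_pos.le
      _ = (c.c₀ * N) * ⟪y t, x t⟫_ℝ := by ring
      _ ≤ _ := mul_le_of_le_one_left (hxy.value_nonneg h ht.2) hN1
  rcases le_or_gt (t + c.σ) P.T with hc | hc
  -- The slope m = 1/σ makes the weight vanish at t + σ, so no pairing remains there, and the value
  -- at t + σ has the good sign.
  · set N : ℝ := (c.lamB ^ 2 / c.γR + 1 / (c.γQ * c.σ ^ 2)) *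
      ((Real.exp (2 * c.kappa * c.σ) - 1) / (2 * c.kappa)) with hNdef
    have hN : 0 < N := by positivity
    refine concl N hN (c.c₀_mul_le_one le_rfl) ?_
    have h1 := hxy.norm_sq_sub_value_le h (t := t) (t₁ := t + c.σ) (m := 1 / c.σ) (N := N)
      (by linarith) (by positivity) (by rw [add_sub_cancel_left, one_div_mul_cancel hσ.ne']) hN
    rw [add_sub_cancel_left, one_div_mul_cancel hσ.ne', sub_self, zero_mul] at h1
    have h2 := mul_nonneg (by positivity : 0 ≤ N / 2) (hxy.value_nonneg h hc)
    have h3 : (Real.exp (2 * c.kappa * c.σ) - 1) / (2 * c.kappa) *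
        (‖x t‖ ^ 2 / (2 * N) * ((1 / c.σ) ^ 2 / c.γQ + c.lamB ^ 2 / c.γR)) = ‖x t‖ ^ 2 / 2 := by
      have : (Real.exp (2 * c.kappa * c.σ) - 1) / (2 * c.kappa) *
        (‖x t‖ ^ 2 / (2 * N) * ((1 / c.σ) ^ 2 / c.γQ + c.lamB ^ 2 / c.γR)) =
        ‖x t‖ ^ 2 / (2 * N) * N := by
        rw [hNdef]; field_simp; ring
      rw [this]; field_simp
    linarith
  -- Less than σ is left, so the weight stays 1 (m = 0) and the pairing at T is absorbed by the
  -- terminal coercivity γ_Q‖x(T)‖². The two summands of N pay for the running and the terminal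
  -- error.
  · set N : ℝ := Real.exp (2 * c.kappa * c.σ) *
      (c.lamB ^ 2 / (2 * c.γR * c.kappa) + 1 / c.γQ) with hNdef
    have hN : 0 < N := by positivity
    refine concl N hN c.c₀_mul_terminal_le_one ?_
    have h1 := hxy.norm_sq_sub_value_le h (t := t) (t₁ := P.T) (m := 0) (N := N)
      ht.2 le_rfl (by simp) hN
    simp only [zero_mul, sub_zero, one_mul] at h1
    set ψ := adjointEvolution P.At P.T t (x t) with hψ
    have hψn : ‖ψ‖ ≤ Real.exp (c.kappa * (P.T - t)) * ‖x t‖ :=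
      norm_adjointEvolution_apply_le h.continuous_At h.norm_At_le ht.2 _
    have hψ2 : ‖ψ‖ ^ 2 ≤ Real.exp (2 * c.kappa * c.σ) * ‖x t‖ ^ 2 := by
      refine (pow_le_pow_left₀ (norm_nonneg _) hψn 2).trans ?_
      rw [mul_pow, ← Real.exp_nat_mul]
      refine mul_le_mul_of_nonneg_right (Real.exp_le_exp.2 ?_) (by positivity)
      push_cast
      nlinarith
    have h2 : ⟪ψ, x P.T⟫_ℝ ≤ N / 2 * (c.γQ * ‖x P.T‖ ^ 2) + ‖ψ‖ ^ 2 / (2 * N * c.γQ) := by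
      refine (real_inner_le_norm _ _).trans ?_
      have e : N / 2 * (c.γQ * ‖x P.T‖ ^ 2) + ‖ψ‖ ^ 2 / (2 * N * c.γQ) - ‖ψ‖ * ‖x P.T‖ =
          (N * c.γQ * ‖x P.T‖ - ‖ψ‖) ^ 2 / (2 * N * c.γQ) := by field_simp; ring
      have : 0 ≤ (N * c.γQ * ‖x P.T‖ - ‖ψ‖) ^ 2 / (2 * N * c.γQ) := by positivity
      linarith
    have h3 := mul_le_mul_of_nonneg_left (hxy.le_value_terminal h) (by positivity : 0 ≤ N / 2)
    have h4 : (Real.exp (2 * c.kappa * (P.T - t)) - 1) / (2 * c.kappa) *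
        (‖x t‖ ^ 2 / (2 * N) * (0 ^ 2 / c.γQ + c.lamB ^ 2 / c.γR)) ≤
        Real.exp (2 * c.kappa * c.σ) / (2 * c.kappa) *
        (‖x t‖ ^ 2 / (2 * N) * (0 ^ 2 / c.γQ + c.lamB ^ 2 / c.γR)) := by
      gcongr
      have : Real.exp (2 * c.kappa * (P.T - t)) ≤ Real.exp (2 * c.kappa * c.σ) := by
        gcongr; linarith
      linarith
    have h5 : ‖ψ‖ ^ 2 / (2 * N * c.γQ) ≤
        Real.exp (2 * c.kappa * c.σ) * ‖x t‖ ^ 2 / (2 * N * c.γQ) := by gcongr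
    have h6 : Real.exp (2 * c.kappa * c.σ) / (2 * c.kappa) *
        (‖x t‖ ^ 2 / (2 * N) * (0 ^ 2 / c.γQ + c.lamB ^ 2 / c.γR)) +
        Real.exp (2 * c.kappa * c.σ) * ‖x t‖ ^ 2 / (2 * N * c.γQ) = ‖x t‖ ^ 2 / 2 := by
      have : Real.exp (2 * c.kappa * c.σ) / (2 * c.kappa) *
        (‖x t‖ ^ 2 / (2 * N) * (0 ^ 2 / c.γQ + c.lamB ^ 2 / c.γR)) +
        Real.exp (2 * c.kappa * c.σ) * ‖x t‖ ^ 2 / (2 * N * c.γQ) = ‖x t‖ ^ 2 / (2 * N) * N := by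
        rw [hNdef]; field_simp; ring
      rw [this]; field_simp
    linarith

/-- The value is at most the cost of any competitor, up to a boundary term. -/
theorem value_le_add_integral (h : P.Regular c) (hxy : P.IsHamiltonian x y) {xh : ℝ → Vec nx}
    {vh : ℝ → Vec nu} (hxh : ∀ s, HasDerivAt xh (P.At s (xh s) + P.B s (vh s)) s) {t t₁ : ℝ}
    (ht : t ≤ t₁) (h0 : xh t = x t) {φ : ℝ → ℝ} (hφ : Continuous φ)
    (hle : ∀ s ∈ Icc t t₁, c.lamQ * ‖xh s‖ ^ 2 + c.lamR * ‖vh s‖ ^ 2 ≤ φ s) :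
    ⟪y t, x t⟫_ℝ ≤ 2 * ⟪y t₁, xh t₁⟫_ℝ - ⟪y t₁, x t₁⟫_ℝ + ∫ s in t..t₁, φ s := by
  -- At time t this function is minus the value, since xh and x agree there. Its derivative falls
  -- short of the running cost of the competitor by exactly the squares in x - xh and vh + v, where
  -- -v is the optimal feedback control.
  have hd : ∀ s, HasDerivAt (fun s => ⟪y s, x s⟫_ℝ - 2 * ⟪y s, xh s⟫_ℝ)
      (-(⟪P.Qt s (x s), x s⟫_ℝ + ⟪P.S s (y s), y s⟫_ℝ) -
        2 * (⟪y s, P.B s (vh s)⟫_ℝ + ⟪-(P.Qt s (x s)), xh s⟫_ℝ)) s := fun s =>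
    (hxy.value_hasDerivAt s).sub
      ((hasDerivAt_inner_adjoint (hxy.costate s) (hxh s)).const_mul 2)
  have key := sub_le_integral_of_hasDerivAt ht hd hφ fun s hs => by
    refine le_trans ?_ (hle s hs)
    have hQ : 0 ≤ ⟪P.Qt s (x s - xh s), x s - xh s⟫_ℝ := by
      have := c.γQ_pos
      exact le_trans (by positivity) (h.le_inner_Qt s (x s - xh s))
    set v : Vec nu := P.Rinv s (((P.B s)†) (y s)) with hv
    have hR : 0 ≤ ⟪P.R s (vh s + v), vh s + v⟫_ℝ := by
      have := c.γR_pos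
      exact le_trans (by positivity) (h.le_inner_R s (vh s + v))
    have e1 : ⟪P.S s (y s), y s⟫_ℝ = ⟪P.R s v, v⟫_ℝ := by
      rw [Regular.inner_S, h.R_Rinv, real_inner_comm]
    have e2 : ⟪y s, P.B s (vh s)⟫_ℝ = ⟪P.R s v, vh s⟫_ℝ := by
      rw [hv, h.R_Rinv, ContinuousLinearMap.adjoint_inner_left]
    have e3 : ⟪P.R s (vh s), v⟫_ℝ = ⟪P.R s v, vh s⟫_ℝ := by rw [h.R_symm, real_inner_comm]
    have e4 : ⟪P.Qt s (xh s), x s⟫_ℝ = ⟪P.Qt s (x s), xh s⟫_ℝ := by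
      rw [h.Qt_symm, real_inner_comm]
    rw [map_sub, inner_sub_left, inner_sub_right, inner_sub_right, e4] at hQ
    rw [map_add, inner_add_left, inner_add_right, inner_add_right, e3] at hR
    rw [e1, e2, inner_neg_left]
    have := h.inner_Qt_le s (xh s)
    have := h.inner_R_le s (vh s)
    linarith
  rw [h0] at key
  linarith

/-- The upper bound for the Riccati form. -/
theorem value_le (h : P.Regular c) (hxy : P.IsHamiltonian x y) {t : ℝ} (ht : t ∈ Icc 0 P.T) :
    ⟪y t, x t⟫_ℝ ≤ c.c₁ * ‖x t‖ ^ 2 := by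
  have hκ := c.kappa_pos; have hB := c.lamB_pos; have hQ := c.lamQ_pos; have hR := c.lamR_pos
  have ha₀ := c.α₀'_pos; have ha₁ := c.α₁'_pos
  rcases le_or_gt (t + c.σ) P.T with hc | hc
  · obtain ⟨t₁, ht₁, hlo, hhi⟩ := h.gramian_At_bounds (t₀ := t) ⟨ht.1, by linarith⟩
    obtain ⟨xh, yh, hx0, hx1, hxh, -, hxb, hyb, -⟩ := exists_steering h.continuous_At h.norm_At_le
      h.contB ha₀ ha₁ hlo hhi (x t)
    set D : ℝ := (c.lamQ * (1 + c.α₁' / c.α₀') ^ 2 + c.lamR * c.lamB ^ 2 / c.α₀' ^ 2) *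
      ‖x t‖ ^ 2 with hD
    have h1 := hxy.value_le_add_integral h hxh ht₁.1 hx0
      (φ := fun s => Real.exp (2 * c.kappa * (s - t)) * D) (by fun_prop) fun s hs => by
        have i1 := hxb s hs
        have i2 : ‖-((P.B s)†) (yh s)‖ ≤
            c.lamB * (Real.exp (c.kappa * (s - t)) * (‖x t‖ / c.α₀')) := by
          rw [norm_neg]
          exact ((P.B s)†).le_of_opNorm_le_of_le (norm_adjoint_le (h.boundB s)) (hyb s hs)
        calc _ ≤ c.lamQ * (Real.exp (c.kappa * (s - t)) * ((1 + c.α₁' / c.α₀') * ‖x t‖)) ^ 2 +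
              c.lamR * (c.lamB * (Real.exp (c.kappa * (s - t)) * (‖x t‖ / c.α₀'))) ^ 2 := by
              gcongr
          _ = _ := by
              rw [show 2 * c.kappa * (s - t) = c.kappa * (s - t) + c.kappa * (s - t) by ring,
                Real.exp_add, hD]
              ring
    rw [hx1, inner_zero_right, mul_zero, zero_sub] at h1
    have h2 := hxy.value_nonneg h (ht₁.2.trans hc)
    have h3 := integral_exp_sq_mul_le hκ ht₁.2 (by positivity : 0 ≤ D)
    calc ⟪y t, x t⟫_ℝ ≤ (Real.exp (2 * c.kappa * c.σ) - 1) / (2 * c.kappa) * D := by linarith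
      _ = ((Real.exp (2 * c.kappa * c.σ) - 1) / (2 * c.kappa) *
          (c.lamQ * (1 + c.α₁' / c.α₀') ^ 2 + c.lamR * c.lamB ^ 2 / c.α₀' ^ 2)) * ‖x t‖ ^ 2 := by
          rw [hD]; ring
      _ ≤ _ := mul_le_mul_of_nonneg_right c.steering_cost_le_c₁ (by positivity)
  -- Too little time is left for controllability, so the competitor uses zero control; its growth
  -- over a time below σ is bounded by Gronwall and it pays the terminal cost.
  · set xh : ℝ → Vec nx := fun s => evolution P.At s t (x t) with hxh
    have hxb : ∀ s ∈ Icc t P.T, ‖xh s‖ ^ 2 ≤ Real.exp (2 * c.kappa * (s - t)) * ‖x t‖ ^ 2 := by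
      intro s hs
      refine (pow_le_pow_left₀ (norm_nonneg _) (norm_evolution_apply_le h.continuous_At
        h.norm_At_le hs.1 _) 2).trans_eq ?_
      rw [mul_pow, ← Real.exp_nat_mul]
      push_cast
      ring_nf
    have h1 := hxy.value_le_add_integral h (xh := xh) (vh := fun _ => 0)
      (fun s => by
        simpa using evolution_apply_hasDerivAt h.continuous_At h.norm_At_le t (x t) s) ht.2
      (by simp [hxh, evolution_self])
      (φ := fun s => Real.exp (2 * c.kappa * (s - t)) * (c.lamQ * ‖x t‖ ^ 2)) (by fun_prop)
      fun s hs => by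
        have := mul_le_mul_of_nonneg_left (hxb s hs) hQ.le
        simp only [norm_zero]
        linarith
    have h2 : 2 * ⟪y P.T, xh P.T⟫_ℝ - ⟪y P.T, x P.T⟫_ℝ ≤
        c.lamQ * (Real.exp (2 * c.kappa * c.σ) * ‖x t‖ ^ 2) := by
      have i1 : 0 ≤ ⟪P.QT (x P.T - xh P.T), x P.T - xh P.T⟫_ℝ := by
        have := c.γQ_pos
        exact le_trans (by positivity) (le_inner_of_smul_one_le h.coerciveQT (x P.T - xh P.T))
      have i2 := inner_le_of_le_smul_one h.boundQT (xh P.T)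
      have e : ⟪P.QT (xh P.T), x P.T⟫_ℝ = ⟪P.QT (x P.T), xh P.T⟫_ℝ := by
        rw [h.QT_symm, real_inner_comm]
      rw [map_sub, inner_sub_left, inner_sub_right, inner_sub_right, e] at i1
      rw [hxy.terminal]
      have i3 : c.lamQ * ‖xh P.T‖ ^ 2 ≤ c.lamQ * (Real.exp (2 * c.kappa * c.σ) * ‖x t‖ ^ 2) := by
        refine mul_le_mul_of_nonneg_left ((hxb P.T ⟨ht.2, le_rfl⟩).trans ?_) hQ.le
        gcongr
        linarith
      linarith
    have h3 := integral_exp_sq_mul_le (t₀ := t) hκ hc.le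
      (by positivity : 0 ≤ c.lamQ * ‖x t‖ ^ 2)
    calc ⟪y t, x t⟫_ℝ ≤ c.lamQ * (Real.exp (2 * c.kappa * c.σ) * ‖x t‖ ^ 2) +
          (Real.exp (2 * c.kappa * c.σ) - 1) / (2 * c.kappa) * (c.lamQ * ‖x t‖ ^ 2) := by linarith
      _ = (c.lamQ * Real.exp (2 * c.kappa * c.σ) +
          (Real.exp (2 * c.kappa * c.σ) - 1) / (2 * c.kappa) * c.lamQ) * ‖x t‖ ^ 2 := by ring
      _ ≤ _ := mul_le_mul_of_nonneg_right c.terminal_cost_le_c₁ (by positivity)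

/-- Exponential decay of the closed loop. -/
theorem norm_le_decay (h : P.Regular c) (hxy : P.IsHamiltonian x y) {s t : ℝ} (hs : 0 ≤ s)
    (hst : s ≤ t) (ht : t ≤ P.T) : ‖x t‖ ≤ c.cZ * Real.exp (-c.ρZ * (t - s)) * ‖x s‖ := by
  have hc₀ := c.c₀_pos; have hc₁ := c.c₁_pos; have hγ := c.γQ_pos
  -- This product is nonincreasing: the value is at most c₁‖x‖², it dissipates at least γ_Q‖x‖², and
  -- 2ρ_Z = γ_Q/c₁. The two Riccati bounds then convert values into norms, whence c_Z² = c₁/c₀.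
  have hd : ∀ r, HasDerivAt (fun r => Real.exp (2 * c.ρZ * (r - s)) * ⟪y r, x r⟫_ℝ)
      (Real.exp (2 * c.ρZ * (r - s)) * (2 * c.ρZ) * ⟪y r, x r⟫_ℝ +
        Real.exp (2 * c.ρZ * (r - s)) *
          -(⟪P.Qt r (x r), x r⟫_ℝ + ⟪P.S r (y r), y r⟫_ℝ)) r := fun r => by
    have h1 : HasDerivAt (fun r => 2 * c.ρZ * (r - s)) (2 * c.ρZ) r := by
      simpa using ((hasDerivAt_id r).sub_const s).const_mul (2 * c.ρZ)
    exact h1.exp.mul (hxy.value_hasDerivAt r)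
  have hle := sub_le_integral_of_hasDerivAt (φ := fun _ => 0) hst hd continuous_const
    fun r hr => by
      have hr' : r ∈ Icc 0 P.T := ⟨hs.trans hr.1, hr.2.trans ht⟩
      have i1 := hxy.value_le h hr'
      have i2 := h.le_inner_Qt r (x r)
      have i3 := S_nonneg h r (y r)
      have i4 : 2 * c.ρZ * ⟪y r, x r⟫_ℝ ≤ c.γQ * ‖x r‖ ^ 2 := by
        have e : 2 * c.ρZ = c.γQ / c.c₁ := by unfold LQConstants.ρZ; field_simp
        rw [e]
        calc _ ≤ c.γQ / c.c₁ * (c.c₁ * ‖x r‖ ^ 2) := by gcongr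
          _ = _ := by field_simp
      have i5 := mul_le_mul_of_nonneg_left (i4.trans i2)
        (Real.exp_pos (2 * c.ρZ * (r - s))).le
      have i6 := mul_nonneg (Real.exp_pos (2 * c.ρZ * (r - s))).le i3
      linarith
  simp only [sub_self, mul_zero, Real.exp_zero, one_mul, intervalIntegral.integral_zero] at hle
  have h1 := hxy.le_value h ⟨hs.trans hst, ht⟩
  have h2 := hxy.value_le h ⟨hs, hst.trans ht⟩
  set e := Real.exp (-c.ρZ * (t - s)) with he
  have he2 : Real.exp (2 * c.ρZ * (t - s)) * e ^ 2 = 1 := by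
    rw [he, ← Real.exp_nat_mul, ← Real.exp_add, ← Real.exp_zero]
    congr 1
    push_cast
    ring
  have he0 : 0 < e := Real.exp_pos _
  have h3 : c.c₀ * ‖x t‖ ^ 2 ≤ e ^ 2 * (c.c₁ * ‖x s‖ ^ 2) := by
    calc _ ≤ ⟪y t, x t⟫_ℝ := h1
      _ = e ^ 2 * (Real.exp (2 * c.ρZ * (t - s)) * ⟪y t, x t⟫_ℝ) := by
        rw [← mul_assoc, mul_comm (e ^ 2), he2, one_mul]
      _ ≤ _ := mul_le_mul_of_nonneg_left (by linarith) (by positivity)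
  refine abs_le_of_sq_le_sq' (a := ‖x t‖) ?_ (by have := c.cZ_pos; positivity) |>.2
  rw [mul_pow, mul_pow, LQConstants.cZ, Real.sq_sqrt (by positivity)]
  calc ‖x t‖ ^ 2 = c.c₀ * ‖x t‖ ^ 2 / c.c₀ := by field_simp
    _ ≤ e ^ 2 * (c.c₁ * ‖x s‖ ^ 2) / c.c₀ := by gcongr
    _ = _ := by ring

end IsHamiltonian

/-! ### The fundamental pair and the inhomogeneous boundary value problem. -/

/-- The matrix of the Hamiltonian system. -/
def hamOp (P : LQProblem nx nu nd) (t : ℝ) : (Vec nx × Vec nx) →L[ℝ] (Vec nx × Vec nx) :=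
  ContinuousLinearMap.inl ℝ (Vec nx) (Vec nx) ∘L
      (P.At t ∘L ContinuousLinearMap.fst ℝ (Vec nx) (Vec nx) -
        P.S t ∘L ContinuousLinearMap.snd ℝ (Vec nx) (Vec nx)) +
    ContinuousLinearMap.inr ℝ (Vec nx) (Vec nx) ∘L
      (-(P.Qt t ∘L ContinuousLinearMap.fst ℝ (Vec nx) (Vec nx)) -
        (P.At t)† ∘L ContinuousLinearMap.snd ℝ (Vec nx) (Vec nx))

theorem hamOp_apply (t : ℝ) (z : Vec nx × Vec nx) :
    P.hamOp t z = (P.At t z.1 - P.S t z.2, -(P.Qt t z.1) - ((P.At t)†) z.2) := by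
  simp [hamOp]

namespace Regular

theorem continuous_hamOp (h : P.Regular c) : Continuous P.hamOp := by
  have h1 := h.continuous_At
  have h2 := h.continuous_S
  have h3 := h.continuous_Qt
  have h4 := continuous_adjoint h.continuous_At
  exact (continuous_const.clm_comp ((h1.clm_comp continuous_const).sub
    (h2.clm_comp continuous_const))).add (continuous_const.clm_comp
      ((h3.clm_comp continuous_const).neg.sub (h4.clm_comp continuous_const)))

theorem exists_norm_hamOp_le (h : P.Regular c) : ∃ K, ∀ t, ‖P.hamOp t‖ ≤ K := by
  have := c.kappa_pos; have := c.γR_pos; have := c.lamQ_pos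
  refine ⟨c.kappa + c.lamB ^ 2 / c.γR + (c.lamQ + c.lamH ^ 2 / c.γR), fun t =>
    ContinuousLinearMap.opNorm_le_bound _ (by positivity) fun z => ?_⟩
  have a1 := (P.At t).le_of_opNorm_le_of_le (h.norm_At_le t) (norm_fst_le z)
  have a2 := (P.S t).le_of_opNorm_le_of_le (h.norm_S_le t) (norm_snd_le z)
  have a3 := (P.Qt t).le_of_opNorm_le_of_le (h.norm_Qt_le t) (norm_fst_le z)
  have a4 := ((P.At t)†).le_of_opNorm_le_of_le (norm_adjoint_le (h.norm_At_le t)) (norm_snd_le z)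
  have b1 : 0 ≤ c.lamB ^ 2 / c.γR * ‖z‖ := by positivity
  have b2 : 0 ≤ (c.lamQ + c.lamH ^ 2 / c.γR) * ‖z‖ := by positivity
  rw [hamOp_apply]
  refine max_le ((norm_sub_le _ _).trans ?_) ((norm_sub_le _ _).trans ?_)
  · linarith
  · simp only [norm_neg]; linarith

end Regular

/-- A fundamental solution of the Hamiltonian system with `Y(T) = Q_T X(T)`, `X(T) = I`. -/
structure IsFundamental (P : LQProblem nx nu nd) (X Y : ℝ → Mat nx nx) : Prop where
  state : ∀ t, HasDerivAt X (P.At t ∘L X t - P.S t ∘L Y t) t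
  costate : ∀ t, HasDerivAt Y (-(P.Qt t ∘L X t) - (P.At t)† ∘L Y t) t
  X_terminal : X P.T = 1
  Y_terminal : Y P.T = P.QT

/-- A Volterra equation for the full flow Φ, with operators acting by composition on the left and
Φ(T) = I, is solved first; the pair is Φ restricted to the terminal subspace. -/
theorem Regular.exists_fundamental (h : P.Regular c) : ∃ X Y, P.IsFundamental X Y := by
  obtain ⟨K, hK⟩ := h.exists_norm_hamOp_le
  have hKc : ∀ t, ‖ContinuousLinearMap.compL ℝ (Vec nx × Vec nx) (Vec nx × Vec nx)
      (Vec nx × Vec nx) (P.hamOp t)‖ ≤ K := fun t =>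
    ((ContinuousLinearMap.compL ℝ (Vec nx × Vec nx) (Vec nx × Vec nx)
      (Vec nx × Vec nx)).le_opNorm (P.hamOp t)).trans
      ((mul_le_mul (ContinuousLinearMap.norm_compL_le _ _ _ _) (hK t) (norm_nonneg _)
        zero_le_one).trans_eq (one_mul K))
  have hMc := (ContinuousLinearMap.compL ℝ (Vec nx × Vec nx) (Vec nx × Vec nx)
    (Vec nx × Vec nx)).continuous.comp h.continuous_hamOp
  obtain ⟨Φ, hΦc, hΦ⟩ := exists_volterra_solution (h := fun _ => ContinuousLinearMap.id ℝ _)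
    hMc hKc continuous_const (fun _ => le_rfl) P.T
  have hd : ∀ t, HasDerivAt Φ (P.hamOp t ∘L Φ t) t := fun t => by
    have hc := hMc.clm_apply hΦc
    have h1 := (intervalIntegral.integral_hasDerivAt_right (hc.intervalIntegrable P.T t)
      hc.aestronglyMeasurable.stronglyMeasurableAtFilter hc.continuousAt).const_add
      (ContinuousLinearMap.id ℝ (Vec nx × Vec nx))
    exact h1.congr_of_eventuallyEq (Filter.Eventually.of_forall hΦ)
  -- The graph of Q_T, which is the set of admissible terminal data when g = 0.
  set J : Vec nx →L[ℝ] Vec nx × Vec nx := (ContinuousLinearMap.id ℝ _).prod P.QT with hJ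
  have hT : Φ P.T = ContinuousLinearMap.id ℝ _ := by rw [hΦ]; simp
  have key : ∀ (π : Vec nx × Vec nx →L[ℝ] Vec nx) (t : ℝ),
      HasDerivAt (fun t => π ∘L Φ t ∘L J) (π ∘L P.hamOp t ∘L Φ t ∘L J) t := fun π t => by
    refine ((hasDerivAt_const t π).clm_comp ((hd t).clm_comp (hasDerivAt_const t J))).congr_deriv ?_
    simp only [ContinuousLinearMap.comp_zero, ContinuousLinearMap.zero_comp, zero_add, add_zero]
    rfl
  refine ⟨fun t => ContinuousLinearMap.fst ℝ _ _ ∘L Φ t ∘L J,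
    fun t => ContinuousLinearMap.snd ℝ _ _ ∘L Φ t ∘L J, fun t => ?_, fun t => ?_, ?_, ?_⟩
  · refine (key _ t).congr_deriv (ContinuousLinearMap.ext fun b => ?_)
    simp [hamOp_apply]
  · refine (key _ t).congr_deriv (ContinuousLinearMap.ext fun b => ?_)
    simp [hamOp_apply]
  · refine ContinuousLinearMap.ext fun b => ?_
    simp [hT, hJ]
  · refine ContinuousLinearMap.ext fun b => ?_
    simp [hT, hJ]

namespace IsFundamental

variable {X Y : ℝ → Mat nx nx}

theorem isHamiltonian (hXY : P.IsFundamental X Y) (b : Vec nx) :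
    P.IsHamiltonian (fun t => X t b) (fun t => Y t b) where
  state t := by simpa using (hXY.state t).clm_apply (hasDerivAt_const t b)
  costate t := by simpa using (hXY.costate t).clm_apply (hasDerivAt_const t b)
  terminal := by simp [hXY.X_terminal, hXY.Y_terminal]

/-- If X(t)b = 0 then the value vanishes at t, but it can only decrease up to T, where it is at
least γ_Q‖b‖². -/
theorem injective_X (h : P.Regular c) (hXY : P.IsFundamental X Y) {t : ℝ} (ht : t ≤ P.T) :
    Function.Injective (X t) := by
  refine (injective_iff_map_eq_zero _).2 fun b hb => ?_
  have h1 := (hXY.isHamiltonian b).value_antitone h ht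
  have h2 := (hXY.isHamiltonian b).le_value_terminal h
  simp only [hb, inner_zero_right, hXY.X_terminal, one_apply_eq_self] at h1 h2
  have h3 : c.γQ * ‖b‖ ^ 2 ≤ 0 := h2.trans h1
  have h4 := c.γQ_pos
  have h5 : ‖b‖ ^ 2 ≤ 0 := by
    by_contra hne
    push Not at hne
    nlinarith
  exact norm_eq_zero.1 (pow_eq_zero_iff two_ne_zero |>.1 (le_antisymm h5 (by positivity)))

theorem isUnit_X (h : P.Regular c) (hXY : P.IsFundamental X Y) {t : ℝ} (ht : t ≤ P.T) :
    IsUnit (X t) := by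
  rw [ContinuousLinearMap.isUnit_iff_bijective]
  exact ⟨hXY.injective_X h ht, LinearMap.injective_iff_surjective.1 (hXY.injective_X h ht)⟩

theorem exists_X_apply_eq (h : P.Regular c) (hXY : P.IsFundamental X Y) {t : ℝ} (ht : t ≤ P.T)
    (z : Vec nx) : ∃ b, X t b = z :=
  (ContinuousLinearMap.isUnit_iff_bijective.1 (hXY.isUnit_X h ht)).2 z

end IsFundamental

/-- Solvability of the inhomogeneous Hamiltonian boundary value problem. -/
theorem Regular.exists_trajectory (h : P.Regular c) {f₁ f₂ : ℝ → Vec nx} (hf₁ : Integrable f₁)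
    (hf₂ : Integrable f₂) (x₀ g : Vec nx) : ∃ x p : ℝ → Vec nx, Continuous x ∧ Continuous p ∧
      (∀ t, x t = x P.T + (∫ s in P.T..t, f₁ s) + ∫ s in P.T..t, (P.At s (x s) - P.S s (p s))) ∧
      (∀ t, p t = p P.T + (∫ s in P.T..t, f₂ s) +
        ∫ s in P.T..t, (-(P.Qt s (x s)) - ((P.At s)†) (p s))) ∧
      x 0 = x₀ ∧ p P.T = P.QT (x P.T) + g := by
  obtain ⟨K, hK⟩ := h.exists_norm_hamOp_le
  obtain ⟨X, Y, hXY⟩ := h.exists_fundamental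
  have hprim : ∀ {f : ℝ → Vec nx}, Integrable f → Continuous (fun t => ∫ s in P.T..t, f s) ∧
      ∀ t, ‖∫ s in P.T..t, f s‖ ≤ ∫ s, ‖f s‖ := fun {f} hf =>
    ⟨intervalIntegral.continuous_primitive (fun a b => hf.intervalIntegrable) _, fun t =>
      intervalIntegral.norm_integral_le_integral_norm_uIoc.trans
        (setIntegral_le_integral hf.norm (Filter.Eventually.of_forall fun _ => norm_nonneg _))⟩
  -- A particular solution, integrated backwards from z(T) = (0, g), which already satisfies the
  -- inhomogeneous terminal condition.
  obtain ⟨z, hzc, hz⟩ := exists_volterra_solution (D := (∫ s, ‖f₁ s‖) + (‖g‖ + ∫ s, ‖f₂ s‖))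
    (h := fun t => ((∫ s in P.T..t, f₁ s), g + ∫ s in P.T..t, f₂ s)) h.continuous_hamOp hK
    ((hprim hf₁).1.prodMk (continuous_const.add (hprim hf₂).1)) (fun t => by
      have h1 := (hprim hf₁).2 t
      have h2 := (norm_add_le g _).trans (add_le_add_right ((hprim hf₂).2 t) ‖g‖)
      refine max_le (h1.trans ?_) (h2.trans ?_)
      · have : 0 ≤ ∫ s, ‖f₂ s‖ := integral_nonneg fun _ => norm_nonneg _
        have := norm_nonneg g
        linarith
      · have : 0 ≤ ∫ s, ‖f₁ s‖ := integral_nonneg fun _ => norm_nonneg _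
        linarith) P.T
  -- Shooting: adding (Xb, Yb) preserves the terminal condition, and invertibility of X(0) allows
  -- the initial state to be corrected.
  obtain ⟨b, hb⟩ := hXY.exists_X_apply_eq h h.T_pos.le (x₀ - (z 0).1)
  have hham := hXY.isHamiltonian b
  have hxc : Continuous fun t => X t b :=
    continuous_iff_continuousAt.2 fun t => (hham.state t).continuousAt
  have hyc : Continuous fun t => Y t b :=
    continuous_iff_continuousAt.2 fun t => (hham.costate t).continuousAt
  have c1 : ∀ {x p : ℝ → Vec nx}, Continuous x → Continuous p →
      Continuous fun s => P.At s (x s) - P.S s (p s) := fun hx hp =>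
    (h.continuous_At.clm_apply hx).sub (h.continuous_S.clm_apply hp)
  have c2 : ∀ {x p : ℝ → Vec nx}, Continuous x → Continuous p →
      Continuous fun s => -(P.Qt s (x s)) - ((P.At s)†) (p s) := fun hx hp =>
    (h.continuous_Qt.clm_apply hx).neg.sub ((continuous_adjoint h.continuous_At).clm_apply hp)
  have hMz := h.continuous_hamOp.clm_apply hzc
  have hz1 : ∀ t, (z t).1 = (∫ s in P.T..t, f₁ s) +
      ∫ s in P.T..t, (P.At s (z s).1 - P.S s (z s).2) := fun t => by
    have := (ContinuousLinearMap.fst ℝ (Vec nx) (Vec nx)).intervalIntegral_comp_comm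
      (hMz.intervalIntegrable (μ := volume) P.T t)
    simp only [hamOp_apply, ContinuousLinearMap.coe_fst'] at this
    conv_lhs => rw [hz t]
    simp only [hamOp_apply, Prod.fst_add, this]
  have hz2 : ∀ t, (z t).2 = g + (∫ s in P.T..t, f₂ s) +
      ∫ s in P.T..t, (-(P.Qt s (z s).1) - ((P.At s)†) (z s).2) := fun t => by
    have := (ContinuousLinearMap.snd ℝ (Vec nx) (Vec nx)).intervalIntegral_comp_comm
      (hMz.intervalIntegrable (μ := volume) P.T t)
    simp only [hamOp_apply, ContinuousLinearMap.coe_snd'] at this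
    conv_lhs => rw [hz t]
    simp only [hamOp_apply, Prod.snd_add, this]
  have hX : ∀ t, X t b = b + ∫ s in P.T..t, (P.At s (X s b) - P.S s (Y s b)) := fun t => by
    rw [intervalIntegral.integral_eq_sub_of_hasDerivAt (fun s _ => hham.state s)
      ((c1 hxc hyc).intervalIntegrable _ _), hXY.X_terminal]
    simp
  have hY : ∀ t, Y t b = P.QT b + ∫ s in P.T..t, (-(P.Qt s (X s b)) - ((P.At s)†) (Y s b)) :=
    fun t => by
    rw [intervalIntegral.integral_eq_sub_of_hasDerivAt (fun s _ => hham.costate s)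
      ((c2 hxc hyc).intervalIntegrable _ _), hXY.Y_terminal]
    simp
  have hzT1 : (z P.T).1 = 0 := by rw [hz1]; simp
  have hzT2 : (z P.T).2 = g := by rw [hz2]; simp
  refine ⟨fun t => (z t).1 + X t b, fun t => (z t).2 + Y t b, hzc.fst.add hxc, hzc.snd.add hyc,
    fun t => ?_, fun t => ?_, ?_, ?_⟩
  · simp only [hzT1, hXY.X_terminal, one_apply_eq_self, zero_add]
    rw [hX t, hz1 t, show (fun s => P.At s ((z s).1 + X s b) - P.S s ((z s).2 + Y s b)) =
      fun s => (P.At s (z s).1 - P.S s (z s).2) + (P.At s (X s b) - P.S s (Y s b)) by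
        funext s; simp only [map_add]; abel,
      intervalIntegral.integral_add ((c1 hzc.fst hzc.snd).intervalIntegrable _ _)
        ((c1 hxc hyc).intervalIntegrable _ _)]
    abel
  · simp only [hzT2, hXY.Y_terminal]
    rw [hY t, hz2 t, show (fun s => -(P.Qt s ((z s).1 + X s b)) -
        ((P.At s)†) ((z s).2 + Y s b)) =
      fun s => (-(P.Qt s (z s).1) - ((P.At s)†) (z s).2) +
        (-(P.Qt s (X s b)) - ((P.At s)†) (Y s b)) by
        funext s; simp only [map_add]; abel,
      intervalIntegral.integral_add ((c2 hzc.fst hzc.snd).intervalIntegrable _ _)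
        ((c2 hxc hyc).intervalIntegrable _ _)]
    abel
  · simp [hb]
  · simp [hzT1, hzT2, hXY.X_terminal, hXY.Y_terminal, add_comm]

/-! ### Bounded inputs and extremals. -/

namespace IsBoundedInput

variable {k m : ℕ} {f g : ℝ → Vec m}

theorem of_continuous (hf : Continuous f) : P.IsBoundedInput f :=
  ⟨hf.aestronglyMeasurable, isCompact_Icc.exists_bound_of_continuousOn hf.continuousOn⟩

theorem of_continuousOn (hf : ContinuousOn f (Icc 0 P.T)) : P.IsBoundedInput f :=
  ⟨hf.aestronglyMeasurable measurableSet_Icc, isCompact_Icc.exists_bound_of_continuousOn hf⟩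

theorem add (hf : P.IsBoundedInput f) (hg : P.IsBoundedInput g) :
    P.IsBoundedInput fun t => f t + g t := by
  obtain ⟨M, hM⟩ := hf.2
  obtain ⟨N, hN⟩ := hg.2
  exact ⟨hf.1.add hg.1, M + N, fun t ht => (norm_add_le _ _).trans (add_le_add (hM t ht) (hN t ht))⟩

theorem neg (hf : P.IsBoundedInput f) : P.IsBoundedInput fun t => -f t := by
  obtain ⟨M, hM⟩ := hf.2
  exact ⟨hf.1.neg, M, fun t ht => by rw [norm_neg]; exact hM t ht⟩

theorem sub (hf : P.IsBoundedInput f) (hg : P.IsBoundedInput g) :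
    P.IsBoundedInput fun t => f t - g t := by
  simpa only [sub_eq_add_neg] using hf.add hg.neg

theorem clm_apply {L : ℝ → Mat k m} (hL : Continuous L) (hf : P.IsBoundedInput f) :
    P.IsBoundedInput fun t => L t (f t) := by
  obtain ⟨M, hM⟩ := hf.2
  obtain ⟨N, hN⟩ := isCompact_Icc.exists_bound_of_continuousOn (hL.continuousOn (s := Icc 0 P.T))
  refine ⟨?_, N * M, fun t ht => (L t).le_of_opNorm_le_of_le (hN t ht) (hM t ht)⟩
  exact isBoundedBilinearMap_apply.continuous.comp_aestronglyMeasurable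
    (hL.aestronglyMeasurable.prodMk hf.1)

theorem integrableOn (hf : P.IsBoundedInput f) : IntegrableOn f (Icc 0 P.T) := by
  obtain ⟨M, hM⟩ := hf.2
  exact .of_bound measure_Icc_lt_top hf.1 M ((ae_restrict_iff' measurableSet_Icc).2
    (Filter.Eventually.of_forall hM))

theorem intervalIntegrable (hf : P.IsBoundedInput f) {a b : ℝ} (ha : a ∈ Icc 0 P.T)
    (hb : b ∈ Icc 0 P.T) : IntervalIntegrable f volume a b :=
  (hf.integrableOn.mono_set (uIcc_subset_Icc ha hb)).intervalIntegrable

theorem intervalIntegrable_inner (hT : 0 ≤ P.T) (hf : P.IsBoundedInput f)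
    (hg : P.IsBoundedInput g) :
    IntervalIntegrable (fun t => ⟪f t, g t⟫_ℝ) volume 0 P.T := by
  obtain ⟨M, hM⟩ := hf.2
  obtain ⟨N, hN⟩ := hg.2
  have h0 : 0 ≤ M := (norm_nonneg _).trans (hM 0 ⟨le_rfl, hT⟩)
  have : IntegrableOn (fun t => ⟪f t, g t⟫_ℝ) (Icc 0 P.T) :=
    .of_bound measure_Icc_lt_top (hf.1.inner hg.1) (M * N)
      ((ae_restrict_iff' measurableSet_Icc).2 (Filter.Eventually.of_forall fun t ht =>
        (norm_inner_le_norm _ _).trans (mul_le_mul (hM t ht) (hN t ht) (norm_nonneg _) h0)))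
  rw [← uIcc_of_le hT] at this
  exact this.intervalIntegrable

end IsBoundedInput

/-- The part of the state equation of the Hamiltonian system driven by `d`, cut off outside the
horizon. -/
def forcingState (P : LQProblem nx nu nd) (d : ℝ → Vec nd) : ℝ → Vec nx :=
  (Icc 0 P.T).indicator fun t => P.C t (d t) - P.B t (P.Rinv t (((P.W t)†) (d t)))

/-- The part of the costate equation of the Hamiltonian system driven by `d`, cut off outside the
horizon. -/
def forcingCostate (P : LQProblem nx nu nd) (d : ℝ → Vec nd) : ℝ → Vec nx :=
  (Icc 0 P.T).indicator fun t => ((P.H t)†) (P.Rinv t (((P.W t)†) (d t))) - ((P.G t)†) (d t)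

/-- The control `-R⁻¹ (H x + Bᵀ p + Wᵀ d)` given by the stationarity condition. -/
def control (P : LQProblem nx nu nd) (d : ℝ → Vec nd) (x p : ℝ → Vec nx) (t : ℝ) : Vec nu :=
  -(P.Rinv t (P.H t (x t) + ((P.B t)†) (p t) + ((P.W t)†) (d t)))

/-- `(x, p)` solves the Hamiltonian boundary value problem with parameters `(d, d₀, d_T)`. -/
structure IsExtremal (P : LQProblem nx nu nd) (d : ℝ → Vec nd) (d0 : Vec nx) (dT : Vec nd)
    (x p : ℝ → Vec nx) : Prop where
  continuous_x : Continuous x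
  continuous_p : Continuous p
  state : ∀ t, x t = x P.T + (∫ s in P.T..t, P.forcingState d s) +
    ∫ s in P.T..t, (P.At s (x s) - P.S s (p s))
  costate : ∀ t, p t = p P.T + (∫ s in P.T..t, P.forcingCostate d s) +
    ∫ s in P.T..t, (-(P.Qt s (x s)) - ((P.At s)†) (p s))
  initial : x 0 = d0
  terminal : p P.T = P.QT (x P.T) + (P.GT†) dT

namespace Regular

theorem zero_mem (h : P.Regular c) : (0 : ℝ) ∈ Icc 0 P.T := ⟨le_rfl, h.T_pos.le⟩

theorem T_mem (h : P.Regular c) : P.T ∈ Icc 0 P.T := ⟨h.T_pos.le, le_rfl⟩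

theorem isBoundedInput_Rinv_W (h : P.Regular c) {d : ℝ → Vec nd} (hd : P.IsBoundedInput d) :
    P.IsBoundedInput fun t => P.Rinv t (((P.W t)†) (d t)) :=
  (hd.clm_apply (continuous_adjoint h.contW)).clm_apply h.continuous_Rinv

theorem integrable_forcingState (h : P.Regular c) {d : ℝ → Vec nd} (hd : P.IsBoundedInput d) :
    Integrable (P.forcingState d) :=
  (((hd.clm_apply h.contC).sub
    ((h.isBoundedInput_Rinv_W hd).clm_apply h.contB)).integrableOn).integrable_indicator
    measurableSet_Icc

theorem integrable_forcingCostate (h : P.Regular c) {d : ℝ → Vec nd} (hd : P.IsBoundedInput d) :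
    Integrable (P.forcingCostate d) :=
  ((((h.isBoundedInput_Rinv_W hd).clm_apply (continuous_adjoint h.contH)).sub
    (hd.clm_apply (continuous_adjoint h.contG))).integrableOn).integrable_indicator
    measurableSet_Icc

theorem exists_isExtremal (h : P.Regular c) {d : ℝ → Vec nd} (hd : P.IsBoundedInput d)
    (d0 : Vec nx) (dT : Vec nd) : ∃ x p, P.IsExtremal d d0 dT x p := by
  obtain ⟨x, p, h1, h2, h3, h4, h5, h6⟩ := h.exists_trajectory (h.integrable_forcingState hd)
    (h.integrable_forcingCostate hd) d0 ((P.GT†) dT)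
  exact ⟨x, p, h1, h2, h3, h4, h5, h6⟩

theorem continuous_ham_state (h : P.Regular c) {x p : ℝ → Vec nx} (hx : Continuous x)
    (hp : Continuous p) : Continuous fun s => P.At s (x s) - P.S s (p s) :=
  (h.continuous_At.clm_apply hx).sub (h.continuous_S.clm_apply hp)

theorem continuous_ham_costate (h : P.Regular c) {x p : ℝ → Vec nx} (hx : Continuous x)
    (hp : Continuous p) : Continuous fun s => -(P.Qt s (x s)) - ((P.At s)†) (p s) :=
  (h.continuous_Qt.clm_apply hx).neg.sub ((continuous_adjoint h.continuous_At).clm_apply hp)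

/-- The stationarity condition; in the first variation it replaces the coefficient of the control
variation by -Bᵀp. -/
theorem R_control (h : P.Regular c) (d : ℝ → Vec nd) (x p : ℝ → Vec nx) (t : ℝ) :
    P.H t (x t) + P.R t (P.control d x p t) + ((P.W t)†) (d t) = -((P.B t)†) (p t) := by
  rw [control, map_neg, h.R_Rinv]; abel

theorem isBoundedInput_control (h : P.Regular c) {d : ℝ → Vec nd} (hd : P.IsBoundedInput d)
    {x p : ℝ → Vec nx} (hx : Continuous x) (hp : Continuous p) :
    P.IsBoundedInput (P.control d x p) :=
  (((IsBoundedInput.of_continuous ((h.contH.clm_apply hx).add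
    ((continuous_adjoint h.contB).clm_apply hp))).add
      (hd.clm_apply (continuous_adjoint h.contW))).clm_apply h.continuous_Rinv).neg

end Regular

theorem continuousOn_control (h : P.Regular c) {d : ℝ → Vec nd}
    (hd : ContinuousOn d (Icc 0 P.T)) {x p : ℝ → Vec nx} (hx : Continuous x) (hp : Continuous p) :
    ContinuousOn (P.control d x p) (Icc 0 P.T) :=
  (h.continuous_Rinv.continuousOn.clm_apply (((h.contH.clm_apply hx).add
    ((continuous_adjoint h.contB).clm_apply hp)).continuousOn.add
      ((continuous_adjoint h.contW).continuousOn.clm_apply hd))).neg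

theorem adjoint_At_apply (h : P.Regular c) (t : ℝ) (p : Vec nx) :
    ((P.At t)†) p = ((P.A t)†) p - ((P.H t)†) (P.Rinv t (((P.B t)†) p)) := by
  refine ext_inner_right ℝ fun b => ?_
  simp only [At, ContinuousLinearMap.adjoint_inner_left, inner_sub_left, inner_sub_right, sub_apply,
    ContinuousLinearMap.comp_apply, h.Rinv_symm]

namespace IsExtremal

variable {d : ℝ → Vec nd} {d0 : Vec nx} {dT : Vec nd} {x p : ℝ → Vec nx}

theorem state_eq (h : P.Regular c) (hd : P.IsBoundedInput d) (hE : P.IsExtremal d d0 dT x p)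
    {t : ℝ} (ht : t ∈ Icc 0 P.T) : x t = d0 +
      ∫ s in (0 : ℝ)..t, (P.A s (x s) + P.B s (P.control d x p s) + P.C s (d s)) := by
  have hf := h.integrable_forcingState hd
  have hc := h.continuous_ham_state hE.continuous_x hE.continuous_p
  have e : ∫ s in (0 : ℝ)..t, (P.A s (x s) + P.B s (P.control d x p s) + P.C s (d s)) =
      ∫ s in (0 : ℝ)..t, (P.forcingState d s + (P.At s (x s) - P.S s (p s))) := by
    refine intervalIntegral.integral_congr fun s hs => ?_
    have hs' := uIcc_subset_Icc h.zero_mem ht hs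
    simp only [forcingState, indicator_of_mem hs', control, At, S, map_add, map_neg, sub_apply,
      ContinuousLinearMap.comp_apply]
    abel
  rw [e, intervalIntegral.integral_add hf.intervalIntegrable (hc.intervalIntegrable _ _),
    ← intervalIntegral.integral_interval_sub_left (a := P.T) hf.intervalIntegrable
      hf.intervalIntegrable,
    ← intervalIntegral.integral_interval_sub_left (a := P.T) (hc.intervalIntegrable _ _)
      (hc.intervalIntegrable _ _), ← hE.initial, hE.state t, hE.state 0]
  abel

theorem adjoint_eq (h : P.Regular c) (hd : P.IsBoundedInput d) (hE : P.IsExtremal d d0 dT x p)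
    {t : ℝ} (ht : t ∈ Icc 0 P.T) : p t = P.QT (x P.T) + (P.GT†) dT +
      ∫ s in t..P.T, (P.Q s (x s) + ((P.H s)†) (P.control d x p s) + ((P.G s)†) (d s) +
        ((P.A s)†) (p s)) := by
  have hf := h.integrable_forcingCostate hd
  have hc := h.continuous_ham_costate hE.continuous_x hE.continuous_p
  have e : ∫ s in t..P.T, (P.Q s (x s) + ((P.H s)†) (P.control d x p s) + ((P.G s)†) (d s) +
        ((P.A s)†) (p s)) =
      -∫ s in t..P.T, (P.forcingCostate d s + (-(P.Qt s (x s)) - ((P.At s)†) (p s))) := by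
    rw [← intervalIntegral.integral_neg]
    refine intervalIntegral.integral_congr fun s hs => ?_
    have hs' := uIcc_subset_Icc ht h.T_mem hs
    simp only [forcingCostate, indicator_of_mem hs', control, adjoint_At_apply h, Qt, map_add,
      map_neg, sub_apply, ContinuousLinearMap.comp_apply]
    abel
  rw [e, ← hE.terminal, ← intervalIntegral.integral_symm,
    intervalIntegral.integral_add hf.intervalIntegrable (hc.intervalIntegrable _ _), ← add_assoc]
  exact hE.costate t

theorem isAdmissible (h : P.Regular c) (hd : P.IsBoundedInput d)
    (hE : P.IsExtremal d d0 dT x p) : P.IsAdmissible d d0 x (P.control d x p) where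
  control := h.isBoundedInput_control hd hE.continuous_x hE.continuous_p
  continuousOn := hE.continuous_x.continuousOn
  dynamics _ ht := hE.state_eq h hd ht

end IsExtremal

end LQProblem

/-- A homogeneous linear Volterra equation, integrated backwards from `T`, has only the zero
solution. -/
theorem eq_zero_of_eq_integral {n : ℕ} {M : ℝ → Mat n n} (hM : Continuous M) {K T : ℝ}
    (hK : ∀ t, ‖M t‖ ≤ K) {w : ℝ → Vec n} (hw : ContinuousOn w (Icc 0 T))
    (h : ∀ t ∈ Icc 0 T, w t = ∫ s in t..T, M s (w s)) {t : ℝ} (ht : t ∈ Icc 0 T) : w t = 0 := by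
  have hT : (0 : ℝ) ≤ T := ht.1.trans ht.2
  set w' : ℝ → Vec n := IccExtend hT ((Icc 0 T).domRestrict w) with hw'
  have hcont : Continuous w' := (continuousOn_iff_continuous_domRestrict.1 hw).Icc_extend'
  have heq : ∀ r ∈ Icc 0 T, w' r = w r := fun r hr => by
    rw [hw', IccExtend_of_mem hT _ hr, domRestrict_apply]
  have hc : Continuous fun s => M s (w' s) := hM.clm_apply hcont
  -- Time is reversed so that the forward Gronwall bound applies, starting from z(0) = 0.
  set z : ℝ → Vec n := fun r => ∫ s in (T - r)..T, M s (w' s) with hz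
  have hzw : ∀ r ∈ Icc 0 T, z r = w (T - r) := fun r hr => by
    have hr' : T - r ∈ Icc 0 T := ⟨by linarith [hr.2], by linarith [hr.1]⟩
    rw [h _ hr']
    refine intervalIntegral.integral_congr fun s hs => ?_
    rw [heq s (uIcc_subset_Icc hr' ⟨hT, le_rfl⟩ hs)]
  have hd : ∀ r, HasDerivAt z (M (T - r) (w' (T - r))) r := fun r => by
    have h1 := intervalIntegral.integral_hasDerivAt_left (hc.intervalIntegrable (T - r) T)
      hc.aestronglyMeasurable.stronglyMeasurableAtFilter hc.continuousAt
    have h2 := h1.scomp r ((hasDerivAt_id r).const_sub T)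
    simpa [Function.comp_def] using h2
  have := norm_le_exp_mul_of_hasDerivAt (x := z) (K := K) (t₀ := 0) (t₁ := T) (fun r _ => hd r)
    (fun r hr => by
      rw [hzw r hr, heq _ ⟨by linarith [hr.2], by linarith [hr.1]⟩]
      exact (M _).le_of_opNorm_le (hK _) _) (t := T - t) ⟨by linarith [ht.2], by linarith [ht.1]⟩
  have hz0 : z 0 = 0 := by simp [hz]
  rw [hz0, norm_zero, mul_zero, hzw _ ⟨by linarith [ht.2], by linarith [ht.1]⟩,
    sub_sub_cancel] at this
  exact norm_le_zero_iff.1 this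

/-! ### Exact expansion of the cost; optimality and uniqueness of extremals. -/

namespace LQProblem

variable {nx nu nd : ℕ} {P : LQProblem nx nu nd} {c : LQConstants}

/-- Twice the running cost. -/
def running (P : LQProblem nx nu nd) (t : ℝ) (x : Vec nx) (u : Vec nu) (d : Vec nd) : ℝ :=
  ⟪x, P.Q t x + ((P.H t)†) u + ((P.G t)†) d⟫_ℝ + ⟪u, P.H t x + P.R t u + ((P.W t)†) d⟫_ℝ
    + ⟪d, P.G t x + P.W t u⟫_ℝ

/-- The second variation of the running cost. -/
def secondVariation (P : LQProblem nx nu nd) (t : ℝ) (x : Vec nx) (u : Vec nu) : ℝ :=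
  ⟪P.Qt t x, x⟫_ℝ + ⟪P.R t (u + P.Rinv t (P.H t x)), u + P.Rinv t (P.H t x)⟫_ℝ

/-- Symmetry of Qt is part of the Loewner bound, and HᵀR⁻¹H is symmetric, so Q inherits it. -/
theorem Regular.Q_symm (h : P.Regular c) (t : ℝ) (x y : Vec nx) :
    ⟪P.Q t x, y⟫_ℝ = ⟪x, P.Q t y⟫_ℝ := by
  have h1 := h.Qt_symm t x y
  simp only [Qt, sub_apply, ContinuousLinearMap.comp_apply, inner_sub_left, inner_sub_right,
    ContinuousLinearMap.adjoint_inner_left, ContinuousLinearMap.adjoint_inner_right,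
    h.Rinv_symm] at h1
  linarith

/-- The running cost has degree two in (x, u), so the second-order expansion is exact; completing
the square in the control variation brings out Qt and R. -/
theorem running_add (h : P.Regular c) (t : ℝ) (x δ : Vec nx) (u ω : Vec nu) (d : Vec nd) :
    P.running t (x + δ) (u + ω) d = P.running t x u d +
      2 * (⟪P.Q t x + ((P.H t)†) u + ((P.G t)†) d, δ⟫_ℝ +
        ⟪P.H t x + P.R t u + ((P.W t)†) d, ω⟫_ℝ) + P.secondVariation t δ ω := by
  have q1 : ⟪x, P.Q t δ⟫_ℝ = ⟪P.Q t x, δ⟫_ℝ := (h.Q_symm t x δ).symm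
  have q2 : ⟪δ, P.Q t x⟫_ℝ = ⟪P.Q t x, δ⟫_ℝ := real_inner_comm _ _
  have q3 : ⟪δ, P.Q t δ⟫_ℝ = ⟪P.Q t δ, δ⟫_ℝ := real_inner_comm _ _
  have r1 : ⟪u, P.R t ω⟫_ℝ = ⟪P.R t u, ω⟫_ℝ := (h.R_symm t u ω).symm
  have r2 : ⟪ω, P.R t u⟫_ℝ = ⟪P.R t u, ω⟫_ℝ := real_inner_comm _ _
  have r3 : ⟪ω, P.R t ω⟫_ℝ = ⟪P.R t ω, ω⟫_ℝ := real_inner_comm _ _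
  have s1 : ⟪P.R t ω, P.Rinv t (P.H t δ)⟫_ℝ = ⟪P.H t δ, ω⟫_ℝ := by
    rw [h.R_symm, h.R_Rinv, real_inner_comm]
  have s2 : ⟪P.H t δ, P.Rinv t (P.H t δ)⟫_ℝ = ⟪δ, ((P.H t)†) (P.Rinv t (P.H t δ))⟫_ℝ := by
    rw [ContinuousLinearMap.adjoint_inner_right]
  have s3 : ⟪P.Rinv t (P.H t δ), P.H t δ⟫_ℝ = ⟪P.H t δ, P.Rinv t (P.H t δ)⟫_ℝ :=
    real_inner_comm _ _
  have a1 : ⟪ω, P.H t x⟫_ℝ = ⟪P.H t x, ω⟫_ℝ := real_inner_comm _ _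
  have a2 : ⟪ω, P.H t δ⟫_ℝ = ⟪P.H t δ, ω⟫_ℝ := real_inner_comm _ _
  have a3 : ⟪P.H t δ, u⟫_ℝ = ⟪u, P.H t δ⟫_ℝ := real_inner_comm _ _
  have b1 : ⟪P.G t δ, d⟫_ℝ = ⟪d, P.G t δ⟫_ℝ := real_inner_comm _ _
  have b2 : ⟪P.W t ω, d⟫_ℝ = ⟪d, P.W t ω⟫_ℝ := real_inner_comm _ _
  simp only [running, secondVariation, Qt, map_add, h.R_Rinv, sub_apply,
    ContinuousLinearMap.comp_apply, inner_add_left, inner_add_right, inner_sub_left,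
    ContinuousLinearMap.adjoint_inner_left, ContinuousLinearMap.adjoint_inner_right,
    q1, q2, q3, r1, r2, r3, s1, s3, a1, a2, a3, b1, b2]
  ring

theorem le_secondVariation (h : P.Regular c) (t : ℝ) (x : Vec nx) (u : Vec nu) :
    c.γQ * ‖x‖ ^ 2 + c.γR * ‖u + P.Rinv t (P.H t x)‖ ^ 2 ≤ P.secondVariation t x u :=
  add_le_add (h.le_inner_Qt t x) (h.le_inner_R t _)

theorem secondVariation_nonneg (h : P.Regular c) (t : ℝ) (x : Vec nx) (u : Vec nu) :
    0 ≤ P.secondVariation t x u := by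
  have := c.γQ_pos; have := c.γR_pos
  exact le_trans (by positivity) (le_secondVariation h t x u)

theorem intervalIntegrable_running (h : P.Regular c) {x : ℝ → Vec nx} {u : ℝ → Vec nu}
    {d : ℝ → Vec nd} (hx : P.IsBoundedInput x) (hu : P.IsBoundedInput u)
    (hd : P.IsBoundedInput d) :
    IntervalIntegrable (fun t => P.running t (x t) (u t) (d t)) volume 0 P.T :=
  ((hx.intervalIntegrable_inner h.T_pos.le (((hx.clm_apply h.contQ).add
    (hu.clm_apply (continuous_adjoint h.contH))).add
      (hd.clm_apply (continuous_adjoint h.contG)))).add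
    (hu.intervalIntegrable_inner h.T_pos.le (((hx.clm_apply h.contH).add
      (hu.clm_apply h.contR)).add (hd.clm_apply (continuous_adjoint h.contW))))).add
    (hd.intervalIntegrable_inner h.T_pos.le ((hx.clm_apply h.contG).add (hu.clm_apply h.contW)))

theorem intervalIntegrable_secondVariation (h : P.Regular c) {x : ℝ → Vec nx} {u : ℝ → Vec nu}
    (hx : P.IsBoundedInput x) (hu : P.IsBoundedInput u) :
    IntervalIntegrable (fun t => P.secondVariation t (x t) (u t)) volume 0 P.T :=
  have hk := hu.add ((hx.clm_apply h.contH).clm_apply h.continuous_Rinv)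
  ((hx.clm_apply h.continuous_Qt).intervalIntegrable_inner h.T_pos.le hx).add
    ((hk.clm_apply h.contR).intervalIntegrable_inner h.T_pos.le hk)

namespace IsExtremal

variable {d : ℝ → Vec nd} {d0 : Vec nx} {dT : Vec nd} {x p : ℝ → Vec nx}

/-- The derivative of the pairing of the adjoint with an admissible variation. -/
theorem integral_first_variation (h : P.Regular c) (hd : P.IsBoundedInput d)
    (hE : P.IsExtremal d d0 dT x p) {δ : ℝ → Vec nx} {ω : ℝ → Vec nu}
    (hω : P.IsBoundedInput ω) (hδc : P.IsBoundedInput δ)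
    (hδ : ∀ t ∈ Icc 0 P.T, δ t = ∫ s in (0 : ℝ)..t, (P.A s (δ s) + P.B s (ω s))) :
    ∫ t in (0 : ℝ)..P.T, (⟪P.Q t (x t) + ((P.H t)†) (P.control d x p t) + ((P.G t)†) (d t), δ t⟫_ℝ +
        ⟪P.H t (x t) + P.R t (P.control d x p t) + ((P.W t)†) (d t), ω t⟫_ℝ) =
      -⟪P.QT (x P.T) + (P.GT†) dT, δ P.T⟫_ℝ := by
  set u := P.control d x p with hu
  have hub : P.IsBoundedInput u := h.isBoundedInput_control hd hE.continuous_x hE.continuous_p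
  set f : ℝ → Vec nx := fun t => P.A t (δ t) + P.B t (ω t) with hf
  have hfb : P.IsBoundedInput f := (hδc.clm_apply h.contA).add (hω.clm_apply h.contB)
  set g : ℝ → Vec nx := fun t =>
    -(P.Q t (x t) + ((P.H t)†) (u t) + ((P.G t)†) (d t) + ((P.A t)†) (p t)) with hg
  have hgb : P.IsBoundedInput g := ((((IsBoundedInput.of_continuous
    (h.contQ.clm_apply hE.continuous_x)).add (hub.clm_apply (continuous_adjoint h.contH))).add
    (hd.clm_apply (continuous_adjoint h.contG))).add (IsBoundedInput.of_continuous
      ((continuous_adjoint h.contA).clm_apply hE.continuous_p))).neg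
  obtain ⟨M, hM⟩ := hfb.2
  obtain ⟨N, hN⟩ := hgb.2
  have hδ0 : δ 0 = 0 := by rw [hδ 0 h.zero_mem]; simp
  have hp : ∀ t ∈ Icc 0 P.T, p t = p 0 + ∫ s in (0 : ℝ)..t, g s := fun t ht => by
    have e : ∀ t ∈ Icc 0 P.T, p t = P.QT (x P.T) + (P.GT†) dT - ∫ s in t..P.T, g s :=
      fun t ht => by
        rw [hE.adjoint_eq h hd ht, hg, intervalIntegral.integral_neg, sub_neg_eq_add]
    rw [e t ht, e 0 h.zero_mem,
      ← intervalIntegral.integral_add_adjacent_intervals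
        (hgb.intervalIntegrable h.zero_mem ht) (hgb.intervalIntegrable ht h.T_mem)]
    abel
  have key := integral_inner_add_inner_primitive (x := p) (y := δ) (K := max M N) h.T_pos.le
    (hgb.intervalIntegrable h.zero_mem h.T_mem) (hfb.intervalIntegrable h.zero_mem h.T_mem)
    (fun t ht => (hN t ht).trans (le_max_right _ _))
    (fun t ht => (hM t ht).trans (le_max_left _ _)) hp
    (fun t ht => by rw [hδ0, zero_add]; exact hδ t ht)
  rw [hδ0, inner_zero_right, sub_zero, hE.terminal] at key
  rw [← key, ← intervalIntegral.integral_neg]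
  refine intervalIntegral.integral_congr fun t _ => ?_
  -- After stationarity both sides contain only p, and the terms with A and B are those of the
  -- variation's dynamics paired with p.
  simp only [hu, h.R_control]
  simp only [hf, hg, inner_neg_left, inner_add_left, inner_add_right,
    ContinuousLinearMap.adjoint_inner_left]
  ring

/-- The linear part of the running cost integrates to minus the linear part of the terminal cost, by
the adjoint equation and its terminal condition. Only the two nonnegative quadratic remainders
survive. -/
theorem cost_eq_add (h : P.Regular c) (hd : P.IsBoundedInput d) (hE : P.IsExtremal d d0 dT x p)
    {y : ℝ → Vec nx} {w : ℝ → Vec nu} (hyw : P.IsAdmissible d d0 y w) :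
    P.cost d dT y w = P.cost d dT x (P.control d x p) +
      1 / 2 * (∫ t in (0 : ℝ)..P.T, P.secondVariation t (y t - x t) (w t - P.control d x p t)) +
      1 / 2 * ⟪P.QT (y P.T - x P.T), y P.T - x P.T⟫_ℝ := by
  have hxb : P.IsBoundedInput x := .of_continuous hE.continuous_x
  have hyb : P.IsBoundedInput y := .of_continuousOn hyw.continuousOn
  have hub := h.isBoundedInput_control hd hE.continuous_x hE.continuous_p
  have hδb := hyb.sub hxb
  have hωb := hyw.control.sub hub
  have hfirst := hE.integral_first_variation h hd hωb hδb fun t ht => by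
    have i1 : IntervalIntegrable (fun s => P.A s (x s) + P.B s (P.control d x p s) + P.C s (d s))
        volume 0 t := (((hxb.clm_apply h.contA).add (hub.clm_apply h.contB)).add
          (hd.clm_apply h.contC)).intervalIntegrable h.zero_mem ht
    have i2 : IntervalIntegrable (fun s => P.A s (y s) + P.B s (w s) + P.C s (d s))
        volume 0 t := (((hyb.clm_apply h.contA).add (hyw.control.clm_apply h.contB)).add
          (hd.clm_apply h.contC)).intervalIntegrable h.zero_mem ht
    rw [hyw.dynamics t ht, hE.state_eq h hd ht, add_sub_add_left_eq_sub,
      ← intervalIntegral.integral_sub i2 i1]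
    refine intervalIntegral.integral_congr fun s _ => ?_
    simp only [map_sub]
    abel
  have hrun : ∀ t, P.running t (y t) (w t) (d t) = P.running t (x t) (P.control d x p t) (d t) +
      2 * (⟪P.Q t (x t) + ((P.H t)†) (P.control d x p t) + ((P.G t)†) (d t), y t - x t⟫_ℝ +
        ⟪P.H t (x t) + P.R t (P.control d x p t) + ((P.W t)†) (d t),
          w t - P.control d x p t⟫_ℝ) +
      P.secondVariation t (y t - x t) (w t - P.control d x p t) := fun t => by
    rw [← running_add h, add_sub_cancel, add_sub_cancel]
  have j1 := intervalIntegrable_running h hxb hub hd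
  have j3 := intervalIntegrable_secondVariation h hδb hωb
  have j2 := ((((((hxb.clm_apply h.contQ).add (hub.clm_apply (continuous_adjoint h.contH))).add
    (hd.clm_apply (continuous_adjoint h.contG))).intervalIntegrable_inner h.T_pos.le hδb).add
    ((((hxb.clm_apply h.contH).add (hub.clm_apply h.contR)).add
      (hd.clm_apply (continuous_adjoint h.contW))).intervalIntegrable_inner h.T_pos.le
        hωb)).const_mul 2)
  have hint : ∫ t in (0 : ℝ)..P.T, P.running t (y t) (w t) (d t) =
      (∫ t in (0 : ℝ)..P.T, P.running t (x t) (P.control d x p t) (d t)) +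
        2 * (-⟪P.QT (x P.T) + (P.GT†) dT, y P.T - x P.T⟫_ℝ) +
        ∫ t in (0 : ℝ)..P.T, P.secondVariation t (y t - x t) (w t - P.control d x p t) := by
    rw [← hfirst, ← intervalIntegral.integral_const_mul]
    simp_rw [hrun]
    rw [intervalIntegral.integral_add (j1.add j2) j3, intervalIntegral.integral_add j1 j2]
  have hcost : ∀ x u, P.cost d dT x u = 1 / 2 * (∫ t in (0 : ℝ)..P.T,
      P.running t (x t) (u t) (d t)) +
        1 / 2 * (⟪x P.T, P.QT (x P.T) + (P.GT†) dT⟫_ℝ + ⟪dT, P.GT (x P.T)⟫_ℝ) := fun _ _ => rfl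
  rw [hcost, hcost, hint]
  obtain ⟨δ, hδ⟩ : ∃ δ, y P.T = x P.T + δ := ⟨y P.T - x P.T, by abel⟩
  have q1 : ⟪x P.T, P.QT δ⟫_ℝ = ⟪P.QT (x P.T), δ⟫_ℝ := (h.QT_symm _ _).symm
  have q2 : ⟪δ, P.QT (x P.T)⟫_ℝ = ⟪P.QT (x P.T), δ⟫_ℝ := real_inner_comm _ _
  have q3 : ⟪δ, P.QT δ⟫_ℝ = ⟪P.QT δ, δ⟫_ℝ := real_inner_comm _ _
  have q4 : ⟪P.GT δ, dT⟫_ℝ = ⟪dT, P.GT δ⟫_ℝ := real_inner_comm _ _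
  rw [hδ, add_sub_cancel_left]
  simp only [map_add, inner_add_left, inner_add_right, ContinuousLinearMap.adjoint_inner_left,
    ContinuousLinearMap.adjoint_inner_right, q1, q2, q3, q4]
  ring

theorem isOptimal (h : P.Regular c) (hd : P.IsBoundedInput d) (hE : P.IsExtremal d d0 dT x p) :
    P.IsOptimal d d0 dT x (P.control d x p) p where
  admissible := hE.isAdmissible h hd
  optimal y w hyw := by
    rw [hE.cost_eq_add h hd hyw]
    have h1 : 0 ≤ ∫ t in (0 : ℝ)..P.T,
        P.secondVariation t (y t - x t) (w t - P.control d x p t) :=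
      intervalIntegral.integral_nonneg h.T_pos.le fun t _ => secondVariation_nonneg h t _ _
    have h2 := le_inner_of_smul_one_le h.coerciveQT (y P.T - x P.T)
    have h3 : 0 ≤ c.γQ * ‖y P.T - x P.T‖ ^ 2 := by have := c.γQ_pos; positivity
    linarith
  adjoint_continuousOn := hE.continuous_p.continuousOn
  adjoint_equation _ ht := hE.adjoint_eq h hd ht

/-- Every optimal triple coincides with the extremal one. -/
theorem eq_of_isOptimal (h : P.Regular c) (hd : P.IsBoundedInput d)
    (hE : P.IsExtremal d d0 dT x p) {y q : ℝ → Vec nx} {w : ℝ → Vec nu}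
    (hO : P.IsOptimal d d0 dT y w q) :
    (∀ t ∈ Icc 0 P.T, y t = x t) ∧ (∀ t ∈ Icc 0 P.T, q t = p t) ∧
      ∀ᵐ t ∂volume.restrict (Icc 0 P.T), w t = P.control d x p t := by
  have hγQ := c.γQ_pos; have hγR := c.γR_pos
  have hxb : P.IsBoundedInput x := .of_continuous hE.continuous_x
  have hyb : P.IsBoundedInput y := .of_continuousOn hO.admissible.continuousOn
  have hub := h.isBoundedInput_control hd hE.continuous_x hE.continuous_p
  have hint := intervalIntegrable_secondVariation h (hyb.sub hxb) (hO.admissible.control.sub hub)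
  have hzero : ∫ t in (0 : ℝ)..P.T,
      P.secondVariation t (y t - x t) (w t - P.control d x p t) = 0 := by
    refine le_antisymm ?_ (intervalIntegral.integral_nonneg h.T_pos.le
      fun t _ => secondVariation_nonneg h t _ _)
    -- The extremal itself is a competitor, so both nonnegative remainders in the expansion about it
    -- must vanish.
    have h1 := hO.optimal x _ (hE.isAdmissible h hd)
    rw [hE.cost_eq_add h hd hO.admissible] at h1
    have h2 := le_inner_of_smul_one_le h.coerciveQT (y P.T - x P.T)
    have h3 : 0 ≤ c.γQ * ‖y P.T - x P.T‖ ^ 2 := by positivity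
    linarith
  rw [intervalIntegral.integral_of_le h.T_pos.le,
    integral_eq_zero_iff_of_nonneg (fun t => secondVariation_nonneg h t _ _)
      ((intervalIntegrable_iff_integrableOn_Ioc_of_le h.T_pos.le).1 hint)] at hzero
  have hae : ∀ᵐ t ∂volume.restrict (Ioc 0 P.T), y t = x t ∧ w t = P.control d x p t := by
    filter_upwards [hzero] with t ht
    have h1 := le_secondVariation h t (y t - x t) (w t - P.control d x p t)
    rw [ht, Pi.zero_apply] at h1
    have h2 : 0 ≤ c.γR * ‖w t - P.control d x p t + P.Rinv t (P.H t (y t - x t))‖ ^ 2 := by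
      positivity
    have h3 : 0 ≤ c.γQ * ‖y t - x t‖ ^ 2 := by positivity
    have h4 : c.γQ * ‖y t - x t‖ ^ 2 = 0 := by linarith
    have h5 : y t - x t = 0 := by simpa [hγQ.ne'] using h4
    have h6 : c.γR * ‖w t - P.control d x p t + P.Rinv t (P.H t (y t - x t))‖ ^ 2 = 0 := by
      linarith
    rw [h5] at h6
    have h7 : w t - P.control d x p t = 0 := by simpa [hγR.ne'] using h6
    exact ⟨sub_eq_zero.1 h5, sub_eq_zero.1 h7⟩
  have hae' : ∀ᵐ t, t ∈ Ioc 0 P.T → y t = x t ∧ w t = P.control d x p t :=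
    (ae_restrict_iff' measurableSet_Ioc).1 hae
  -- Equality almost everywhere becomes equality everywhere because both states satisfy the integral
  -- equation with integrands that agree almost everywhere.
  have hyx : ∀ t ∈ Icc 0 P.T, y t = x t := fun t ht => by
    rw [hO.admissible.dynamics t ht, hE.state_eq h hd ht]
    congr 1
    refine intervalIntegral.integral_congr_ae ?_
    filter_upwards [hae'] with s hs hst
    rw [uIoc_of_le ht.1] at hst
    obtain ⟨e1, e2⟩ := hs ⟨hst.1, hst.2.trans ht.2⟩
    rw [e1, e2]
  refine ⟨hyx, fun t ht => ?_, ?_⟩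
  · have hqb : P.IsBoundedInput q := .of_continuousOn hO.adjoint_continuousOn
    have hpb : P.IsBoundedInput p := .of_continuous hE.continuous_p
    have hHc := continuous_adjoint h.contH
    have hGc := continuous_adjoint h.contG
    have hAc := continuous_adjoint h.contA
    refine sub_eq_zero.1 (eq_zero_of_eq_integral (w := fun t => q t - p t) hAc
      (fun t => norm_adjoint_le (h.boundA t))
      (hO.adjoint_continuousOn.sub hE.continuous_p.continuousOn) (fun t ht => ?_) ht)
    have i1 := ((((hxb.clm_apply h.contQ).add (hub.clm_apply hHc)).add (hd.clm_apply hGc)).add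
      (hpb.clm_apply hAc)).intervalIntegrable ht h.T_mem
    have i2 := ((((hyb.clm_apply h.contQ).add (hO.admissible.control.clm_apply hHc)).add
      (hd.clm_apply hGc)).add (hqb.clm_apply hAc)).intervalIntegrable ht h.T_mem
    rw [hO.adjoint_equation t ht, hE.adjoint_eq h hd ht, hyx P.T h.T_mem, add_sub_add_left_eq_sub,
      ← intervalIntegral.integral_sub i2 i1]
    refine intervalIntegral.integral_congr_ae ?_
    filter_upwards [hae'] with s hs hst
    rw [uIoc_of_le ht.2] at hst
    obtain ⟨e1, e2⟩ := hs ⟨ht.1.trans_lt hst.1, hst.2⟩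
    rw [e1, e2, map_sub]
    abel
  · rw [← Measure.restrict_congr_set Ioc_ae_eq_Icc]
    exact hae.mono fun t ht => ht.2

end IsExtremal

/-! ### Symplectic duality and the sensitivity estimate. -/

/-- The symplectic pairing of two solutions of the Hamiltonian system is constant. -/
theorem symplectic_const (h : P.Regular c) {x y ξ q : ℝ → Vec nx}
    (hx : ∀ t, HasDerivAt x (P.At t (x t) - P.S t (y t)) t)
    (hy : ∀ t, HasDerivAt y (-(P.Qt t (x t)) - ((P.At t)†) (y t)) t)
    (hξ : ∀ t, HasDerivAt ξ (P.At t (ξ t) - P.S t (q t)) t)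
    (hq : ∀ t, HasDerivAt q (-(P.Qt t (ξ t)) - ((P.At t)†) (q t)) t) (s t : ℝ) :
    ⟪q s, x s⟫_ℝ - ⟪y s, ξ s⟫_ℝ = ⟪q t, x t⟫_ℝ - ⟪y t, ξ t⟫_ℝ := by
  have hd : ∀ t, HasDerivAt (fun t => ⟪q t, x t⟫_ℝ - ⟪y t, ξ t⟫_ℝ) 0 t := fun t => by
    refine ((hasDerivAt_inner_adjoint (hq t) ((hx t).congr_deriv (sub_eq_add_neg _ _))).sub
      (hasDerivAt_inner_adjoint (hy t) ((hξ t).congr_deriv (sub_eq_add_neg _ _)))).congr_deriv ?_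
    have e1 : ⟪y t, P.S t (q t)⟫_ℝ = ⟪q t, P.S t (y t)⟫_ℝ := by
      rw [← h.S_symm, real_inner_comm]
    have e2 : ⟪P.Qt t (ξ t), x t⟫_ℝ = ⟪P.Qt t (x t), ξ t⟫_ℝ := by
      rw [h.Qt_symm, real_inner_comm]
    simp only [inner_neg_left, inner_neg_right, e1, e2]
    ring
  exact is_const_of_deriv_eq_zero (fun r => (hd r).differentiableAt) (fun r => (hd r).deriv) s t

namespace IsFundamental

variable {X Y : ℝ → Mat nx nx}

theorem X_inverse_apply (h : P.Regular c) (hXY : P.IsFundamental X Y) {t : ℝ} (ht : t ≤ P.T)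
    (z : Vec nx) : X t (Ring.inverse (X t) z) = z :=
  DFunLike.congr_fun (Ring.mul_inverse_cancel _ (hXY.isUnit_X h ht)) z

theorem inverse_X_apply (h : P.Regular c) (hXY : P.IsFundamental X Y) {t : ℝ} (ht : t ≤ P.T)
    (z : Vec nx) : Ring.inverse (X t) (X t z) = z :=
  DFunLike.congr_fun (Ring.inverse_mul_cancel _ (hXY.isUnit_X h ht)) z

/-- This is the symmetry of the Riccati matrix YX⁻¹: the symplectic pairing of two columns is
conserved, and it vanishes at T since Q_T is symmetric. -/
theorem inner_Y_X (h : P.Regular c) (hXY : P.IsFundamental X Y) (t : ℝ) (a b : Vec nx) :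
    ⟪Y t a, X t b⟫_ℝ = ⟪Y t b, X t a⟫_ℝ := by
  have ha := hXY.isHamiltonian a
  have hb := hXY.isHamiltonian b
  have := symplectic_const h hb.state hb.costate ha.state ha.costate t P.T
  simp only [hXY.X_terminal, hXY.Y_terminal, one_apply_eq_self] at this
  rw [h.QT_symm a b, real_inner_comm a (P.QT b), sub_self] at this
  linarith

/-- YX⁻¹ is symmetric with form between 0 and c₁, so its operator norm is at most c₁. -/
theorem norm_Y_apply_le (h : P.Regular c) (hXY : P.IsFundamental X Y) {t : ℝ}
    (ht : t ∈ Icc 0 P.T) (b : Vec nx) : ‖Y t b‖ ≤ c.c₁ * ‖X t b‖ := by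
  have hinv := hXY.X_inverse_apply h ht.2
  have := norm_apply_le_of_inner_le (S := fun z => Y t (Ring.inverse (X t) z))
    (fun x y r => by simp) c.c₁_pos (fun x y => ?_) (fun x => ?_) (fun x => ?_) (X t b)
  · simpa only [hXY.inverse_X_apply h ht.2] using this
  · have := hXY.inner_Y_X h t (Ring.inverse (X t) x) (Ring.inverse (X t) y)
    rw [hinv, hinv] at this
    rw [this, real_inner_comm]
  · have := (hXY.isHamiltonian (Ring.inverse (X t) x)).value_nonneg h ht.2
    simpa only [hinv] using this
  · have := (hXY.isHamiltonian (Ring.inverse (X t) x)).value_le h ht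
    simpa only [hinv] using this

theorem inverse_hasDerivAt (h : P.Regular c) (hXY : P.IsFundamental X Y) {t : ℝ}
    (ht : t ≤ P.T) : HasDerivAt (fun t => Ring.inverse (X t))
      (-(Ring.inverse (X t) * (P.At t ∘L X t - P.S t ∘L Y t) * Ring.inverse (X t))) t := by
  obtain ⟨u, hu⟩ := hXY.isUnit_X h ht
  have h1 := hasFDerivAt_ringInverse (𝕜 := ℝ) u
  rw [hu] at h1
  refine (h1.comp_hasDerivAt t (hXY.state t)).congr_deriv ?_
  rw [← hu, Ring.inverse_unit]
  rfl

end IsFundamental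

section Sensitivity

variable {X Y : ℝ → Mat nx nx} {ξ q : ℝ → Vec nx} {l0 g : Vec nx}

/-- The part of the costate not explained by the Riccati feedback decays backwards from the
horizon. -/
theorem norm_costate_sub_feedback_le (h : P.Regular c) (hXY : P.IsFundamental X Y)
    (hξ : ∀ t, HasDerivAt ξ (P.At t (ξ t) - P.S t (q t)) t)
    (hq : ∀ t, HasDerivAt q (-(P.Qt t (ξ t)) - ((P.At t)†) (q t)) t)
    (hT : q P.T = P.QT (ξ P.T) + g) {t : ℝ} (ht : t ∈ Icc 0 P.T) :
    ‖q t - Y t (Ring.inverse (X t) (ξ t))‖ ≤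
      c.cZ * Real.exp (-c.ρZ * (P.T - t)) * ‖g‖ := by
  set r : Vec nx := q t - Y t (Ring.inverse (X t) (ξ t)) with hr
  -- With X(t)b = r, the symplectic pairing of (ξ, q) with (Xb, Yb) gives ‖r‖² = ⟨g, b⟩. Here b =
  -- X(T)b is where the closed loop started from r at time t arrives at T, so it has decayed.
  obtain ⟨b, hb⟩ := hXY.exists_X_apply_eq h ht.2 r
  have hham := hXY.isHamiltonian b
  have h1 := symplectic_const h hham.state hham.costate hξ hq t P.T
  simp only [hXY.X_terminal, hXY.Y_terminal, one_apply_eq_self, hT, inner_add_left] at h1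
  rw [h.QT_symm (ξ P.T) b, real_inner_comm (P.QT b)] at h1
  have h2 := hXY.inner_Y_X h t (Ring.inverse (X t) (ξ t)) b
  rw [hXY.X_inverse_apply h ht.2] at h2
  have h3 : ⟪r, X t b⟫_ℝ = ⟪g, b⟫_ℝ := by
    rw [hr, inner_sub_left, h2]; linarith
  have h4 := hham.norm_le_decay h ht.1 ht.2 le_rfl
  simp only [hXY.X_terminal, one_apply_eq_self] at h4
  rw [hb] at h3 h4
  rw [real_inner_self_eq_norm_sq] at h3
  have h5 : ‖r‖ ^ 2 ≤ ‖g‖ * (c.cZ * Real.exp (-c.ρZ * (P.T - t)) * ‖r‖) :=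
    h3.trans_le ((real_inner_le_norm _ _).trans (mul_le_mul_of_nonneg_left h4 (norm_nonneg _)))
  rcases (norm_nonneg r).eq_or_lt with h6 | h6
  · rw [← h6]
    have := c.cZ_pos
    positivity
  · have h7 : ‖r‖ * ‖r‖ ≤ (c.cZ * Real.exp (-c.ρZ * (P.T - t)) * ‖g‖) * ‖r‖ := by
      rw [← pow_two]; linarith
    exact le_of_mul_le_mul_right h7 h6

theorem integral_exp_backward_le {ρ : ℝ} (hρ : 0 < ρ) (t : ℝ) :
    ∫ s in (0 : ℝ)..t, Real.exp (-(2 * ρ) * (t - s)) ≤ 1 / (2 * ρ) := by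
  have e : ∀ s, Real.exp (-(2 * ρ) * (t - s)) =
      Real.exp (-(2 * ρ * t)) * Real.exp (2 * ρ * (s - 0)) := fun s => by
    rw [← Real.exp_add]; ring_nf
  simp_rw [e]
  rw [intervalIntegral.integral_const_mul, integral_exp_mul_sub (by positivity), sub_zero,
    ← mul_div_assoc, mul_sub, ← Real.exp_add, neg_add_cancel, Real.exp_zero, mul_one]
  gcongr
  linarith [Real.exp_pos (-(2 * ρ * t))]

/-- Variation of constants for the closed loop with forcing -Sr: both r and the transition operator
decay, and the convolution of the two decays costs only 1/(2ρ_Z). -/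
theorem norm_state_le (h : P.Regular c) (hXY : P.IsFundamental X Y)
    (hξ : ∀ t, HasDerivAt ξ (P.At t (ξ t) - P.S t (q t)) t)
    (hq : ∀ t, HasDerivAt q (-(P.Qt t (ξ t)) - ((P.At t)†) (q t)) t)
    (hT : q P.T = P.QT (ξ P.T) + g) {t : ℝ} (ht : t ∈ Icc 0 P.T) :
    ‖ξ t‖ ≤ c.cZ * Real.exp (-c.ρZ * t) * ‖ξ 0‖ +
      c.cZ ^ 2 * (c.lamB ^ 2 / c.γR) / (2 * c.ρZ) * Real.exp (-c.ρZ * (P.T - t)) * ‖g‖ := by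
  have hρ := c.ρZ_pos; have hZ := c.cZ_pos; have hγR := c.γR_pos
  set r : ℝ → Vec nx := fun s => q s - Y s (Ring.inverse (X s) (ξ s)) with hr
  have hinvc : ContinuousOn (fun s => Ring.inverse (X s)) (Icc 0 P.T) := fun s hs =>
    (hXY.inverse_hasDerivAt h hs.2).continuousAt.continuousWithinAt
  have hYc : Continuous Y := continuous_iff_continuousAt.2 fun t => (hXY.costate t).continuousAt
  have hξc : Continuous ξ := continuous_iff_continuousAt.2 fun t => (hξ t).continuousAt
  have hqc : Continuous q := continuous_iff_continuousAt.2 fun t => (hq t).continuousAt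
  have hrc : ContinuousOn r (Icc 0 P.T) :=
    hqc.continuousOn.sub (hYc.continuousOn.clm_apply (hinvc.clm_apply hξc.continuousOn))
  have hFc : ContinuousOn (fun s => -(Ring.inverse (X s) (P.S s (r s)))) (Icc 0 P.T) :=
    (hinvc.clm_apply (h.continuous_S.continuousOn.clm_apply hrc)).neg
  -- In the coordinates X⁻¹ξ the closed-loop dynamics disappears and only the forcing by r remains.
  have hd : ∀ s ∈ Icc 0 P.T, HasDerivAt (fun s => Ring.inverse (X s) (ξ s))
      (-(Ring.inverse (X s) (P.S s (r s)))) s := fun s hs => by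
    refine ((hXY.inverse_hasDerivAt h hs.2).clm_apply (hξ s)).congr_deriv ?_
    simp only [hr, neg_apply, mul_apply_eq_comp, sub_apply,
      ContinuousLinearMap.comp_apply, map_sub, hXY.X_inverse_apply h hs.2]
    abel
  have hsub : uIcc 0 t ⊆ Icc 0 P.T := uIcc_subset_Icc h.zero_mem ht
  have hI : IntervalIntegrable (fun s => -(Ring.inverse (X s) (P.S s (r s)))) volume 0 t :=
    (hFc.mono hsub).intervalIntegrable
  have hftc := intervalIntegral.integral_eq_sub_of_hasDerivAt (fun s hs => hd s (hsub hs)) hI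
  have hrep : ξ t = X t (Ring.inverse (X 0) (ξ 0)) +
      ∫ s in (0 : ℝ)..t, X t (-(Ring.inverse (X s) (P.S s (r s)))) := by
    rw [(X t).intervalIntegral_comp_comm hI, hftc, map_sub, hXY.X_inverse_apply h ht.2]
    abel
  have hdecay : ∀ s ∈ Icc 0 t, ∀ z, ‖X t (Ring.inverse (X s) z)‖ ≤
      c.cZ * Real.exp (-c.ρZ * (t - s)) * ‖z‖ := fun s hs z => by
    have := (hXY.isHamiltonian (Ring.inverse (X s) z)).norm_le_decay h hs.1 hs.2 ht.2
    simpa only [hXY.X_inverse_apply h (hs.2.trans ht.2)] using this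
  set D : ℝ := c.cZ ^ 2 * (c.lamB ^ 2 / c.γR) * Real.exp (-c.ρZ * (P.T - t)) * ‖g‖ with hD
  have hbound : ‖∫ s in (0 : ℝ)..t, X t (-(Ring.inverse (X s) (P.S s (r s))))‖ ≤
      ∫ s in (0 : ℝ)..t, Real.exp (-(2 * c.ρZ) * (t - s)) * D := by
    refine intervalIntegral.norm_integral_le_of_norm_le ht.1
      (Filter.Eventually.of_forall fun s hs => ?_)
      ((by fun_prop : Continuous fun s => Real.exp (-(2 * c.ρZ) * (t - s)) * D).intervalIntegrable
        _ _)
    have hs' : s ∈ Icc 0 t := Ioc_subset_Icc_self hs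
    rw [map_neg, norm_neg]
    calc _ ≤ c.cZ * Real.exp (-c.ρZ * (t - s)) * ‖P.S s (r s)‖ := hdecay s hs' _
      _ ≤ c.cZ * Real.exp (-c.ρZ * (t - s)) * (c.lamB ^ 2 / c.γR *
          (c.cZ * Real.exp (-c.ρZ * (P.T - s)) * ‖g‖)) := by
          gcongr
          exact (P.S s).le_of_opNorm_le_of_le (h.norm_S_le s)
            (norm_costate_sub_feedback_le h hXY hξ hq hT ⟨hs'.1, hs'.2.trans ht.2⟩)
      _ = Real.exp (-c.ρZ * (t - s) + -c.ρZ * (P.T - s)) *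
          (c.cZ ^ 2 * (c.lamB ^ 2 / c.γR) * ‖g‖) := by
          rw [Real.exp_add]; ring
      -- The identity (t - s) + (T - s) = 2(t - s) + (T - t) takes the wanted factor out of the
      -- integral and leaves an integrable kernel.
      _ = Real.exp (-(2 * c.ρZ) * (t - s) + -c.ρZ * (P.T - t)) *
          (c.cZ ^ 2 * (c.lamB ^ 2 / c.γR) * ‖g‖) := by ring_nf
      _ = _ := by rw [Real.exp_add, hD]; ring
  rw [hrep]
  refine (norm_add_le _ _).trans (add_le_add ?_ (hbound.trans ?_))
  · simpa using hdecay 0 ⟨le_rfl, ht.1⟩ (ξ 0)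
  · rw [intervalIntegral.integral_mul_const]
    calc _ ≤ 1 / (2 * c.ρZ) * D :=
          mul_le_mul_of_nonneg_right (integral_exp_backward_le hρ t) (by positivity)
      _ = _ := by rw [hD]; ring

end Sensitivity

namespace IsExtremal

variable {d : ℝ → Vec nd} {d0 l0 : Vec nx} {dT lT : Vec nd} {x p xp pp : ℝ → Vec nx}

/-- The forcing depends on d alone and cancels, so the difference is differentiable everywhere even
though each extremal need not be. -/
theorem sub_hasDerivAt (h : P.Regular c) {d0' : Vec nx} {dT' : Vec nd}
    (hE : P.IsExtremal d d0 dT x p) (hE' : P.IsExtremal d d0' dT' xp pp) (t : ℝ) :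
    HasDerivAt (fun t => xp t - x t) (P.At t (xp t - x t) - P.S t (pp t - p t)) t ∧
    HasDerivAt (fun t => pp t - p t)
      (-(P.Qt t (xp t - x t)) - ((P.At t)†) (pp t - p t)) t := by
  have ftc : ∀ {f : ℝ → Vec nx}, Continuous f → ∀ t,
      HasDerivAt (fun t => ∫ s in P.T..t, f s) (f t) t := fun hf t =>
    intervalIntegral.integral_hasDerivAt_right (hf.intervalIntegrable _ _)
      hf.aestronglyMeasurable.stronglyMeasurableAtFilter hf.continuousAt
  constructor
  · have e : (fun t => xp t - x t) = fun t => (xp P.T - x P.T) +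
        ((∫ s in P.T..t, (P.At s (xp s) - P.S s (pp s))) -
          ∫ s in P.T..t, (P.At s (x s) - P.S s (p s))) := by
      funext t
      rw [hE.state t, hE'.state t]
      abel
    rw [e]
    refine (((ftc (h.continuous_ham_state hE'.continuous_x hE'.continuous_p) t).sub
      (ftc (h.continuous_ham_state hE.continuous_x hE.continuous_p) t)).const_add _).congr_deriv ?_
    simp only [map_sub]
    abel
  · have e : (fun t => pp t - p t) = fun t => (pp P.T - p P.T) +
        ((∫ s in P.T..t, (-(P.Qt s (xp s)) - ((P.At s)†) (pp s))) -
          ∫ s in P.T..t, (-(P.Qt s (x s)) - ((P.At s)†) (p s))) := by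
      funext t
      rw [hE.costate t, hE'.costate t]
      abel
    rw [e]
    refine (((ftc (h.continuous_ham_costate hE'.continuous_x hE'.continuous_p) t).sub
      (ftc (h.continuous_ham_costate hE.continuous_x hE.continuous_p) t)).const_add
        _).congr_deriv ?_
    simp only [map_sub]
    abel

theorem control_sub (d : ℝ → Vec nd) (x p xp pp : ℝ → Vec nx) (t : ℝ) :
    P.control d xp pp t - P.control d x p t =
      -(P.Rinv t (P.H t (xp t - x t) + ((P.B t)†) (pp t - p t))) := by
  simp only [control, map_sub, map_add]
  abel

/-- Exponential decay of the sensitivity for extremals. -/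
theorem sensitivity (h : P.Regular c) (hE : P.IsExtremal d d0 dT x p)
    (hE' : P.IsExtremal d (d0 + l0) (dT + lT) xp pp) {t : ℝ} (ht : t ∈ Icc 0 P.T) :
    ‖xp t - x t‖ + ‖P.control d xp pp t - P.control d x p t‖ + ‖pp t - p t‖ ≤
      c.Lamb * (‖l0‖ * Real.exp (-c.ρZ * t) + ‖lT‖ * Real.exp (-c.ρZ * (P.T - t))) := by
  have hρ := c.ρZ_pos; have hZ := c.cZ_pos; have hγR := c.γR_pos; have hB := c.lamB_pos
  have hH := c.lamH_pos; have hG := c.lamG_pos; have hc₁ := c.c₁_pos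
  obtain ⟨X, Y, hXY⟩ := h.exists_fundamental
  have hd := hE.sub_hasDerivAt h hE'
  have hT : pp P.T - p P.T = P.QT (xp P.T - x P.T) + (P.GT†) lT := by
    rw [hE.terminal, hE'.terminal, map_add, map_sub]; abel
  have h0 : xp 0 - x 0 = l0 := by rw [hE.initial, hE'.initial]; abel
  have hg : ‖(P.GT†) lT‖ ≤ c.lamG * ‖lT‖ := (P.GT†).le_of_opNorm_le (norm_adjoint_le h.boundGT) _
  have hs := norm_state_le h hXY (fun t => (hd t).1) (fun t => (hd t).2) hT ht
  have hr := norm_costate_sub_feedback_le h hXY (fun t => (hd t).1) (fun t => (hd t).2) hT ht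
  rw [h0] at hs
  set ξ := xp t - x t with hξ
  set q := pp t - p t with hq
  have hY := hXY.norm_Y_apply_le h ht (Ring.inverse (X t) ξ)
  rw [hXY.X_inverse_apply h ht.2] at hY
  set M : ℝ := max c.cZ (c.cZ ^ 2 * c.lamB ^ 2 * c.lamG / (2 * c.ρZ * c.γR)) with hM
  have hM1 : c.cZ ≤ M := le_max_left _ _
  have hM2 : c.cZ ^ 2 * c.lamB ^ 2 * c.lamG / (2 * c.ρZ * c.γR) ≤ M := le_max_right _ _
  set e₀ := ‖l0‖ * Real.exp (-c.ρZ * t) with he₀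
  set e₁ := ‖lT‖ * Real.exp (-c.ρZ * (P.T - t)) with he₁
  have he₀0 : 0 ≤ e₀ := by positivity
  have he₁0 : 0 ≤ e₁ := by positivity
  have b1 : ‖ξ‖ ≤ M * (e₀ + e₁) := by
    calc ‖ξ‖ ≤ _ := hs
      _ ≤ c.cZ * Real.exp (-c.ρZ * t) * ‖l0‖ + c.cZ ^ 2 * (c.lamB ^ 2 / c.γR) / (2 * c.ρZ) *
          Real.exp (-c.ρZ * (P.T - t)) * (c.lamG * ‖lT‖) := by gcongr
      _ = c.cZ * e₀ + c.cZ ^ 2 * c.lamB ^ 2 * c.lamG / (2 * c.ρZ * c.γR) * e₁ := by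
          rw [he₀, he₁]; field_simp
      _ ≤ M * e₀ + M * e₁ := by gcongr
      _ = _ := by ring
  -- Split q into r and the Riccati feedback YX⁻¹ξ: r contributes λ_G, the feedback contributes c₁.
  have b2 : ‖q‖ ≤ (c.c₁ + c.lamG) * (M * (e₀ + e₁)) := by
    have i1 : ‖q‖ ≤ ‖q - Y t (Ring.inverse (X t) ξ)‖ + ‖Y t (Ring.inverse (X t) ξ)‖ := by
      simpa using norm_add_le (q - Y t (Ring.inverse (X t) ξ)) (Y t (Ring.inverse (X t) ξ))
    have i2 : ‖q - Y t (Ring.inverse (X t) ξ)‖ ≤ c.lamG * (M * (e₀ + e₁)) := by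
      calc _ ≤ _ := hr
        _ ≤ c.cZ * Real.exp (-c.ρZ * (P.T - t)) * (c.lamG * ‖lT‖) := by gcongr
        _ = c.lamG * (c.cZ * e₁) := by rw [he₁]; ring
        _ ≤ c.lamG * (M * (e₀ + e₁)) := by
          have : 0 ≤ M := hZ.le.trans hM1
          gcongr
          linarith
    have i3 := hY.trans (mul_le_mul_of_nonneg_left b1 hc₁.le)
    linarith
  have b3 : ‖P.control d xp pp t - P.control d x p t‖ ≤
      1 / c.γR * (c.lamH * ‖ξ‖ + c.lamB * ‖q‖) := by
    rw [control_sub, norm_neg]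
    refine (h.norm_Rinv_apply_le t _).trans (mul_le_mul_of_nonneg_left ?_ (by positivity))
    exact (norm_add_le _ _).trans (add_le_add ((P.H t).le_of_opNorm_le (h.boundH t) _)
      (((P.B t)†).le_of_opNorm_le (norm_adjoint_le (h.boundB t)) _))
  calc _ ≤ ‖ξ‖ + 1 / c.γR * (c.lamH * ‖ξ‖ + c.lamB * ‖q‖) + ‖q‖ := by gcongr
    _ = (1 + c.lamH / c.γR) * ‖ξ‖ + (1 + c.lamB / c.γR) * ‖q‖ := by ring
    _ ≤ (1 + c.lamH / c.γR) * (M * (e₀ + e₁)) +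
        (1 + c.lamB / c.γR) * ((c.c₁ + c.lamG) * (M * (e₀ + e₁))) := by gcongr
    _ = c.Lamb * (e₀ + e₁) := by rw [LQConstants.Lamb, ← hM]; ring

end IsExtremal

theorem Regular.exists_isOptimal (h : P.Regular c) {d : ℝ → Vec nd} (hd : P.IsBoundedInput d)
    (d0 : Vec nx) (dT : Vec nd) : ∃ x u p, P.IsOptimal d d0 dT x u p ∧
      (ContinuousOn d (Icc 0 P.T) → ContinuousOn u (Icc 0 P.T)) := by
  obtain ⟨x, p, hE⟩ := h.exists_isExtremal hd d0 dT
  exact ⟨x, _, p, hE.isOptimal h hd, fun hdc =>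
    continuousOn_control h hdc hE.continuous_x hE.continuous_p⟩

theorem Regular.sensitivity (h : P.Regular c) {d : ℝ → Vec nd} (hd : P.IsBoundedInput d)
    {d0 l0 : Vec nx} {dT lT : Vec nd} {x p xp pp : ℝ → Vec nx} {u up : ℝ → Vec nu}
    (hO : P.IsOptimal d d0 dT x u p) (hO' : P.IsOptimal d (d0 + l0) (dT + lT) xp up pp) :
    (∀ᵐ t ∂(volume.restrict (Icc 0 P.T)), ‖xp t - x t‖ + ‖up t - u t‖ + ‖pp t - p t‖ ≤
      c.Lamb * (‖l0‖ * Real.exp (-c.ρZ * t) + ‖lT‖ * Real.exp (-c.ρZ * (P.T - t)))) ∧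
    (ContinuousOn u (Icc 0 P.T) → ContinuousOn up (Icc 0 P.T) → ∀ t ∈ Icc 0 P.T,
      ‖xp t - x t‖ + ‖up t - u t‖ + ‖pp t - p t‖ ≤
        c.Lamb * (‖l0‖ * Real.exp (-c.ρZ * t) + ‖lT‖ * Real.exp (-c.ρZ * (P.T - t)))) := by
  obtain ⟨ex, ep, hE⟩ := h.exists_isExtremal hd d0 dT
  obtain ⟨ex', ep', hE'⟩ := h.exists_isExtremal hd (d0 + l0) (dT + lT)
  obtain ⟨hx, hp, hu⟩ := hE.eq_of_isOptimal h hd hO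
  obtain ⟨hx', hp', hu'⟩ := hE'.eq_of_isOptimal h hd hO'
  have key : ∀ t ∈ Icc 0 P.T, up t - u t = P.control d ex' ep' t - P.control d ex ep t →
      ‖xp t - x t‖ + ‖up t - u t‖ + ‖pp t - p t‖ ≤
        c.Lamb * (‖l0‖ * Real.exp (-c.ρZ * t) + ‖lT‖ * Real.exp (-c.ρZ * (P.T - t))) := by
    intro t ht htu
    rw [htu, hx t ht, hp t ht, hx' t ht, hp' t ht]
    exact hE.sensitivity h hE' ht
  have hae : (fun t => up t - u t) =ᵐ[volume.restrict (Icc 0 P.T)]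
      fun t => P.control d ex' ep' t - P.control d ex ep t := by
    filter_upwards [hu, hu'] with t e1 e2
    rw [e1, e2]
  refine ⟨?_, fun huc huc' t ht => key t ht ?_⟩
  · filter_upwards [hae, ae_restrict_mem measurableSet_Icc] with t e1 ht using key t ht e1
  -- The difference of the two extremal controls is continuous for any d, because the term Wᵀd
  -- cancels; two continuous functions that agree almost everywhere agree on the whole interval.
  · refine Measure.eqOn_Icc_of_ae_eq volume h.T_pos.ne hae (huc'.sub huc) ?_ ht
    simp only [IsExtremal.control_sub]
    exact ((h.continuous_Rinv.clm_apply ((h.contH.clm_apply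
      (hE'.continuous_x.sub hE.continuous_x)).add ((continuous_adjoint h.contB).clm_apply
        (hE'.continuous_p.sub hE.continuous_p)))).neg).continuousOn

/-! ### Extension of the coefficients to the real line -/

/-- The problem whose coefficients are extended to be constant on both sides of the horizon. -/
def extend (P : LQProblem nx nu nd) (hT : 0 ≤ P.T) : LQProblem nx nu nd where
  T := P.T
  A t := P.A (projIcc 0 P.T hT t)
  B t := P.B (projIcc 0 P.T hT t)
  C t := P.C (projIcc 0 P.T hT t)
  Q t := P.Q (projIcc 0 P.T hT t)
  H t := P.H (projIcc 0 P.T hT t)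
  R t := P.R (projIcc 0 P.T hT t)
  G t := P.G (projIcc 0 P.T hT t)
  W t := P.W (projIcc 0 P.T hT t)
  QT := P.QT
  GT := P.GT

theorem projIcc_coe_of_mem {T t : ℝ} (hT : 0 ≤ T) (ht : t ∈ Icc 0 T) :
    (projIcc 0 T hT t : ℝ) = t := by
  rw [projIcc_of_mem hT ht]

theorem gramian_extend (hT : 0 ≤ P.T) {t₀ t₁ : ℝ} (h₀ : t₀ ∈ Icc 0 P.T) (h₁ : t₁ ∈ Icc 0 P.T) :
    gramian (P.extend hT).A (P.extend hT).B t₀ t₁ = gramian P.A P.B t₀ t₁ := by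
  have hA : EqOn (P.extend hT).A P.A (Icc 0 P.T) := fun t ht => by
    simp only [extend, projIcc_coe_of_mem hT ht]
  refine intervalIntegral.integral_congr fun s hs => ?_
  have hs' := uIcc_subset_Icc h₀ h₁ hs
  have hB : (P.extend hT).B s = P.B s := by simp only [extend, projIcc_coe_of_mem hT hs']
  simp only [evolution_congr hA hs' h₀, hB]

theorem Assumptions.regular_extend (hP : P.Assumptions c) (hT : 0 ≤ P.T) :
    (P.extend hT).Regular c := by
  have hc : ∀ {E : Type} [TopologicalSpace E] {f : ℝ → E}, ContinuousOn f (Icc 0 P.T) →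
      Continuous fun t => f (projIcc 0 P.T hT t) := fun hf =>
    hf.comp_continuous (continuous_subtype_val.comp continuous_projIcc)
      fun t => (projIcc 0 P.T hT t).2
  have hm : ∀ t, (projIcc 0 P.T hT t : ℝ) ∈ Icc 0 P.T := fun t => (projIcc 0 P.T hT t).2
  exact {
    σ_lt_T := hP.σ_lt_T
    contA := hc hP.contA
    contB := hc hP.contB
    contC := hc hP.contC
    contQ := hc hP.contQ
    contH := hc hP.contH
    contR := hc hP.contR
    contG := hc hP.contG
    contW := hc hP.contW
    boundA := fun t => hP.boundA _ (hm t)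
    boundB := fun t => hP.boundB _ (hm t)
    boundC := fun t => hP.boundC _ (hm t)
    boundQ := fun t => hP.boundQ _ (hm t)
    boundH := fun t => hP.boundH _ (hm t)
    boundR := fun t => hP.boundR _ (hm t)
    boundG := fun t => hP.boundG _ (hm t)
    boundW := fun t => hP.boundW _ (hm t)
    boundGT := hP.boundGT
    controllable := fun t₀ ht₀ => by
      obtain ⟨t₁, ht₁, h1, h2, -, -⟩ := hP.controllable t₀ ht₀
      have hσ := c.σ_pos
      -- As t₀ ≤ T - σ, the controllability interval stays inside the horizon, where the extension
      -- changes nothing.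
      have m0 : t₀ ∈ Icc 0 P.T := ⟨ht₀.1, ht₀.2.trans (show P.T - c.σ ≤ P.T by linarith)⟩
      have m1 : t₁ ∈ Icc 0 P.T :=
        ⟨ht₀.1.trans ht₁.1, ht₁.2.trans (by have : t₀ ≤ P.T - c.σ := ht₀.2; linarith)⟩
      refine ⟨t₁, ht₁, ?_⟩
      rw [gramian_extend hT m0 m1]
      exact ⟨h1, h2⟩
    coerciveR := fun t => hP.coerciveR _ (hm t)
    coerciveQ := fun t => hP.coerciveQ _ (hm t)
    coerciveQT := hP.coerciveQT
    boundQT := hP.boundQT }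

theorem isAdmissible_extend (hT : 0 ≤ P.T) {d : ℝ → Vec nd} {d0 : Vec nx} {x : ℝ → Vec nx}
    {u : ℝ → Vec nu} : (P.extend hT).IsAdmissible d d0 x u ↔ P.IsAdmissible d d0 x u := by
  have e : ∀ t ∈ Icc 0 P.T, (∫ s in (0 : ℝ)..t, ((P.extend hT).A s (x s) +
      (P.extend hT).B s (u s) + (P.extend hT).C s (d s))) =
      ∫ s in (0 : ℝ)..t, (P.A s (x s) + P.B s (u s) + P.C s (d s)) := fun t ht =>
    intervalIntegral.integral_congr fun s hs => by
      simp only [extend, projIcc_coe_of_mem hT (uIcc_subset_Icc ⟨le_rfl, hT⟩ ht hs)]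
  exact ⟨fun h => ⟨h.control, h.continuousOn, fun t ht => (e t ht) ▸ h.dynamics t ht⟩,
    fun h => ⟨h.control, h.continuousOn, fun t ht => (e t ht).symm ▸ h.dynamics t ht⟩⟩

theorem cost_extend (hT : 0 ≤ P.T) (d : ℝ → Vec nd) (dT : Vec nd) (x : ℝ → Vec nx)
    (u : ℝ → Vec nu) : (P.extend hT).cost d dT x u = P.cost d dT x u := by
  unfold cost
  congr 2
  refine intervalIntegral.integral_congr fun s hs => ?_
  have hs' : s ∈ Icc 0 P.T := uIcc_subset_Icc ⟨le_rfl, hT⟩ ⟨hT, le_rfl⟩ hs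
  simp only [extend, projIcc_coe_of_mem hT hs']

theorem isOptimal_extend (hT : 0 ≤ P.T) {d : ℝ → Vec nd} {d0 : Vec nx} {dT : Vec nd}
    {x p : ℝ → Vec nx} {u : ℝ → Vec nu} :
    (P.extend hT).IsOptimal d d0 dT x u p ↔ P.IsOptimal d d0 dT x u p := by
  have e : ∀ t ∈ Icc 0 P.T, (∫ s in t..P.T, ((P.extend hT).Q s (x s) +
      (((P.extend hT).H s)†) (u s) + (((P.extend hT).G s)†) (d s) +
        (((P.extend hT).A s)†) (p s))) =
      ∫ s in t..P.T, (P.Q s (x s) + ((P.H s)†) (u s) + ((P.G s)†) (d s) + ((P.A s)†) (p s)) :=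
    fun t ht => intervalIntegral.integral_congr fun s hs => by
      simp only [extend, projIcc_coe_of_mem hT (uIcc_subset_Icc ht ⟨hT, le_rfl⟩ hs)]
  constructor
  · intro h
    refine ⟨(isAdmissible_extend hT).1 h.admissible, fun y w hyw => ?_, h.adjoint_continuousOn,
      fun t ht => ?_⟩
    · rw [← cost_extend hT, ← cost_extend hT]
      exact h.optimal y w ((isAdmissible_extend hT).2 hyw)
    · rw [← e t ht]
      exact h.adjoint_equation t ht
  · intro h
    refine ⟨(isAdmissible_extend hT).2 h.admissible, fun y w hyw => ?_, h.adjoint_continuousOn,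
      fun t ht => ?_⟩
    · rw [cost_extend hT, cost_extend hT]
      exact h.optimal y w ((isAdmissible_extend hT).1 hyw)
    · exact (h.adjoint_equation t ht).trans (congrArg _ (e t ht).symm)

end LQProblem

end

theorem mainTheorem3 {nx nu nd : ℕ} (c : LQConstants) :
    0 < c.Lamb ∧ 0 < c.ρZ ∧
    ∀ P : LQProblem nx nu nd, P.Assumptions c →
    ∀ d : ℝ → Vec nd, P.IsBoundedInput d →
      -- for all boundary parameters there is an optimal state, control and adjoint
      (∀ (d0 : Vec nx) (dT : Vec nd), ∃ (x : ℝ → Vec nx) (u : ℝ → Vec nu) (p : ℝ → Vec nx),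
        P.IsOptimal d d0 dT x u p ∧
        (ContinuousOn d (Set.Icc 0 P.T) → ContinuousOn u (Set.Icc 0 P.T))) ∧
      -- sensitivity to the boundary parameters
      ∀ (d0 l0 : Vec nx) (dT lT : Vec nd)
        (x : ℝ → Vec nx) (u : ℝ → Vec nu) (p : ℝ → Vec nx)
        (xp : ℝ → Vec nx) (up : ℝ → Vec nu) (pp : ℝ → Vec nx),
        P.IsOptimal d d0 dT x u p →
        P.IsOptimal d (d0 + l0) (dT + lT) xp up pp →
        (∀ᵐ t ∂(MeasureTheory.volume.restrict (Set.Icc 0 P.T)),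
          ‖xp t - x t‖ + ‖up t - u t‖ + ‖pp t - p t‖ ≤
            c.Lamb * (‖l0‖ * Real.exp (-c.ρZ * t) + ‖lT‖ * Real.exp (-c.ρZ * (P.T - t)))) ∧
        (ContinuousOn u (Set.Icc 0 P.T) → ContinuousOn up (Set.Icc 0 P.T) →
          ∀ t ∈ Set.Icc 0 P.T,
            ‖xp t - x t‖ + ‖up t - u t‖ + ‖pp t - p t‖ ≤
              c.Lamb * (‖l0‖ * Real.exp (-c.ρZ * t) + ‖lT‖ * Real.exp (-c.ρZ * (P.T - t)))) := by
  refine ⟨c.Lamb_pos, c.ρZ_pos, fun P hP d hd => ?_⟩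
  have hT : 0 ≤ P.T := (c.σ_pos.trans hP.σ_lt_T).le
  have h := hP.regular_extend hT
  refine ⟨fun d0 dT => ?_, fun d0 l0 dT lT x u p xp up pp hO hO' => ?_⟩
  · obtain ⟨x, u, p, hO, hu⟩ := h.exists_isOptimal (d := d) hd d0 dT
    exact ⟨x, u, p, (LQProblem.isOptimal_extend hT).1 hO, hu⟩
  · exact h.sensitivity (d := d) hd ((LQProblem.isOptimal_extend hT).2 hO)
      ((LQProblem.isOptimal_extend hT).2 hO')
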